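/- Let $k\in\{\infty,\omega\}$, let $\Omega\subset\mathbb R^n\times\mathbb R^m$ be open, let $f:\Omega\to\mathbb R^n$ be of class $C^k$ ($C^\omega$ means real analytic), and let $(\bar x,\bar u)\in\Omega$. Consider the control system $\dot x=f(x,u)$ with state $x\in\mathbb R^n$ and control $u\in\mathbb R^m$. *Solutions and linearizability.* A solution that remains in an open set $\Omega_0$ is a map $\gamma=(\gamma_{\rm I},\gamma_{\rm II}):I\to\Omega_0$ on a real interval $I$, measurable, locally bounded (bounded on compact subintervals of $I$), with $\gamma_{\rm I}$ absolutely continuous on compact subintervals of $I$, such that for all $[T_1,T_2]\subset I$ the function $f\circ\gamma$ is integrable on $[T_1,T_2]$ and $\gamma_{\rm I}(T_2)-\gamma_{\rm I}(T_1)=\int_{T_1}^{T_2}f(\gamma(t))\,dt$. A homeomorphism $\chi:\Omega_0\to\Omega_0'$ between open subsets of $\mathbb R^{n}\times\mathbb R^m$ conjugates $\dot x=f(x,u)$ to $\dot z=g(z,v)$ if, for every real interval $I$, a map $\gamma:I\to\Omega_0$ is a solution of the first system that remains in $\Omega_0$ if and only if $\chi\circ\gamma$ is a solution of the second one that remains in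 $\Omega_0'$. It is a quasi-$C^k$ diffeomorphism if $\chi(x,u)=(\chi_{\rm I}(x),\chi_{\rm II}(x,u))$ where $\chi_{\rm I}$ is a $C^k$ diffeomorphism from the projection of $\Omega_0$ to $\mathbb R^n$ onto that of $\Omega_0'$. The system is locally quasi-$C^k$ linearizable at $(\bar x,\bar u)$ if some quasi-$C^k$ diffeomorphism, defined on an open neighborhood $\Omega_0\subset\Omega$ of $(\bar x,\bar u)$, conjugates it to a linear system $\dot z=Az+Bv$ ($z\in\mathbb R^n$, $v\in\mathbb R^m$) that is controllable, i.e. $\operatorname{rank}(B,AB,\dots,A^{n-1}B)=n$. *Generalized range and distributions.* For open sets $\mathcal X\subset\mathbb R^n$, $\mathcal U\subset\mathbb R^m$ with $\mathcal X\times\mathcal U\subset\Omega$ and $(x,u)\in\mathcal X\times\mathcal U$, let $D(x,u)\subset\mathbb R^n$ be the linear span of all limits of $\frac{f(x,w_i)-f(x,u)}{\|f(x,w_i)-f(x,u)\|}$ along sequences $(w_i)$ in $\mathcal U$ with $w_i\to u$ and $f(x,w_i)\ne f(x,u)$. For a distribution $\Delta$ on $\mathcal X$ (a subspace $\Delta(x)\subset\mathbb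 R^n$ for each $x\in\mathcal X$) and a vector field $F$ on $\mathcal X$, $(\Delta+[F,\Delta])(x)$ is the span of $\Delta(x)$ and of the values at $x$ of all Lie brackets $[F,Y]$, with $Y$ a $C^k$ vector field with values in $\Delta$ on an open neighborhood of $x$ in $\mathcal X$. Call $\Delta$ integrable if $\dim\Delta(x)$ is constant on $\mathcal X$ and $[Y,Z]$ takes values in $\Delta$ whenever $Y,Z$ are $C^k$ vector fields with values in $\Delta$ on an open subset of $\mathcal X$. *Fibrations.* A $C^0$ fibration with fiber $\mathcal F$ over $\mathcal B$ is a continuous map $g:\mathcal E\to\mathcal B$ such that each $\xi\in\mathcal B$ has a neighborhood $\mathcal O$ in $\mathcal B$ for which there is a homeomorphism $\psi:g^{-1}(\mathcal O)\to\mathcal O\times\mathcal F$ whose first component is $g$. **Theorem.** The system $\dot x=f(x,u)$ is locally quasi-$C^k$ linearizable at $(\bar x,\bar u)$ if and only if there are open neighborhoods $\mathcal X$ of $\bar x$ in $\mathbb R^n$ and $\mathcal U$ of $\bar u$ in $\mathbb R^m$, with $\mathcal X\times\mathcal U\subset\Omega$, such that: 1. $D(x,u)$ does not depend on $u$ for $(x,u)\in\mathcal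 X\times\mathcal U$. 2. Define distributions on $\mathcal X$ by $\Delta_0(x)=D(x,\bar u)$ and $\Delta_{j+1}=\Delta_j+[f_{\bar u},\Delta_j]$, where $f_{\bar u}(x)=f(x,\bar u)$. Then $\Delta_j$ is integrable for $0\le j\le n-1$, and $\Delta_{n-1}$ has rank $n$ (for $n=0$ this condition is void). 3. Denoting by $r_1$ the constant rank of $\Delta_0$, the map $F:\mathcal X\times\mathcal U\to\mathcal X\times\mathbb R^n$, $F(x,u)=(x,f(x,u))$, restricts to a $C^0$ fibration $\mathcal W\to F(\mathcal W)$ with fiber $\mathbb R^{m-r_1}$ on some neighborhood $\mathcal W$ of $(\bar x,\bar u)$ in $\mathcal X\times\mathcal U$. -/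

import Mathlib

open Set Filter Topology MeasureTheory
open scoped ContDiff

noncomputable section

namespace ControlSys

/-- The space `ℝⁿ` with its Euclidean norm. -/
abbrev Vec (n : ℕ) : Type := EuclideanSpace ℝ (Fin n)

/-! ### Control systems, solutions, conjugacy -/

/-- `γ`, restricted to the interval `I`, is a solution of the control system `ẋ = f (x, u)`
that remains in `Ω`. The state is `(γ t).1` and the control is `(γ t).2`.
Only the values of `γ` on `I` and those of `f` on `Ω` matter. -/
structure IsSolution {n m : ℕ} (f : Vec n × Vec m → Vec n) (Ω : Set (Vec n × Vec m))
    (I : Set ℝ) (γ : ℝ → Vec n × Vec m) : Prop where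
  remains : ∀ t ∈ I, γ t ∈ Ω
  /-- Lebesgue measurability on `I`. -/
  measurable : AEMeasurable γ (volume.restrict I)
  locallyBounded : ∀ T₁ T₂ : ℝ, Icc T₁ T₂ ⊆ I → Bornology.IsBounded (γ '' Icc T₁ T₂)
  absolutelyContinuous : ∀ T₁ T₂ : ℝ, T₁ ≤ T₂ → Icc T₁ T₂ ⊆ I →
    AbsolutelyContinuousOnInterval (fun t => (γ t).1) T₁ T₂
  /-- The integral equation; existence of the integral is part of the claim. -/
  integralEq : ∀ T₁ T₂ : ℝ, T₁ ≤ T₂ → Icc T₁ T₂ ⊆ I →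
    IntervalIntegrable (fun t => f (γ t)) volume T₁ T₂ ∧
      (γ T₂).1 - (γ T₁).1 = ∫ t in T₁..T₂, f (γ t)

/-- The homeomorphism `χ : Ω → Ω'` (with `Ω = χ.source` and `Ω' = χ.target` open) conjugates
`ẋ = f (x, u)` and `ż = g (z, v)`: for every real interval `I`, a map `γ : I → Ω` is a solution of
the first system that remains in `Ω` iff `χ ∘ γ` is a solution of the second one that remains
in `Ω'`. -/
def Conjugates {n m : ℕ} (f g : Vec n × Vec m → Vec n)
    (χ : OpenPartialHomeomorph (Vec n × Vec m) (Vec n × Vec m)) : Prop :=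
  ∀ I : Set ℝ, I.OrdConnected → ∀ γ : ℝ → Vec n × Vec m, (∀ t ∈ I, γ t ∈ χ.source) →
    (IsSolution f χ.source I γ ↔ IsSolution g χ.target I (fun t => χ (γ t)))

/-- `χ` is a quasi-`C^k` diffeomorphism: a homeomorphism `Ω → Ω'` of the form
`χ (x, u) = (φ x, χ₂ (x, u))`, where `φ` is a `C^k` diffeomorphism from the projection of `Ω` to
the state space onto the projection of `Ω'`. -/
def IsQuasiDiffeo {n m : ℕ} (k : WithTop ℕ∞)
    (χ : OpenPartialHomeomorph (Vec n × Vec m) (Vec n × Vec m)) : Prop :=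
  ∃ φ : OpenPartialHomeomorph (Vec n) (Vec n),
    φ.source = Prod.fst '' χ.source ∧ φ.target = Prod.fst '' χ.target ∧
    ContDiffOn ℝ k φ φ.source ∧ ContDiffOn ℝ k φ.symm φ.target ∧
    ∀ p ∈ χ.source, (χ p).1 = φ p.1

/-- The system `ẋ = f (x, u)`, considered on the open set `Ω`, is locally quasi-`C^k` conjugate at
`p` to `ż = g (z, v)`. -/
def LocallyQuasiConjugateAt {n m : ℕ} (k : WithTop ℕ∞) (f : Vec n × Vec m → Vec n)
    (Ω : Set (Vec n × Vec m)) (g : Vec n × Vec m → Vec n) (p : Vec n × Vec m) : Prop :=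
  ∃ χ : OpenPartialHomeomorph (Vec n × Vec m) (Vec n × Vec m),
    p ∈ χ.source ∧ χ.source ⊆ Ω ∧ IsQuasiDiffeo k χ ∧ Conjugates f g χ

/-- The right-hand side `A z + B v` of a linear control system. -/
def linearRHS {n m : ℕ} (A : Matrix (Fin n) (Fin n) ℝ) (B : Matrix (Fin n) (Fin m) ℝ)
    (p : Vec n × Vec m) : Vec n :=
  Matrix.toEuclideanLin A p.1 + Matrix.toEuclideanLin B p.2

/-- The block matrix `(B, A B, …, A^{n-1} B)`. -/
def kalmanMatrix {n m : ℕ} (A : Matrix (Fin n) (Fin n) ℝ) (B : Matrix (Fin n) (Fin m) ℝ) :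
    Matrix (Fin n) (Fin n × Fin m) ℝ :=
  Matrix.of fun i q => (A ^ (q.1 : ℕ) * B) i q.2

/-- Kalman's criterion for controllability of `ż = A z + B v`. -/
def IsControllable {n m : ℕ} (A : Matrix (Fin n) (Fin n) ℝ) (B : Matrix (Fin n) (Fin m) ℝ) :
    Prop :=
  (kalmanMatrix A B).rank = n

/-- The system `ẋ = f (x, u)`, considered on the open set `Ω`, is locally quasi-`C^k` linearizable
at `p`: it is locally quasi-`C^k` conjugate there to a controllable linear system. -/
def LocallyQuasiLinearizableAt {n m : ℕ} (k : WithTop ℕ∞) (f : Vec n × Vec m → Vec n)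
    (Ω : Set (Vec n × Vec m)) (p : Vec n × Vec m) : Prop :=
  ∃ (A : Matrix (Fin n) (Fin n) ℝ) (B : Matrix (Fin n) (Fin m) ℝ),
    IsControllable A B ∧ LocallyQuasiConjugateAt k f Ω (linearRHS A B) p

/-! ### The generalized range -/

/-- All limits of unit vectors `(f (x, wᵢ) - f (x, u)) / ‖f (x, wᵢ) - f (x, u)‖` along sequences
`wᵢ → u` in `U` with `f (x, wᵢ) ≠ f (x, u)`. -/
def limitDirections {n m : ℕ} (f : Vec n × Vec m → Vec n) (U : Set (Vec m))
    (x : Vec n) (u : Vec m) : Set (Vec n) :=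
  {y | ∃ w : ℕ → Vec m, (∀ i, w i ∈ U) ∧ (∀ i, f (x, w i) ≠ f (x, u)) ∧
    Tendsto w atTop (𝓝 u) ∧
    Tendsto (fun i => ‖f (x, w i) - f (x, u)‖⁻¹ • (f (x, w i) - f (x, u))) atTop (𝓝 y)}

/-- The generalized range `D (x, u)`. -/
def genRange {n m : ℕ} (f : Vec n × Vec m → Vec n) (U : Set (Vec m))
    (x : Vec n) (u : Vec m) : Submodule ℝ (Vec n) :=
  Submodule.span ℝ (limitDirections f U x u)

/-! ### Distributions -/

/-- `Y` is a `C^k` vector field on the open set `V` with values in the distribution `Δ`. -/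
def IsSection {n : ℕ} (k : WithTop ℕ∞) (Δ : Vec n → Submodule ℝ (Vec n)) (V : Set (Vec n))
    (Y : Vec n → Vec n) : Prop :=
  IsOpen V ∧ ContDiffOn ℝ k Y V ∧ ∀ x ∈ V, Y x ∈ Δ x

/-- The distribution `Δ + [F, Δ]` on the open set `X`: its value at `x` is spanned by `Δ x` and by
the values at `x` of all Lie brackets `[F, Y]`, with `Y` a local `C^k` vector field in `Δ`
around `x`. -/
def addBracket {n : ℕ} (k : WithTop ℕ∞) (X : Set (Vec n)) (F : Vec n → Vec n)
    (Δ : Vec n → Submodule ℝ (Vec n)) (x : Vec n) : Submodule ℝ (Vec n) :=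
  Δ x ⊔ Submodule.span ℝ {v | ∃ (V : Set (Vec n)) (Y : Vec n → Vec n), V ⊆ X ∧ x ∈ V ∧
    IsSection k Δ V Y ∧ v = VectorField.lieBracket ℝ F Y x}

/-- The distribution `Δ` is integrable on the open set `X`: it has constant dimension and is closed
under Lie bracket. -/
def IsIntegrable {n : ℕ} (k : WithTop ℕ∞) (X : Set (Vec n))
    (Δ : Vec n → Submodule ℝ (Vec n)) : Prop :=
  (∃ r : ℕ, ∀ x ∈ X, Module.finrank ℝ (Δ x) = r) ∧
  ∀ (V : Set (Vec n)) (Y Z : Vec n → Vec n), V ⊆ X → IsSection k Δ V Y → IsSection k Δ V Z →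
    ∀ x ∈ V, VectorField.lieBracket ℝ Y Z x ∈ Δ x

/-- The flag `Δ₀ (x) = D (x, u₀)`, `Δ_{j+1} = Δ_j + [f_{u₀}, Δ_j]` on `X`, where `f_{u₀}` is the
vector field `x ↦ f (x, u₀)`. -/
def flag {n m : ℕ} (k : WithTop ℕ∞) (f : Vec n × Vec m → Vec n) (X : Set (Vec n))
    (U : Set (Vec m)) (u₀ : Vec m) : ℕ → Vec n → Submodule ℝ (Vec n)
  | 0 => fun x => genRange f U x u₀
  | j + 1 => addBracket k X (fun x => f (x, u₀)) (flag k f X U u₀ j)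

/-! ### Fibrations -/

/-- The map `g : E → B` is a `C⁰` fibration with fiber `F`: it is continuous and every point of `B`
has a neighborhood `O` with a trivializing homeomorphism `g⁻¹(O) ≃ O × F`. -/
def IsC0Fibration {E B : Type*} [TopologicalSpace E] [TopologicalSpace B]
    (F : Type*) [TopologicalSpace F] (g : E → B) : Prop :=
  Continuous g ∧ ∀ ξ : B, ∃ O ∈ 𝓝 ξ, ∃ ψ : ↥(g ⁻¹' O) ≃ₜ ↥O × F,
    ∀ p : ↥(g ⁻¹' O), ((ψ p).1 : B) = g p

end ControlSys

end

/-! Sufficiency. Let `F` be the drift `x ↦ f (x, u₀)` and `R` the value of the first distribution at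
`x₀`. If `h` is a first integral of `Δ_j` and `Y` a section of `Δ_j`, then `[F, Y] h = -Y (F h)`.
Hence the Lie derivative `L` along `F` sends first integrals of `Δ_{j+1}` to first integrals of
`Δ_j`, and a first integral of `Δ_j` whose Lie derivative also annihilates `Δ_j` annihilates
`Δ_{j+1}`. Frobenius (`exists_firstIntegrals`) supplies enough first integrals, and linear algebra
along this filtration (`exists_section_of_filtration`) selects functions `σ l`, linear in `l`, with
differential `l` at `x₀` and such that `L (σ l)` is again some `σ l'` when `l` annihilates `R`.
These functions are coordinates `φ` in which the drift is linear modulo `R` and the first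
distribution has values in `R` (`exists_linearizing_coordinates`).

Since the generalized range does not depend on the control, `f (x, u) - f (x, u₀)` stays in it, and
`φ' f = A φ + v` with `v` a continuous `R`-valued function of `(x, u)`. This `v` need not be a
submersion in `u`, so no smooth inversion is available. The fibration provides instead a continuous
`y` with `m - dim R` components such that `(x, f (x, u), y)` determines `(x, u)`. Then `(φ, v, y)`
is continuous and injective between spaces of equal dimension (`finrank_genRange_le_card` gives `dim
R ≤ m`), and invariance of domain makes it a homeomorphism. Almost everywhere differentiation of
Lipschitz trajectories (`IsSolution.transport`) turns the pointwise identity into a conjugacy.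

Necessity. Pulling back trajectories with constant linear control gives `φ' f = A φ + B v`, with `v`
the second component of `χ` (`fderiv_eq_of_conjugates`). Through the isomorphism `φ'`, the
generalized range becomes `Im B` and the flag becomes `Im B + ⋯ + A^j Im B`, which exhausts the
space by Kalman's criterion. The kernel of `B` provides the fibers.

Brouwer's theorem is obtained by a volume argument and yields invariance of domain. Frobenius is
proved for the smooth and analytic classes at once by the implicit function theorem in a space of
continuous curves: composition operators inherit the class of the map
(`exists_continuousMap_contDiffAt_postcomp`), hence so do flows. -/

noncomputable section

namespace ControlSys

section

open Metric

/-! ### Brouwer's fixed point theorem -/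

/-- For each endomorphism `A` the function `t ↦ det (1 + t A)` is a polynomial of degree at most
the dimension, so that its value at `1` is given by Lagrange interpolation. -/
theorem det_one_add_eq_interpolation {d : ℕ} {s : Finset ℕ} {v : ℕ → ℝ}
    (hv : Set.InjOn v s) (hs : d < s.card) (A : Vec d →L[ℝ] Vec d) :
    (1 + A).det =
      ∑ i ∈ s, (1 + v i • A).det * (Lagrange.basis s v i).eval 1 := by
  classical
  set b := (EuclideanSpace.basisFun (Fin d) ℝ).toBasis
  set M : Matrix (Fin d) (Fin d) ℝ := LinearMap.toMatrix b b (A : Vec d →ₗ[ℝ] Vec d) with hM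
  set q : Polynomial ℝ := Matrix.det
    ((Polynomial.X : Polynomial ℝ) • M.map Polynomial.C + (1 : Matrix (Fin d) (Fin d) ℝ).map
      Polynomial.C) with hq
  have hqe : ∀ t : ℝ, q.eval t = (1 + t • A).det := by
    intro t
    have h1 : (1 + t • A).det = Matrix.det (1 + t • M) := by
      rw [ContinuousLinearMap.det, ← LinearMap.det_toMatrix b]
      congr 1
      simp [hM, LinearMap.toMatrix_one]
    rw [h1, hq, ← Polynomial.coe_evalRingHom, RingHom.map_det]
    congr 1
    ext i j
    by_cases hij : i = j
    · subst hij; simp [Matrix.add_apply]; ring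
    · simp [Matrix.add_apply, hij]; ring
  have hdeg : q.degree < s.card := by
    refine lt_of_le_of_lt (Polynomial.degree_le_of_natDegree_le
      ((Polynomial.natDegree_det_X_add_C_le M 1))) ?_
    simpa using hs
  have := Lagrange.eq_interpolate hv hdeg
  have h2 := congrArg (Polynomial.eval 1) this
  rw [hqe, one_smul, Lagrange.interpolate_apply, Polynomial.eval_finsetSum] at h2
  rw [h2]
  refine Finset.sum_congr rfl fun i _ => ?_
  rw [Polynomial.eval_mul, Polynomial.eval_C, hqe]

theorem exists_mem_segment_norm_eq_one {d : ℕ} {x y : Vec d} (hx : ‖x‖ ≤ 1) (hy : 1 ≤ ‖y‖) :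
    ∃ s : Vec d, ‖s‖ = 1 ∧ dist x s ≤ dist x y := by
  have hc : Continuous fun t : ℝ => ‖AffineMap.lineMap x y t‖ := by
    simp only [AffineMap.lineMap_apply]
    fun_prop
  have := intermediate_value_Icc (zero_le_one (α := ℝ)) hc.continuousOn
  obtain ⟨t, ht, h⟩ := this (show (1 : ℝ) ∈ _ by simpa using ⟨hx, hy⟩)
  refine ⟨AffineMap.lineMap x y t, h, ?_⟩
  rw [dist_left_lineMap, Real.norm_of_nonneg ht.1]
  exact mul_le_of_le_one_left dist_nonneg ht.2

/-- A Lipschitz map on the closed unit ball which vanishes on the sphere, multiplied by a small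
number and added to the identity, is a bijection of the ball. -/
theorem bijOn_closedBall_of_lipschitz {d : ℕ} {r : Vec d → Vec d} {K : NNReal}
    (hL : LipschitzOnWith K (fun x => r x - x) (closedBall 0 1))
    (hs : ∀ x, ‖x‖ = 1 → r x = x) (hb : ∀ x ∈ closedBall (0 : Vec d) 1, ‖r x‖ ≤ 1)
    {t : ℝ} (ht0 : 0 ≤ t) (ht1 : t ≤ 1) (htK : t * K < 1) :
    BijOn (fun x => x + t • (r x - x)) (closedBall 0 1) (closedBall 0 1) := by
  classical
  rcases subsingleton_or_nontrivial (Vec d) with hE | hE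
  · have h0 : ∀ x : Vec d, x ∈ closedBall (0 : Vec d) 1 := fun x => by
      rw [Subsingleton.elim x 0]; simp
    exact ⟨fun x _ => h0 _, fun x _ y _ _ => Subsingleton.elim _ _,
      fun x hx => ⟨x, hx, Subsingleton.elim _ _⟩⟩
  -- Extension by zero keeps the Lipschitz constant on the whole space: a segment leaving the ball
  -- crosses the sphere, where `r x - x` vanishes.
  set g : Vec d → Vec d := fun x => if ‖x‖ ≤ 1 then r x - x else 0 with hg
  have hg1 : ∀ x, 1 ≤ ‖x‖ → g x = 0 := by
    intro x hx
    by_cases h : ‖x‖ ≤ 1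
    · simp [hg, h, hs x (le_antisymm h hx)]
    · simp [hg, h]
  have hg2 : ∀ x, ‖x‖ ≤ 1 → g x = r x - x := fun x hx => by simp [hg, hx]
  have key : ∀ x y : Vec d, ‖x‖ ≤ 1 → dist (g x) (g y) ≤ K * dist x y := by
    intro x y hx
    by_cases hy : ‖y‖ ≤ 1
    · rw [hg2 x hx, hg2 y hy]
      exact hL.dist_le_mul x (by simpa using hx) y (by simpa using hy)
    · push Not at hy
      obtain ⟨s, hs1, hs2⟩ := exists_mem_segment_norm_eq_one hx hy.le
      rw [hg1 y hy.le, ← hg1 s hs1.ge, hg2 x hx, hg2 s hs1.le]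
      exact (hL.dist_le_mul x (by simpa using hx) s (by simpa using hs1.le)).trans
        (by gcongr)
  have hgL : LipschitzWith K g := by
    refine LipschitzWith.of_dist_le_mul fun x y => ?_
    by_cases hx : ‖x‖ ≤ 1
    · exact key x y hx
    · by_cases hy : ‖y‖ ≤ 1
      · rw [dist_comm, dist_comm x]; exact key y x hy
      · push Not at hx hy
        rw [hg1 x hx.le, hg1 y hy.le, dist_self]; positivity
  -- The map is the identity plus a perturbation of Lipschitz constant `t * K < 1`, hence a
  -- bijection of the whole space.
  have happ : ApproximatesLinearOn (fun x => x + t • g x)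
      ((ContinuousLinearEquiv.refl ℝ (Vec d)) : Vec d →L[ℝ] Vec d) univ (t.toNNReal * K) := by
    intro x _ y _
    have : (fun x => x + t • g x) x - (fun x => x + t • g x) y -
        ((ContinuousLinearEquiv.refl ℝ (Vec d)) : Vec d →L[ℝ] Vec d) (x - y)
        = t • (g x - g y) := by
      simp [smul_sub]; abel
    rw [this, norm_smul, Real.norm_of_nonneg ht0, NNReal.coe_mul, Real.coe_toNNReal t ht0, mul_assoc]
    gcongr
    simpa [dist_eq_norm] using hgL.dist_le_mul x y
  have hc : (t.toNNReal * K) < ‖((ContinuousLinearEquiv.refl ℝ (Vec d)).symm :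
      Vec d →L[ℝ] Vec d)‖₊⁻¹ := by
    have : ‖((ContinuousLinearEquiv.refl ℝ (Vec d)).symm : Vec d →L[ℝ] Vec d)‖₊ = 1 := by
      have : ((ContinuousLinearEquiv.refl ℝ (Vec d)).symm : Vec d →L[ℝ] Vec d)
        = ContinuousLinearMap.id ℝ _ := rfl
      rw [this, ContinuousLinearMap.nnnorm_id]
    rw [this, inv_one, ← NNReal.coe_lt_coe]
    simpa [Real.coe_toNNReal t ht0] using htK
  have hsurj := happ.surjective (Or.inr hc)
  have hinj := happ.injective (Or.inr hc)
  have hmaps : MapsTo (fun x => x + t • (r x - x)) (closedBall 0 1) (closedBall (0 : Vec d) 1) := by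
    intro x hx
    have : x + t • (r x - x) = (1 - t) • x + t • r x := by module
    simp only [this]
    exact (convex_closedBall (0 : Vec d) 1) hx (by simpa using hb x hx) (by linarith) ht0 (by ring)
  refine ⟨hmaps, ?_, ?_⟩
  · intro x hx y hy hxy
    simp only [mem_closedBall, dist_zero_right] at hx hy
    have := @hinj ⟨x, mem_univ x⟩ ⟨y, mem_univ y⟩ (by simpa [hg2 x hx, hg2 y hy] using hxy)
    simpa using this
  · intro y hy
    obtain ⟨x, hx⟩ := hsurj y
    by_cases h : ‖x‖ ≤ 1
    · exact ⟨x, by simpa using h, by simpa [hg2 x h] using hx⟩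
    -- A preimage outside the ball would be a fixed point, since `g` vanishes there; but `y` lies in
    -- the ball.
    · push Not at h
      simp [hg1 x h.le] at hx
      simp [hx] at h hy
      linarith

/-- The integral over the ball of the Jacobian of `x + t (r x - x)` is a polynomial in `t`. For
small `t` the map is a bijection of the ball, so this polynomial equals the volume of the ball,
hence also at `t = 1`. There the Jacobian is that of `r`, which vanishes because `r` takes values in
the sphere. -/
theorem not_exists_smooth_retraction {d : ℕ} (r : Vec d → Vec d)
    (hr : ∀ x ∈ closedBall (0 : Vec d) 1, ContDiffAt ℝ 1 r x)
    (hs : ∀ x, ‖x‖ = 1 → r x = x) (hb : ∀ x ∈ closedBall (0 : Vec d) 1, ‖r x‖ = 1) : False := by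
  rcases subsingleton_or_nontrivial (Vec d) with hE | hE
  · have := hb 0 (by simp)
    simp [Subsingleton.elim (r 0) 0] at this
  set B : Set (Vec d) := closedBall 0 1 with hB
  have hBc : IsCompact B := isCompact_closedBall 0 1
  set g : Vec d → Vec d := fun x => r x - x with hg
  have hgd : ∀ x ∈ B, ContDiffAt ℝ 1 g x := fun x hx => (hr x hx).sub contDiffAt_id
  set A : Vec d → Vec d →L[ℝ] Vec d := fun x => fderiv ℝ g x with hA
  have hAc : ContinuousOn A B := fun x hx =>
    ((hgd x hx).fderiv_right (m := 0) (by norm_num)).continuousAt.continuousWithinAt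
  obtain ⟨K, hK⟩ : ∃ K : NNReal, ∀ x ∈ B, ‖A x‖₊ ≤ K := by
    obtain ⟨C, hC⟩ := hBc.exists_bound_of_continuousOn hAc
    refine ⟨C.toNNReal, fun x hx => ?_⟩
    rw [← NNReal.coe_le_coe]
    exact (hC x hx).trans (Real.le_coe_toNNReal C)
  have hL : LipschitzOnWith K g B :=
    Convex.lipschitzOnWith_of_nnnorm_fderiv_le (𝕜 := ℝ)
      (fun x (hx : x ∈ B) => (hgd x hx).differentiableAt one_ne_zero) hK
      (convex_closedBall (0 : Vec d) 1)
  -- positivity of the determinant for small parameters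
  obtain ⟨δ, hδ, hdet⟩ : ∃ δ > 0, ∀ M : Vec d →L[ℝ] Vec d, dist M 1 < δ → 0 < M.det := by
    have h1 : (1 : Vec d →L[ℝ] Vec d).det = 1 := by
      rw [ContinuousLinearMap.det]; exact LinearMap.det_id
    have : ∀ᶠ M in 𝓝 (1 : Vec d →L[ℝ] Vec d), 0 < M.det :=
      ContinuousLinearMap.continuous_det.continuousAt.eventually
        (lt_mem_nhds (h1.symm ▸ one_pos : (0 : ℝ) < (1 : Vec d →L[ℝ] Vec d).det))
    exact Metric.eventually_nhds_iff.mp this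
  -- For `t ≤ ε` both `t * K < 1`, which gives bijectivity, and `t * K < δ`, which makes the
  -- Jacobian positive, so that the absolute value in the change of variables disappears.
  set ε : ℝ := min 1 (min 1 δ / (K + 1)) / 2 with hε
  have hK1 : (0 : ℝ) < K + 1 := by positivity
  have hε0 : 0 < ε := by positivity
  have hεb : ∀ t, 0 ≤ t → t ≤ ε → t ≤ 1 ∧ t * K < 1 ∧ t * K < δ := by
    intro t ht0 ht
    have h1 : ε ≤ 1 := by
      have : min 1 (min 1 δ / (K + 1)) ≤ 1 := min_le_left _ _
      rw [hε]; linarith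
    have h2 : ε < min 1 δ / (K + 1) := by
      have h3 : min 1 (min 1 δ / ((K : ℝ) + 1)) ≤ min 1 δ / (K + 1) := min_le_right _ _
      have h4 : 0 < min 1 (min 1 δ / ((K : ℝ) + 1)) := by positivity
      rw [hε]; linarith
    rw [lt_div_iff₀ hK1] at h2
    have h3 : t * K ≤ ε * (K + 1) := by
      apply mul_le_mul ht (by linarith) (by positivity) hε0.le
    exact ⟨ht.trans h1, (h3.trans_lt h2).trans_le (min_le_left _ _),
      (h3.trans_lt h2).trans_le (min_le_right _ _)⟩
  have hvol : ∀ t, 0 ≤ t → t ≤ ε → ∫ x in B, (1 + t • A x).det = volume.real B := by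
    intro t ht0 htε
    obtain ⟨ht1, htK, htδ⟩ := hεb t ht0 htε
    have hbij := bijOn_closedBall_of_lipschitz hL hs (fun x hx => (hb x hx).le) ht0 ht1 htK
    have hder : ∀ x ∈ B, HasFDerivWithinAt (fun x => x + t • (r x - x)) (1 + t • A x) B x := by
      intro x hx
      have : HasFDerivAt g (A x) x := ((hgd x hx).differentiableAt (by norm_num)).hasFDerivAt
      exact ((hasFDerivAt_id x).add (this.const_smul t)).hasFDerivWithinAt
    have := integral_image_eq_integral_abs_det_fderiv_smul volume measurableSet_closedBall hder
      hbij.injOn (fun _ => (1 : ℝ))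
    rw [hbij.image_eq] at this
    simp only [integral_const, smul_eq_mul, mul_one, MeasurableSet.univ, measureReal_restrict_apply,
      univ_inter] at this
    rw [← hB] at this
    rw [this]
    refine setIntegral_congr_fun measurableSet_closedBall fun x hx => ?_
    refine (abs_of_pos (hdet _ ?_)).symm
    rw [dist_eq_norm, add_sub_cancel_left, norm_smul, Real.norm_of_nonneg ht0]
    refine lt_of_le_of_lt ?_ htδ
    gcongr
    exact hK x hx
  -- interpolation nodes
  set s : Finset ℕ := Finset.range (d + 1)
  set v : ℕ → ℝ := fun i => ε / (i + 1)
  have hv : Set.InjOn v s := by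
    intro i _ j _ hij
    simp only [v] at hij
    have : ((i : ℝ) + 1) = j + 1 := by
      have hi : (0 : ℝ) < i + 1 := by positivity
      have hj : (0 : ℝ) < j + 1 := by positivity
      field_simp at hij
      linarith
    exact_mod_cast add_right_cancel this
  have hv0 : ∀ i, 0 ≤ v i ∧ v i ≤ ε := fun i =>
    ⟨by positivity, div_le_self hε0.le (by linarith [(Nat.cast_nonneg i : (0 : ℝ) ≤ i)])⟩
  have h1 : ∫ x in B, (1 + A x).det = volume.real B := by
    have hint : ∀ i ∈ s, IntegrableOn
        (fun x => (1 + v i • A x).det * (Lagrange.basis s v i).eval 1) B := by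
      intro i _
      refine ContinuousOn.integrableOn_compact hBc ?_
      exact (ContinuousLinearMap.continuous_det.comp_continuousOn
        (continuousOn_const.add (hAc.const_smul (v i)))).mul continuousOn_const
    calc ∫ x in B, (1 + A x).det
        = ∫ x in B, ∑ i ∈ s, (1 + v i • A x).det * (Lagrange.basis s v i).eval 1 := by
          congr 1 with x
          exact det_one_add_eq_interpolation hv (by simp [s]) (A x)
      _ = ∑ i ∈ s, volume.real B * (Lagrange.basis s v i).eval 1 := by
          rw [integral_finsetSum s hint]
          refine Finset.sum_congr rfl fun i _ => ?_
          rw [integral_mul_const, hvol _ (hv0 i).1 (hv0 i).2]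
      _ = volume.real B := by
          rw [← Finset.mul_sum, ← Polynomial.eval_finsetSum,
            Lagrange.sum_basis hv ⟨0, by simp [s]⟩]
          simp
  have h2 : ∫ x in B, (1 + A x).det = ∫ x in B, (0 : ℝ) := by
    have hae : ball (0 : Vec d) 1 =ᵐ[volume] closedBall (0 : Vec d) 1 := by
      refine ae_eq_of_subset_of_measure_ge ball_subset_closedBall ?_
        measurableSet_ball.nullMeasurableSet measure_closedBall_lt_top.ne
      exact (Measure.addHaar_closedBall_eq_addHaar_ball volume 0 1).le
    rw [hB, ← setIntegral_congr_set hae, ← setIntegral_congr_set hae]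
    refine setIntegral_congr_fun measurableSet_ball fun x hx => ?_
    have hxB : x ∈ B := ball_subset_closedBall hx
    have hrd : HasFDerivAt r (1 + A x) x := by
      have h := (hasFDerivAt_id x).add ((hgd x hxB).differentiableAt (by norm_num)).hasFDerivAt
      refine h.congr_of_eventuallyEq (Eventually.of_forall fun y => ?_)
      simp [hg]
    have hconst : (fun y => ‖r y‖ ^ 2) =ᶠ[𝓝 x] fun _ => (1 : ℝ) := by
      filter_upwards [isOpen_ball.mem_nhds hx] with y hy
      rw [hb y (ball_subset_closedBall hy)]; norm_num
    -- Differentiating `‖r‖² = 1` shows that the range of the differential is orthogonal to the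
    -- nonzero vector `r x`, so the differential is not onto.
    have hd0 : ∀ w, inner ℝ (r x) ((1 + A x) w) = 0 := by
      intro w
      have e1 := hrd.norm_sq
      have e2 : HasFDerivAt (fun y => ‖r y‖ ^ 2) (0 : Vec d →L[ℝ] ℝ) x :=
        (hasFDerivAt_const (1 : ℝ) x).congr_of_eventuallyEq hconst
      have := congrArg (fun L : Vec d →L[ℝ] ℝ => L w) (e1.unique e2)
      simp only [smul_apply, ContinuousLinearMap.comp_apply,
        zero_apply, innerSL_apply_apply, nsmul_eq_mul, Nat.cast_ofNat] at this
      linarith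
    by_contra hne
    have hunit : IsUnit (1 + A x).det := isUnit_iff_ne_zero.mpr hne
    have hsur : Function.Surjective ((1 + A x : Vec d →L[ℝ] Vec d) : Vec d →ₗ[ℝ] Vec d) :=
      LinearMap.range_eq_top.mp ((LinearMap.isUnit_iff_range_eq_top _).mp
        ((LinearMap.isUnit_iff_isUnit_det _).mpr hunit))
    obtain ⟨w, hw⟩ := hsur (r x)
    have := hd0 w
    rw [← ContinuousLinearMap.coe_coe, hw, inner_self_eq_zero] at this
    have h3 := hb x hxB
    rw [this] at h3
    simp at h3
  rw [h1] at h2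
  simp only [integral_zero] at h2
  have : 0 < volume.real B :=
    ENNReal.toReal_pos ((measure_closedBall_pos volume 0 one_pos).ne')
      measure_closedBall_lt_top.ne
  linarith

end

section

open Metric

/-- Without a fixed point, the point where the ray from `f x` through `x` leaves the ball would
define a `C¹` retraction onto the sphere. -/
theorem exists_fixedPoint_of_contDiff {d : ℕ} (f : Vec d → Vec d) (hf : ContDiff ℝ 1 f)
    (hfb : ∀ x ∈ closedBall (0 : Vec d) 1, ‖f x‖ ≤ 1) :
    ∃ x ∈ closedBall (0 : Vec d) 1, f x = x := by
  by_contra! hne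
  set u : Vec d → Vec d := fun x => x - f x with hu
  have hu0 : ∀ x ∈ closedBall (0 : Vec d) 1, u x ≠ 0 := fun x hx h =>
    hne x hx (sub_eq_zero.mp h).symm
  have huc : ContDiff ℝ 1 u := contDiff_id.sub hf
  -- the ray from `f x` through `x` points outwards on the sphere
  have hout : ∀ x, ‖x‖ = 1 → 0 < inner ℝ x (u x) := by
    intro x hx
    have hxB : x ∈ closedBall (0 : Vec d) 1 := by simp [hx]
    have h1 : 0 < ‖u x‖ ^ 2 := by
      have := norm_pos_iff.mpr (hu0 x hxB); positivity
    have h2 : ‖u x‖ ^ 2 = ‖x‖ ^ 2 - 2 * inner ℝ x (f x) + ‖f x‖ ^ 2 := norm_sub_sq_real x (f x)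
    have h3 : ‖f x‖ ^ 2 ≤ 1 := by
      have := hfb x hxB
      have h0 := norm_nonneg (f x)
      nlinarith
    have h4 : inner ℝ x (u x) = ‖x‖ ^ 2 - inner ℝ x (f x) := by
      simp [hu, inner_sub_right]
    rw [h4]
    rw [hx] at h2 ⊢
    linarith
  -- A quarter of the discriminant of `‖x + l u‖² = 1` as an equation in `l`. It is positive on the
  -- closed ball, so its square root is `C¹`; the larger root `l` below vanishes on the sphere
  -- because of `hout`.
  set D : Vec d → ℝ := fun x => (inner ℝ x (u x)) ^ 2 + ‖u x‖ ^ 2 * (1 - ‖x‖ ^ 2) with hD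
  have hD0 : ∀ x ∈ closedBall (0 : Vec d) 1, 0 < D x := by
    intro x hx
    simp only [mem_closedBall, dist_zero_right] at hx
    rcases hx.lt_or_eq with h | h
    · have h1 : 0 < ‖u x‖ := norm_pos_iff.mpr (hu0 x (by simpa using hx))
      have h2 : 0 < 1 - ‖x‖ ^ 2 := by
        have := norm_nonneg x; nlinarith
      have : 0 < ‖u x‖ ^ 2 * (1 - ‖x‖ ^ 2) := by positivity
      have := sq_nonneg (inner ℝ x (u x))
      simp only [hD]; linarith
    · have := hout x h
      simp only [hD, h]
      have h3 : 0 < (inner ℝ x (u x)) ^ 2 := by positivity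
      linarith
  set l : Vec d → ℝ := fun x => (-(inner ℝ x (u x)) + √(D x)) / ‖u x‖ ^ 2 with hl
  refine not_exists_smooth_retraction (fun x => x + l x • u x) ?_ ?_ ?_
  · intro x hx
    have hux : ‖u x‖ ^ 2 ≠ 0 := by simpa using hu0 x hx
    have hua : ContDiffAt ℝ 1 u x := huc.contDiffAt
    have hDa : ContDiffAt ℝ 1 D x := by
      have h1 : ContDiffAt ℝ 1 (fun x => inner ℝ x (u x)) x := contDiffAt_id.inner ℝ hua
      exact (h1.pow 2).add ((hua.norm_sq ℝ).mul (contDiffAt_const.sub (contDiffAt_id.norm_sq ℝ)))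
    have hla : ContDiffAt ℝ 1 l x :=
      ((contDiffAt_id.inner ℝ hua).neg.add (hDa.sqrt (hD0 x hx).ne')).div (hua.norm_sq ℝ) hux
    exact contDiffAt_id.add (hla.smul hua)
  · intro x hx
    have : l x = 0 := by
      simp only [hl, hD, hx]
      rw [show (inner ℝ x (u x)) ^ 2 + ‖u x‖ ^ 2 * (1 - 1 ^ 2) = (inner ℝ x (u x)) ^ 2 by ring,
        Real.sqrt_sq (hout x hx).le]
      simp
    simp [this]
  · intro x hx
    have hux : ‖u x‖ ^ 2 ≠ 0 := by simpa using hu0 x hx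
    have hs : √(D x) ^ 2 = D x := Real.sq_sqrt (hD0 x hx).le
    have hls : l x * ‖u x‖ ^ 2 = -(inner ℝ x (u x)) + √(D x) := by
      simp only [hl]; exact div_mul_cancel₀ _ hux
    have h1 : ‖x + l x • u x‖ ^ 2 = 1 := by
      rw [norm_add_sq_real, inner_smul_right, norm_smul, mul_pow, Real.norm_eq_abs, sq_abs]
      apply mul_right_cancel₀ hux
      have e : (‖x‖ ^ 2 + 2 * (l x * inner ℝ x (u x)) + l x ^ 2 * ‖u x‖ ^ 2) * ‖u x‖ ^ 2 =
        ‖x‖ ^ 2 * ‖u x‖ ^ 2 + 2 * (l x * ‖u x‖ ^ 2) * inner ℝ x (u x)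
          + (l x * ‖u x‖ ^ 2) ^ 2 := by ring
      rw [e, hls]
      have : D x = (inner ℝ x (u x)) ^ 2 + ‖u x‖ ^ 2 * (1 - ‖x‖ ^ 2) := rfl
      nlinarith
    have h2 : 0 ≤ ‖x + l x • u x‖ := norm_nonneg _
    nlinarith

/-- **Brouwer's fixed point theorem** for the closed unit ball. -/
theorem exists_fixedPoint_of_continuous {d : ℕ} (f : Vec d → Vec d) (hf : Continuous f)
    (hfb : ∀ x ∈ closedBall (0 : Vec d) 1, ‖f x‖ ≤ 1) :
    ∃ x ∈ closedBall (0 : Vec d) 1, f x = x := by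
  by_contra! hne
  obtain ⟨x₀, hx₀, hmin⟩ := (isCompact_closedBall (0 : Vec d) 1).exists_isMinOn ⟨0, by simp⟩
    (f := fun x => ‖f x - x‖) (by fun_prop)
  -- The minimal displacement is `4 ε`. A smooth approximation within `ε`, divided by `1 + ε` so as
  -- to preserve the ball, has a fixed point that `f` moves by less than `2 ε`.
  set ε := ‖f x₀ - x₀‖ / 4 with hε
  have hε0 : 0 < ε := by
    have := norm_pos_iff.mpr (sub_ne_zero.mpr (hne x₀ hx₀)); positivity
  obtain ⟨g, hgc, hg, -⟩ := hf.exists_contDiff_approx 1 (ε := fun _ => ε) continuous_const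
    (fun _ => hε0)
  obtain ⟨x, hx, hfix⟩ := exists_fixedPoint_of_contDiff (fun x => (1 + ε)⁻¹ • g x)
    ((contDiff_const_smul _).comp (by exact_mod_cast hgc)) (by
      intro x hx
      rw [norm_smul, norm_inv, Real.norm_of_nonneg (by positivity), inv_mul_le_iff₀ (by positivity)]
      have h1 := hg x
      rw [dist_eq_norm] at h1
      have h2 := norm_le_norm_add_norm_sub' (g x) (f x)
      have := hfb x hx
      linarith)
  have h1 : g x = (1 + ε) • x := by
    conv_rhs => rw [← hfix]
    rw [smul_smul, mul_inv_cancel₀ (by positivity), one_smul]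
  have h2 := hg x
  rw [h1, dist_eq_norm] at h2
  have h3 : ‖f x₀ - x₀‖ ≤ ‖f x - x‖ := hmin hx
  have h4 : f x - x = ε • x - ((1 + ε) • x - f x) := by module
  have h5 : ‖f x - x‖ ≤ ‖ε • x‖ + ‖(1 + ε) • x - f x‖ := by rw [h4]; exact norm_sub_le _ _
  rw [norm_smul, Real.norm_of_nonneg hε0.le] at h5
  have h6 : ‖x‖ ≤ 1 := by simpa using hx
  have : ε * ‖x‖ ≤ ε := mul_le_of_le_one_right hε0.le h6
  linarith

/-! ### Invariance of domain -/

/-- A continuous injective map of the closed unit ball into a space of the same dimension covers a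
neighborhood of the image of the center. -/
theorem image_closedBall_mem_nhds {d : ℕ} (f : Vec d → Vec d)
    (hf : ContinuousOn f (closedBall 0 1)) (hinj : InjOn f (closedBall 0 1)) :
    f '' closedBall 0 1 ∈ 𝓝 (f 0) := by
  set B : Set (Vec d) := closedBall 0 1 with hB
  have hBc : IsCompact B := isCompact_closedBall 0 1
  have h0B : (0 : Vec d) ∈ B := by simp [hB]
  -- a continuous extension of the inverse
  obtain ⟨G, hG⟩ : ∃ G : C(Vec d, Vec d), ∀ x ∈ B, G (f x) = x := by
    have hemb : IsClosedEmbedding (B.domRestrict f) := by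
      have : CompactSpace B := isCompact_iff_compactSpace.mp hBc
      exact (continuousOn_iff_continuous_domRestrict.mp hf).isClosedEmbedding
        (injOn_iff_injective.mp hinj)
    obtain ⟨G, hG⟩ := ContinuousMap.exists_extension hemb
      (⟨Subtype.val, continuous_subtype_val⟩ : C(B, Vec d))
    refine ⟨G, fun x hx => ?_⟩
    exact congrArg (fun F : C(B, Vec d) => F ⟨x, hx⟩) hG
  have hG0 : G (f 0) = 0 := hG 0 h0B
  -- a continuous map close to `G` on the image has a zero there
  have stable : ∀ H : Vec d → Vec d, ContinuousOn H (f '' B) →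
      (∀ y ∈ f '' B, ‖G y - H y‖ ≤ 1) → ∃ y ∈ f '' B, H y = 0 := by
    intro H hH hclose
    -- A fixed point of `x ↦ x - H (f x)` yields a zero of `H`. This map sends the ball to itself
    -- since `x = G (f x)` and `H` is within `1` of `G`.
    have hc : ContinuousOn (fun x => x - H (f x)) B :=
      continuousOn_id.sub (hH.comp hf (mapsTo_image f B))
    obtain ⟨Φ, hΦ⟩ := ContinuousMap.exists_restrict_eq (isClosed_closedBall (x := (0 : Vec d)) (ε := 1))
      (⟨_, continuousOn_iff_continuous_domRestrict.mp hc⟩ : C(B, Vec d))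
    have hΦ' : ∀ x ∈ B, Φ x = x - H (f x) := fun x hx =>
      congrArg (fun F : C(B, Vec d) => F ⟨x, hx⟩) hΦ
    obtain ⟨x, hx, hfix⟩ := exists_fixedPoint_of_continuous Φ Φ.continuous (by
      intro x hx
      rw [hΦ' x hx]
      have := hclose (f x) (mem_image_of_mem f hx)
      rwa [hG x hx] at this)
    refine ⟨f x, mem_image_of_mem f hx, ?_⟩
    rw [hΦ' x hx] at hfix
    simpa using hfix
  -- Otherwise some `c` close to `f 0` is missed by the image. Pushing the image radially off the
  -- ball around `c`, then applying a smooth approximation of `G` minus a small vector `v`, produces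
  -- a map close to `G` without zeros on the image, contradicting `stable`.
  by_contra hnot
  obtain ⟨ε, hε, hGε⟩ : ∃ ε > 0, ∀ y, dist y (f 0) < 2 * ε → ‖G y‖ ≤ 1 / 10 := by
    have : ∀ᶠ y in 𝓝 (f 0), ‖G y‖ < 1 / 10 := by
      have h := G.continuous.norm.continuousAt (x := f 0)
      refine h.eventually (gt_mem_nhds ?_)
      simp only [hG0]; norm_num
    obtain ⟨δ, hδ, h⟩ := Metric.eventually_nhds_iff.mp this
    exact ⟨δ / 2, by positivity, fun y hy => (h (by linarith)).le⟩
  obtain ⟨c, hc, hcf⟩ : ∃ c, dist c (f 0) < ε ∧ c ∉ f '' B := by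
    by_contra! h
    exact hnot (Metric.mem_nhds_iff.mpr ⟨ε, hε, fun c hc => h c hc⟩)
  have hfBc : IsCompact (f '' B) := hBc.image_of_continuousOn hf
  set S₁ : Set (Vec d) := f '' B ∩ {y | ε ≤ dist y c} with hS₁
  have hS₁c : IsCompact S₁ := hfBc.inter_right (isClosed_le continuous_const (by fun_prop))
  obtain ⟨δ, hδ0, hδ⟩ : ∃ δ > 0, ∀ y ∈ S₁, δ ≤ ‖G y‖ := by
    rcases S₁.eq_empty_or_nonempty with h | h
    · exact ⟨1, one_pos, by simp [h]⟩
    · obtain ⟨y₀, hy₀, hmin⟩ := hS₁c.exists_isMinOn h (f := fun y => ‖G y‖)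
        G.continuous.norm.continuousOn
      refine ⟨‖G y₀‖, norm_pos_iff.mpr ?_, fun y hy => hmin hy⟩
      obtain ⟨⟨x, hx, rfl⟩, hxd⟩ := hy₀
      rw [hG x hx]
      rintro rfl
      simp only [mem_ofPred_eq] at hxd
      rw [dist_comm] at hc
      linarith
  -- The bound by `δ` keeps `P - v` away from zero at image points outside the ball around `c`; the
  -- bound by `1 / 10` keeps the total distance to `G` below `1`.
  set η := min δ (1 / 10) / 4 with hη
  have hη0 : 0 < η := by positivity
  have hηδ : 4 * η ≤ δ := by rw [hη]; linarith [min_le_left δ (1 / 10)]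
  have hη1 : 4 * η ≤ 1 / 10 := by rw [hη]; linarith [min_le_right δ (1 / 10 : ℝ)]
  obtain ⟨P, hPc, hP, -⟩ := G.continuous.exists_contDiff_approx 1 (ε := fun _ => η)
    continuous_const (fun _ => hη0)
  -- a small vector avoided by `P` on the sphere
  have hnull : volume (P '' sphere c ε) = 0 :=
    addHaar_image_eq_zero_of_differentiableOn_of_addHaar_eq_zero volume
      ((hPc.differentiable (by norm_num)).differentiableOn)
      (Measure.addHaar_sphere_of_ne_zero volume c hε.ne')
  obtain ⟨v, hvb, hv⟩ : ∃ v ∈ ball (0 : Vec d) η, v ∉ P '' sphere c ε := by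
    by_contra! h
    have h1 : volume (ball (0 : Vec d) η) ≤ 0 := hnull ▸ measure_mono h
    exact (measure_ball_pos volume (0 : Vec d) hη0).not_ge h1
  have hvn : ‖v‖ < η := by simpa using hvb
  have hcne : ∀ y ∈ f '' B, 0 < dist y c := fun y hy =>
    dist_pos.mpr (by rintro rfl; exact hcf hy)
  -- push the image off the ball around `c`
  set ρ : Vec d → Vec d := fun y => c + max (ε / dist y c) 1 • (y - c) with hρ
  have hρ1 : ∀ y, ε ≤ dist y c → ρ y = y := by
    intro y hy
    have h0 : 0 < dist y c := hε.trans_le hy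
    have : max (ε / dist y c) 1 = 1 := max_eq_right ((div_le_one h0).mpr hy)
    simp [hρ, this]
  have hρ2 : ∀ y ∈ f '' B, dist y c ≤ ε → ρ y ∈ sphere c ε := by
    intro y hy hyε
    have h0 := hcne y hy
    have : max (ε / dist y c) 1 = ε / dist y c := max_eq_left ((one_le_div h0).mpr hyε)
    have e : dist (ρ y) c = ‖ε / dist y c‖ * dist y c := by
      rw [← this]
      simp [hρ, dist_eq_norm, norm_smul]
    rw [mem_sphere, e, Real.norm_of_nonneg (by positivity), div_mul_cancel₀ _ h0.ne']
  have hρc : ContinuousOn ρ (f '' B) := by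
    have h1 : ContinuousOn (fun y => ε / dist y c) (f '' B) :=
      continuousOn_const.div (by fun_prop) fun y hy => (hcne y hy).ne'
    exact continuousOn_const.add ((h1.sup continuousOn_const).smul (by fun_prop))
  obtain ⟨y, hy, hzero⟩ := stable (fun y => P (ρ y) - v)
    ((hPc.continuous.comp_continuousOn hρc).sub continuousOn_const) (by
      intro y hy
      have hPa : ‖P (ρ y) - G (ρ y)‖ < η := by simpa [dist_eq_norm] using hP (ρ y)
      have e : G y - (P (ρ y) - v) = (G y - G (ρ y)) - (P (ρ y) - G (ρ y)) + v := by abel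
      have h1 : ‖G y - G (ρ y)‖ ≤ 1 / 5 := by
        rcases le_total ε (dist y c) with h | h
        · rw [hρ1 y h]; simp
        · have h2 := hGε y (by linarith [dist_triangle y c (f 0)])
          have h3 : ‖G (ρ y)‖ ≤ 1 / 10 := by
            have hs : dist (ρ y) c = ε := hρ2 y hy h
            exact hGε _ (by linarith [dist_triangle (ρ y) c (f 0)])
          linarith [norm_sub_le (G y) (G (ρ y))]
      rw [e]
      refine (norm_add_le _ _).trans ?_
      linarith [norm_sub_le (G y - G (ρ y)) (P (ρ y) - G (ρ y))])
  have hzero' : P (ρ y) = v := sub_eq_zero.mp hzero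
  rcases le_total ε (dist y c) with h | h
  · rw [hρ1 y h] at hzero'
    have h1 := hδ y ⟨hy, h⟩
    have h2 : ‖P y - G y‖ < η := by simpa [dist_eq_norm] using hP y
    have h3 : ‖G y‖ ≤ ‖P y‖ + ‖P y - G y‖ := by
      have := norm_sub_le (P y) (P y - G y)
      simpa using this
    rw [hzero'] at h3 h2
    linarith
  · exact hv ⟨ρ y, hρ2 y hy h, hzero'⟩

/-- **Invariance of domain**: a continuous injective map between finite-dimensional spaces of
the same dimension is open. -/
theorem isOpen_image_of_injOn {E F : Type*} [NormedAddCommGroup E] [NormedSpace ℝ E]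
    [FiniteDimensional ℝ E] [NormedAddCommGroup F] [NormedSpace ℝ F] [FiniteDimensional ℝ F]
    (hEF : Module.finrank ℝ E = Module.finrank ℝ F) {s : Set E} (hs : IsOpen s) {f : E → F}
    (hf : ContinuousOn f s) (hinj : InjOn f s) : IsOpen (f '' s) := by
  rw [isOpen_iff_mem_nhds]
  rintro _ ⟨x, hx, rfl⟩
  set d := Module.finrank ℝ E
  have e₁ : Vec d ≃L[ℝ] E := ContinuousLinearEquiv.ofFinrankEq (by simp [d])
  have e₂ : F ≃L[ℝ] Vec d := ContinuousLinearEquiv.ofFinrankEq (by simp [d, hEF])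
  have hpre : (fun w => x + e₁ w) ⁻¹' s ∈ 𝓝 (0 : Vec d) := by
    have hc : Continuous fun w => x + e₁ w := by fun_prop
    exact hc.continuousAt.preimage_mem_nhds (by simpa using hs.mem_nhds hx)
  obtain ⟨ε, hε, hball⟩ := Metric.nhds_basis_closedBall.mem_iff.mp hpre
  have hmaps : MapsTo (fun w : Vec d => x + e₁ (ε • w)) (closedBall 0 1) s := by
    intro w hw
    apply hball
    simp only [mem_closedBall, dist_zero_right, norm_smul, Real.norm_of_nonneg hε.le] at hw ⊢
    exact mul_le_of_le_one_right hε.le hw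
  have hg : (fun w => e₂ (f (x + e₁ (ε • w)))) '' closedBall 0 1 ∈
      𝓝 ((fun w => e₂ (f (x + e₁ (ε • w)))) 0) := by
    refine image_closedBall_mem_nhds (fun w => e₂ (f (x + e₁ (ε • w)))) ?_ ?_
    · exact e₂.continuous.comp_continuousOn (hf.comp (by fun_prop) hmaps)
    · intro w hw w' hw' h
      have := hinj (hmaps hw) (hmaps hw') (e₂.injective h)
      simpa [hε.ne'] using this
  have h2 : e₂.symm ⁻¹' (f '' s) ∈ 𝓝 (e₂ (f x)) := by
    simp only [smul_zero, map_zero, add_zero] at hg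
    refine mem_of_superset hg ?_
    rintro _ ⟨w, hw, rfl⟩
    exact ⟨_, hmaps hw, by simp⟩
  have h3 := e₂.continuous.continuousAt.preimage_mem_nhds h2
  refine mem_of_superset h3 ?_
  intro y hy
  simpa using hy

end

/-! ### Composition operators on spaces of continuous functions -/

section Nemytskii

universe u

variable {K : Type} [TopologicalSpace K] [CompactSpace K]
  {E F : Type u} [NormedAddCommGroup E] [NormedSpace ℝ E] [NormedAddCommGroup F] [NormedSpace ℝ F]

/-- Pointwise application of operator-valued functions, as a bilinear map. -/
def pointwiseApplyLin (K : Type) [TopologicalSpace K]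
    (E F : Type u) [NormedAddCommGroup E] [NormedSpace ℝ E] [NormedAddCommGroup F]
    [NormedSpace ℝ F] : C(K, E →L[ℝ] F) →ₗ[ℝ] C(K, E) →ₗ[ℝ] C(K, F) where
  toFun A :=
    { toFun := fun h => ⟨fun t => A t (h t), A.continuous.clm_apply h.continuous⟩
      map_add' := fun _ _ => by ext; simp
      map_smul' := fun _ _ => by ext; simp }
  map_add' _ _ := by ext; simp
  map_smul' _ _ := by ext; simp

theorem norm_pointwiseApplyLin_le (A : C(K, E →L[ℝ] F)) (h : C(K, E)) :
    ‖pointwiseApplyLin K E F A h‖ ≤ 1 * ‖A‖ * ‖h‖ := by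
  refine (ContinuousMap.norm_le _ (by positivity)).mpr fun t => ?_
  rw [one_mul]
  exact (A t).le_of_opNorm_le_of_le (A.norm_coe_le_norm t) (h.norm_coe_le_norm t)

/-- Pointwise application of operator-valued functions, as a bounded bilinear map. -/
def pointwiseApply (K : Type) [TopologicalSpace K] [CompactSpace K]
    (E F : Type u) [NormedAddCommGroup E] [NormedSpace ℝ E] [NormedAddCommGroup F]
    [NormedSpace ℝ F] : C(K, E →L[ℝ] F) →L[ℝ] C(K, E) →L[ℝ] C(K, F) :=
  LinearMap.mkContinuous₂ (E := C(K, E →L[ℝ] F)) (F := C(K, E)) (G := C(K, F))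
    (σ₁₃ := RingHom.id ℝ) (σ₂₃ := RingHom.id ℝ)
    (pointwiseApplyLin K E F) 1 norm_pointwiseApplyLin_le

@[simp] theorem pointwiseApply_apply (A : C(K, E →L[ℝ] F)) (h : C(K, E)) (t : K) :
    pointwiseApply K E F A h t = A t (h t) := rfl

/-- Postcomposition with `f'` is continuous for the sup norm, so a single `δ` controls the variation
of `f'` at all points of `K`; the mean value inequality on segments then gives a uniform remainder.
-/
theorem hasFDerivAt_postcomp (f : C(E, F)) (f' : C(E, E →L[ℝ] F))
    (hf : ∀ x, HasFDerivAt f (f' x) x) (u : C(K, E)) :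
    HasFDerivAt (fun v : C(K, E) => f.comp v) (pointwiseApply K E F (f'.comp u)) u := by
  rw [hasFDerivAt_iff_isLittleO_nhds_zero, Asymptotics.isLittleO_iff]
  intro ε hε
  have hc := (ContinuousMap.continuous_postcomp (X := K) f').continuousAt (x := u)
  obtain ⟨δ, hδ, hclose⟩ := (Metric.continuousAt_iff (α := C(K, E)) (β := C(K, E →L[ℝ] F))).mp hc ε hε
  filter_upwards [Metric.ball_mem_nhds (0 : C(K, E)) hδ] with h hh
  rw [mem_ball_zero_iff] at hh
  refine (ContinuousMap.norm_le _ (by positivity)).mpr fun t => ?_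
  have hseg : ∀ z ∈ segment ℝ (u t) (u t + h t), ‖f' z - f' (u t)‖ ≤ ε := by
    rintro z hz
    rw [segment_eq_image'] at hz
    obtain ⟨s, hs, rfl⟩ := hz
    have h1 : dist (u + s • h) u < δ := by
      rw [dist_eq_norm, add_sub_cancel_left, norm_smul, Real.norm_of_nonneg hs.1]
      exact (mul_le_of_le_one_left (norm_nonneg _) hs.2).trans_lt hh
    have h2 := (ContinuousMap.dist_apply_le_dist t).trans (hclose h1).le
    rw [dist_eq_norm] at h2
    simpa using h2
  have := (convex_segment (u t) (u t + h t)).norm_image_sub_le_of_norm_hasFDerivWithin_le' (𝕜 := ℝ)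
    (fun z _ => (hf z).hasFDerivWithinAt) hseg (left_mem_segment ℝ _ _) (right_mem_segment ℝ _ _)
  simp only [add_sub_cancel_left] at this
  exact this.trans (mul_le_mul_of_nonneg_left (h.norm_coe_le_norm t) hε.le)

/-- The derivative of postcomposition with `f` is postcomposition with `f'` followed by a bounded
linear map. The induction therefore has to range over all targets `F`, as `f'` has values in `E
→L[ℝ] F`. -/
theorem contDiff_postcomp_nat (n : ℕ) : ∀ {F : Type u} [NormedAddCommGroup F] [NormedSpace ℝ F]
    (f : C(E, F)), ContDiff ℝ n f → ContDiff ℝ n (fun u : C(K, E) => f.comp u) := by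
  induction n with
  | zero =>
    intro F _ _ f _
    exact contDiff_zero.mpr (ContinuousMap.continuous_postcomp f)
  | succ n ih =>
    intro F _ _ f hf
    have hf' : ContDiff ℝ n (fderiv ℝ f) := hf.fderiv_right (by norm_cast)
    set f' : C(E, E →L[ℝ] F) := ⟨fderiv ℝ f, hf'.continuous⟩
    have hd : ∀ x, HasFDerivAt f (f' x) x := fun x =>
      ((hf.differentiable (by simp)) x).hasFDerivAt
    have hL : ContDiff ℝ n (fun A : C(K, E →L[ℝ] F) => pointwiseApply K E F A) :=
      ContinuousLinearMap.contDiff (E := C(K, E →L[ℝ] F)) (F := C(K, E) →L[ℝ] C(K, F)) _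
    have := (contDiff_succ_iff_hasFDerivAt (𝕜 := ℝ) (n := n)
      (f := fun u : C(K, E) => f.comp u)).mpr
      ⟨fun u => pointwiseApply K E F (f'.comp u),
        hL.comp (ih f' hf'), hasFDerivAt_postcomp f f' hd⟩
    exact_mod_cast this

theorem contDiff_postcomp (f : C(E, F)) (hf : ContDiff ℝ ∞ f) :
    ContDiff ℝ ∞ (fun u : C(K, E) => f.comp u) :=
  contDiff_infty.mpr fun n => contDiff_postcomp_nat n f (contDiff_infty.mp hf n)

/-- The pointwise action of a continuous multilinear map on continuous functions. -/
def pointwiseMultilinear (K : Type) [TopologicalSpace K] [CompactSpace K] {n : ℕ}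
    (p : ContinuousMultilinearMap ℝ (fun _ : Fin n => E) F) :
    ContinuousMultilinearMap ℝ (fun _ : Fin n => C(K, E)) C(K, F) :=
  MultilinearMap.mkContinuous
    { toFun := fun m => ⟨fun t => p (fun i => m i t), by fun_prop⟩
      map_update_add' := fun m i x y => by
        ext t
        have h : ∀ z : C(K, E), (fun j => (Function.update m i z j) t)
            = Function.update (fun j => m j t) i (z t) := fun z => by
          ext j
          by_cases hj : j = i
          · subst hj; simp
          · simp [hj]
        have e := p.map_update_add (fun j => m j t) i (x t) (y t)
        simp only [ContinuousMap.coe_mk, ContinuousMap.add_apply]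
        convert e using 2 <;> first | exact congrArg p (h _) | (simp [h])
      map_update_smul' := fun m i c x => by
        ext t
        have h : ∀ z : C(K, E), (fun j => (Function.update m i z j) t)
            = Function.update (fun j => m j t) i (z t) := fun z => by
          ext j
          by_cases hj : j = i
          · subst hj; simp
          · simp [hj]
        have e := p.map_update_smul (fun j => m j t) i c (x t)
        simp only [ContinuousMap.coe_mk, ContinuousMap.smul_apply]
        convert e using 2 <;> first | exact congrArg p (h _) | (simp [h]) } ‖p‖ (fun m => by
    refine (ContinuousMap.norm_le _ (by positivity)).mpr fun t => ?_
    refine (p.le_opNorm _).trans ?_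
    gcongr with i
    exact (m i).norm_coe_le_norm t)

@[simp] theorem pointwiseMultilinear_apply {n : ℕ}
    (p : ContinuousMultilinearMap ℝ (fun _ : Fin n => E) F) (m : Fin n → C(K, E)) (t : K) :
    pointwiseMultilinear K p m t = p (fun i => m i t) := rfl

theorem norm_pointwiseMultilinear_le {n : ℕ}
    (p : ContinuousMultilinearMap ℝ (fun _ : Fin n => E) F) :
    ‖pointwiseMultilinear K p‖ ≤ ‖p‖ :=
  MultilinearMap.mkContinuous_norm_le _ (norm_nonneg _) _

/-- The power series of `f` at `x₀` acts pointwise on functions close to the constant `x₀`. Its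
terms keep their norm bounds, so the radius of convergence does not shrink. -/
theorem analyticAt_postcomp [CompleteSpace F] (f : C(E, F)) {x₀ : E} (hf : AnalyticAt ℝ f x₀) :
    AnalyticAt ℝ (fun u : C(K, E) => f.comp u) (ContinuousMap.const K x₀) := by
  obtain ⟨p, r, hp⟩ := hf
  set q : FormalMultilinearSeries ℝ C(K, E) C(K, F) := fun n => pointwiseMultilinear K (p n)
  have hrad : p.radius ≤ q.radius :=
    FormalMultilinearSeries.radius_le_of_le fun n => norm_pointwiseMultilinear_le (p n)
  refine ⟨q, r, hp.r_le.trans hrad, hp.r_pos, ?_⟩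
  intro y hy
  have hy' : y ∈ Metric.eball (0 : C(K, E)) q.radius :=
    Metric.eball_subset_eball (hp.r_le.trans hrad) hy
  have hs := q.hasSum hy'
  convert hs using 1
  ext t
  have h1 := (ContinuousMap.evalCLM ℝ t).hasSum hs
  have hyt : y t ∈ Metric.eball (0 : E) r := by
    simp only [Metric.mem_eball, edist_zero_right] at hy ⊢
    refine lt_of_le_of_lt ?_ hy
    rw [← ofReal_norm, ← ofReal_norm]
    exact ENNReal.ofReal_le_ofReal (y.norm_coe_le_norm t)
  have h2 := hp.hasSum hyt
  exact h2.unique h1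

end Nemytskii

/-- A `C^k` function on an open set coincides near a given point with a continuous function on the
whole space whose composition operator is `C^k` near the constant function. -/
theorem exists_continuousMap_contDiffAt_postcomp {K : Type} [TopologicalSpace K] [CompactSpace K]
    {E F : Type} [NormedAddCommGroup E] [NormedSpace ℝ E] [FiniteDimensional ℝ E]
    [NormedAddCommGroup F] [NormedSpace ℝ F] [CompleteSpace F] {k : WithTop ℕ∞}
    (hk : k = ∞ ∨ k = ω) {f : E → F} {X : Set E} (hX : IsOpen X) (hf : ContDiffOn ℝ k f X)
    {x₀ : E} (hx₀ : x₀ ∈ X) :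
    ∃ g : C(E, F), (g : E → F) =ᶠ[𝓝 x₀] f ∧
      ∀ᶠ v in 𝓝 (ContinuousMap.const K x₀), ContDiffAt ℝ k (fun u : C(K, E) => g.comp u) v := by
  obtain ⟨ε, hε, hball⟩ := Metric.nhds_basis_closedBall.mem_iff.mp (hX.mem_nhds hx₀)
  let b : ContDiffBump x₀ := ⟨ε / 2, ε, by positivity, by linarith⟩
  have hsm : ContDiffOn ℝ ∞ f X := by
    rcases hk with rfl | rfl
    · exact hf
    · exact hf.of_le le_top
  have hg : ContDiff ℝ ∞ (fun x => b x • f x) := by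
    rw [contDiff_iff_contDiffAt]
    intro x
    by_cases hx : x ∈ X
    · exact b.contDiffAt.smul (hsm.contDiffAt (hX.mem_nhds hx))
    · have hx' : x ∉ tsupport b := by
        rw [b.tsupport_eq]
        exact fun h => hx (hball h)
      refine (contDiffAt_const (c := (0 : F))).congr_of_eventuallyEq ?_
      filter_upwards [notMem_tsupport_iff_eventuallyEq.mp hx'] with y hy
      simp [hy]
  have heq : (fun x => b x • f x) =ᶠ[𝓝 x₀] f := by
    filter_upwards [b.eventuallyEq_one] with y hy
    simp [hy]
  refine ⟨⟨_, hg.continuous⟩, heq, ?_⟩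
  rcases hk with rfl | rfl
  · exact Eventually.of_forall fun v => (contDiff_postcomp _ hg).contDiffAt
  -- The bump function destroys analyticity away from `x₀`, but the product equals `f` near `x₀`;
  -- this gives analyticity at the constant function, and analyticity is an open condition.
  · refine ContDiffAt.eventually (n := ω) (analyticAt_postcomp _ ?_).contDiffAt (by simp)
    have : ContDiffAt ℝ ω (fun x => b x • f x) x₀ :=
      (hf.contDiffAt (hX.mem_nhds hx₀)).congr_of_eventuallyEq heq
    exact this.analyticAt

section

/-! ### Implicit and inverse functions near a point -/

/-- The implicit function defined by an equation of class `C^n` near a point is of class `C^n` near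
that point. -/
theorem eventually_contDiffAt_implicitFunction {E₁ E₂ F : Type*}
    [NormedAddCommGroup E₁] [NormedSpace ℝ E₁] [CompleteSpace E₁]
    [NormedAddCommGroup E₂] [NormedSpace ℝ E₂] [CompleteSpace E₂]
    [NormedAddCommGroup F] [NormedSpace ℝ F] [CompleteSpace F]
    {u : E₁ × E₂} {f : E₁ × E₂ → F} {n : WithTop ℕ∞} (cdf : ContDiffAt ℝ n f u) (pn : n ≠ 0)
    (if₂ : (fderiv ℝ f u ∘L .inr ℝ E₁ E₂).IsInvertible)
    (hev : ∀ᶠ p in 𝓝 u, ContDiffAt ℝ n f p)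
    (hinv : ∀ᶠ p in 𝓝 u, (fderiv ℝ f p ∘L .inr ℝ E₁ E₂).IsInvertible) :
    ∀ᶠ x in 𝓝 u.1, ContDiffAt ℝ n (cdf.implicitFunction pn if₂) x := by
  set ψ := cdf.implicitFunction pn if₂ with hψ
  have hψu : ψ u.1 = u.2 := cdf.implicitFunction_apply_self pn if₂
  have hψc : Tendsto (fun x => (x, ψ x)) (𝓝 u.1) (𝓝 u) := by
    have h := (cdf.contDiffAt_implicitFunction pn if₂).continuousAt
    have : ContinuousAt (fun x => (x, ψ x)) u.1 := continuousAt_id.prodMk h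
    simpa [ContinuousAt, hψu] using this
  have hiff := cdf.eventually_apply_eq_iff_implicitFunction pn if₂
  have hsol := cdf.eventually_apply_implicitFunction pn if₂
  filter_upwards [hψc.eventually hev, hψc.eventually hinv,
    hψc.eventually (eventually_eventually_nhds.mpr hiff), hsol] with x h1 h2 h3 h4
  -- The implicit function built at the nearby point `(x, ψ x)` is `C^n` at `x`, and local
  -- uniqueness of solutions identifies it with `ψ` near `x`.
  set χ := h1.implicitFunction pn h2 with hχ
  have hχx : χ x = ψ x := h1.implicitFunction_apply_self pn h2
  have hχd : ContDiffAt ℝ n χ x := h1.contDiffAt_implicitFunction pn h2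
  have hχc : Tendsto (fun y => (y, χ y)) (𝓝 x) (𝓝 (x, ψ x)) := by
    have : ContinuousAt (fun y => (y, χ y)) x := continuousAt_id.prodMk hχd.continuousAt
    simpa [ContinuousAt, hχx] using this
  have hχs : ∀ᶠ y in 𝓝 x, f (y, χ y) = f (x, ψ x) := h1.eventually_apply_implicitFunction pn h2
  refine hχd.congr_of_eventuallyEq ?_
  filter_upwards [hχc.eventually h3, hχs] with y h5 h6
  exact h5.mp (h6.trans h4)

/-- **Inverse function theorem** on an open set, in terms of open partial homeomorphisms. -/
theorem exists_openPartialHomeomorph_of_contDiffOn {E F : Type*} [NormedAddCommGroup E]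
    [NormedSpace ℝ E] [CompleteSpace E] [NormedAddCommGroup F] [NormedSpace ℝ F]
    {k : WithTop ℕ∞} (hk : 1 ≤ k) {φ : E → F} {X : Set E} (hX : IsOpen X)
    (hφ : ContDiffOn ℝ k φ X) {x₀ : E} (hx₀ : x₀ ∈ X) {e : E ≃L[ℝ] F}
    (he : HasFDerivAt φ (e : E →L[ℝ] F) x₀) :
    ∃ Φ : OpenPartialHomeomorph E F, (Φ : E → F) = φ ∧ x₀ ∈ Φ.source ∧ Φ.source ⊆ X ∧
      ContDiffOn ℝ k Φ.symm Φ.target ∧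
      ∀ x ∈ Φ.source, ∃ e' : E ≃L[ℝ] F, HasFDerivAt φ (e' : E →L[ℝ] F) x := by
  have hk0 : k ≠ 0 := (zero_lt_one.trans_le hk).ne'
  have hφ₀ : ContDiffAt ℝ k φ x₀ := hφ.contDiffAt (hX.mem_nhds hx₀)
  set Ψ := hφ₀.toOpenPartialHomeomorph φ he hk0 with hΨ
  -- Restricting to points with invertible differential makes the inverse `C^k` on the whole target,
  -- not only at the image of `x₀`.
  have hopen : IsOpen {x ∈ X | ∃ e' : E ≃L[ℝ] F, (e' : E →L[ℝ] F) = fderiv ℝ φ x} := by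
    have h1 : ContinuousOn (fderiv ℝ φ) X := hφ.continuousOn_fderiv_of_isOpen hX hk
    exact h1.isOpen_inter_preimage hX ContinuousLinearEquiv.isOpen
  refine ⟨Ψ.restrOpen _ hopen, rfl, ⟨?_, hx₀, e, ?_⟩, fun x hx => hx.2.1, ?_, ?_⟩
  · exact hφ₀.mem_toOpenPartialHomeomorph_source he hk0
  · exact he.fderiv.symm
  · intro y hy
    have hys : (Ψ.restrOpen _ hopen).symm y ∈ (Ψ.restrOpen _ hopen).source :=
      (Ψ.restrOpen _ hopen).map_target hy
    obtain ⟨-, hyX, e', he'⟩ := hys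
    refine ContDiffAt.contDiffWithinAt ?_
    refine (Ψ.restrOpen _ hopen).contDiffAt_symm hy (f₀' := e') ?_ (hφ.contDiffAt (hX.mem_nhds hyX))
    rw [he']
    exact ((hφ.contDiffAt (hX.mem_nhds hyX)).differentiableAt hk0).hasFDerivAt
  · rintro x ⟨-, hxX, e', he'⟩
    refine ⟨e', ?_⟩
    rw [he']
    exact ((hφ.contDiffAt (hX.mem_nhds hxX)).differentiableAt hk0).hasFDerivAt

/-! ### The integral equation of a family of vector fields -/

section IntegralEquation

open unitInterval

/-- The extension of a continuous function on the unit interval by constants. -/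
def extendI {E : Type*} [TopologicalSpace E] (v : C(I, E)) (s : ℝ) : E := v (projIcc 0 1 zero_le_one s)

theorem continuous_extendI {E : Type*} [TopologicalSpace E] (v : C(I, E)) : Continuous (extendI v) :=
  v.continuous.comp continuous_projIcc

theorem extendI_of_mem {E : Type*} [TopologicalSpace E] (v : C(I, E)) {s : ℝ}
    (hs : s ∈ Icc (0 : ℝ) 1) : extendI v s = v ⟨s, hs⟩ := by
  rw [extendI, projIcc_of_mem _ hs]

variable (E : Type) [NormedAddCommGroup E] [NormedSpace ℝ E]

/-- Constant functions, as a bounded linear map. -/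
def constFun : E →L[ℝ] C(I, E) :=
  LinearMap.mkContinuous
    ({ toFun := fun x => ContinuousMap.const I x
       map_add' := fun _ _ => by ext; simp
       map_smul' := fun _ _ => by ext; simp } : E →ₗ[ℝ] C(I, E)) 1 (fun x => by
    refine (ContinuousMap.norm_le _ (by positivity)).mpr fun t => ?_
    simp)

variable {E}

@[simp] theorem constFun_apply (x : E) (t : I) : constFun E x t = x := rfl

variable (E)

/-- Integration from `0`, as a bounded linear map. -/
def primitive [CompleteSpace E] : C(I, E) →L[ℝ] C(I, E) :=
  LinearMap.mkContinuous
    ({ toFun := fun v => ⟨fun t => ∫ s in (0 : ℝ)..t, extendI v s,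
         (intervalIntegral.continuous_primitive
           (fun a b => (continuous_extendI v).intervalIntegrable a b) 0).comp
             continuous_subtype_val⟩
       map_add' := fun v w => by
        ext t
        exact intervalIntegral.integral_add ((continuous_extendI v).intervalIntegrable _ _)
          ((continuous_extendI w).intervalIntegrable _ _)
       map_smul' := fun c v => by
        ext t
        exact intervalIntegral.integral_smul c (extendI v) } : C(I, E) →ₗ[ℝ] C(I, E)) 1 (fun v => by
    refine (ContinuousMap.norm_le _ (by positivity)).mpr fun t => ?_
    have h := intervalIntegral.norm_integral_le_of_norm_le_const (a := 0) (b := (t : ℝ))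
      (f := extendI v) (C := ‖v‖) (fun s _ => v.norm_coe_le_norm _)
    refine h.trans ?_
    rw [one_mul, sub_zero, abs_of_nonneg t.2.1]
    exact mul_le_of_le_one_right (norm_nonneg _) t.2.2)

variable {E}

theorem primitive_apply [CompleteSpace E] (v : C(I, E)) (t : I) :
    primitive E v t = ∫ s in (0 : ℝ)..t, extendI v s := rfl

end IntegralEquation

end

/-! ### Rectification of commuting vector fields by the implicit function theorem. -/

section

open unitInterval

/-- Evaluation at `s` is bounded and linear, so both sides are the derivative of `v ↦ g (v s)` in
the direction `w`. An abstract derivative of the composition operator can thus be computed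
pointwise. -/
theorem fderiv_postcomp_apply {K : Type} [TopologicalSpace K] [CompactSpace K] {E F : Type}
    [NormedAddCommGroup E] [NormedSpace ℝ E] [NormedAddCommGroup F] [NormedSpace ℝ F]
    {g : C(E, F)} {u : C(K, E)} {D : C(K, E) →L[ℝ] C(K, F)}
    (hD : HasFDerivAt (fun v : C(K, E) => g.comp v) D u) (w : C(K, E)) (s : K)
    (hg : DifferentiableAt ℝ g (u s)) : D w s = fderiv ℝ g (u s) (w s) := by
  have h1 : HasFDerivAt (fun v : C(K, E) => g (v s)) ((ContinuousMap.evalCLM ℝ s).comp D) u :=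
    HasFDerivAt.comp (g := fun v : C(K, F) => v s) u
      (ContinuousLinearMap.hasFDerivAt (E := C(K, F)) (ContinuousMap.evalCLM ℝ s)) hD
  have h2 : HasFDerivAt (fun v : C(K, E) => g (v s))
      ((fderiv ℝ g (u s)).comp (ContinuousMap.evalCLM ℝ s)) u :=
    HasFDerivAt.comp (g := g) (f := fun v : C(K, E) => v s) u hg.hasFDerivAt
      (ContinuousLinearMap.hasFDerivAt (E := C(K, E)) (ContinuousMap.evalCLM ℝ s))
  exact congrArg (fun L : C(K, E) →L[ℝ] F => L w) (h1.unique h2)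

/-- Solution by the implicit function theorem of the equation
`v = c₀ + Λ z + J (B (N v) (Ξ z))` for small `z`, and of the linearized equation. -/
theorem exists_implicit_solution {E V A T : Type*} [NormedAddCommGroup E] [NormedSpace ℝ E]
    [CompleteSpace E] [NormedAddCommGroup V] [NormedSpace ℝ V] [CompleteSpace V]
    [NormedAddCommGroup A] [NormedSpace ℝ A] [NormedAddCommGroup T] [NormedSpace ℝ T]
    {k : WithTop ℕ∞} (hk1 : 1 ≤ k) {N : V → A} {c₀ : V} (hN : ∀ᶠ v in 𝓝 c₀, ContDiffAt ℝ k N v)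
    (B : A →L[ℝ] T →L[ℝ] V) (Λ : E →L[ℝ] V) (Ξ : E →L[ℝ] T) (J : V →L[ℝ] V) :
    ∃ ψ : E → V, ψ 0 = c₀ ∧ (∀ᶠ z in 𝓝 0, ContDiffAt ℝ k ψ z) ∧
      ∀ᶠ z in 𝓝 0, ψ z = c₀ + Λ z + J (B (N (ψ z)) (Ξ z)) ∧
        ∀ h w, w = Λ h + J (B (N (ψ z)) (Ξ h) + B (fderiv ℝ N (ψ z) w) (Ξ z)) →
          fderiv ℝ ψ z h = w := by
  have hk0 : k ≠ 0 := (zero_lt_one.trans_le hk1).ne'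
  set G : E × V → V := fun p => p.2 - (c₀ + Λ p.1 + J (B (N p.2) (Ξ p.1))) with hG
  set G' : E × V → E × V →L[ℝ] V := fun p => ContinuousLinearMap.snd ℝ E V -
        (Λ.comp (ContinuousLinearMap.fst ℝ E V) +
          J.comp ((B (N p.2)).comp (Ξ.comp (ContinuousLinearMap.fst ℝ E V)) +
            (B.flip (Ξ p.1)).comp ((fderiv ℝ N p.2).comp (ContinuousLinearMap.snd ℝ E V)))) with hG'
  have hGd : ∀ p : E × V, DifferentiableAt ℝ N p.2 → HasFDerivAt G (G' p) p := by
    intro p hD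
    have h1 : HasFDerivAt (fun p : E × V => N p.2)
        ((fderiv ℝ N p.2).comp (ContinuousLinearMap.snd ℝ E V)) p :=
      hD.hasFDerivAt.comp p hasFDerivAt_snd
    have h2 : HasFDerivAt (fun p : E × V => Ξ p.1)
        (Ξ.comp (ContinuousLinearMap.fst ℝ E V)) p := Ξ.hasFDerivAt.comp p hasFDerivAt_fst
    have h3 := B.hasFDerivAt_of_bilinear h1 h2
    have h4 : HasFDerivAt (fun p : E × V => Λ p.1)
        (Λ.comp (ContinuousLinearMap.fst ℝ E V)) p := Λ.hasFDerivAt.comp p hasFDerivAt_fst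
    have h5 := ((h4.const_add c₀).add (J.hasFDerivAt.comp p h3))
    refine (hasFDerivAt_snd.sub h5).congr_fderiv ?_
    ext q <;> simp [hG']
  have hGc : ∀ᶠ p in 𝓝 ((0 : E), c₀), ContDiffAt ℝ k G p := by
    have h := (continuousAt_snd (p := ((0 : E), c₀))).eventually hN
    filter_upwards [h] with p hp
    have h1 : ContDiffAt ℝ k (fun p : E × V => N p.2) p :=
      ContDiffAt.comp (g := N) p hp contDiffAt_snd
    have h2 : ContDiffAt ℝ k (fun p : E × V => Ξ p.1) p := Ξ.contDiff.contDiffAt.comp p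
      contDiffAt_fst
    have h3 : ContDiffAt ℝ k (fun p : E × V => B (N p.2) (Ξ p.1)) p :=
      B.isBoundedBilinearMap.contDiff.contDiffAt.comp p (h1.prodMk h2)
    exact contDiffAt_snd.sub ((contDiffAt_const.add (Λ.contDiff.contDiffAt.comp p
      contDiffAt_fst)).add (J.contDiff.contDiffAt.comp p h3))
  have hGp := hGc.self_of_nhds
  have hG0 : G (0, c₀) = 0 := by simp [hG]
  -- At `z = 0` the factor `Ξ z` kills the nonlinear term, so the partial derivative in `v` is the
  -- identity.
  have hGi : fderiv ℝ G (0, c₀) ∘L .inr ℝ E V = ContinuousLinearMap.id ℝ _ := by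
    rw [(hGd (0, c₀) (hN.self_of_nhds.differentiableAt hk0)).fderiv]
    ext w
    simp [hG']
  have hinv₀ : (fderiv ℝ G (0, c₀) ∘L .inr ℝ E V).IsInvertible := by
    rw [hGi]; exact ⟨ContinuousLinearEquiv.refl ℝ _, rfl⟩
  have hinv : ∀ᶠ p in 𝓝 ((0 : E), c₀), (fderiv ℝ G p ∘L .inr ℝ E V).IsInvertible := by
    have h1 : ContinuousAt (fun p => fderiv ℝ G p ∘L .inr ℝ E V) (0, c₀) := by
      have h2 : ContinuousAt (fderiv ℝ G) (0, c₀) :=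
        (hGp.fderiv_right (m := 0) (by simpa using hk1)).continuousAt
      exact h2.clm_comp continuousAt_const
    have h3 : {L : V →L[ℝ] V | L.IsInvertible} ∈ 𝓝 (fderiv ℝ G (0, c₀) ∘L .inr ℝ E V) := by
      rw [hGi]
      exact ContinuousLinearEquiv.nhds (ContinuousLinearEquiv.refl ℝ V)
    exact h1.eventually h3
  set ψ := hGp.implicitFunction hk0 hinv₀ with hψ
  have hψ0 : ψ 0 = c₀ := hGp.implicitFunction_apply_self hk0 hinv₀
  have hψc : ∀ᶠ z in 𝓝 (0 : E), ContDiffAt ℝ k ψ z :=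
    eventually_contDiffAt_implicitFunction hGp hk0 hinv₀ hGc hinv
  have hψs : ∀ᶠ z in 𝓝 (0 : E), G (z, ψ z) = 0 := by
    have := hGp.eventually_apply_implicitFunction hk0 hinv₀
    rwa [hG0] at this
  have hψt : Tendsto (fun z => (z, ψ z)) (𝓝 0) (𝓝 ((0 : E), c₀)) := by
    have : ContinuousAt (fun z => (z, ψ z)) 0 :=
      continuousAt_id.prodMk hψc.self_of_nhds.continuousAt
    simpa [ContinuousAt, hψ0] using this
  have hψt2 : Tendsto ψ (𝓝 0) (𝓝 c₀) := hψ0 ▸ hψc.self_of_nhds.continuousAt.tendsto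
  refine ⟨ψ, hψ0, hψc, ?_⟩
  filter_upwards [hψc, eventually_eventually_nhds.mpr hψs, hψt2.eventually hN,
    hψt.eventually hinv] with z h1 h2 h3 h4
  refine ⟨sub_eq_zero.mp h2.self_of_nhds, fun h w hw => ?_⟩
  have hd := hGd (z, ψ z) (h3.differentiableAt hk0)
  -- Both `(h, ψ' h)` and `(h, w)` lie in the kernel of `G'`, the first by differentiating `G (z, ψ
  -- z) = 0`. Invertibility in the second variable forces `ψ' h = w`.
  have e1 : G' (z, ψ z) (h, fderiv ℝ ψ z h) = 0 := by
    have h5 : HasFDerivAt (fun z => G (z, ψ z)) _ z :=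
      HasFDerivAt.comp (g := G) (f := fun z => (z, ψ z)) z hd ((hasFDerivAt_id z).prodMk (h1.differentiableAt hk0).hasFDerivAt)
    have h6 : HasFDerivAt (fun z => G (z, ψ z)) (0 : E →L[ℝ] V) z :=
      (hasFDerivAt_const 0 z).congr_of_eventuallyEq h2
    exact congrArg (fun L : E →L[ℝ] V => L h) (h5.unique h6)
  have e2 : G' (z, ψ z) (h, w) = 0 := by
    have : G' (z, ψ z) (h, w) =
        w - (Λ h + J (B (N (ψ z)) (Ξ h) + B (fderiv ℝ N (ψ z) w) (Ξ z))) := rfl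
    rw [this, sub_eq_zero]
    exact hw
  obtain ⟨e, he⟩ := h4
  rw [hd.fderiv] at he
  have e3 : e (fderiv ℝ ψ z h - w) = 0 := by
    have : e (fderiv ℝ ψ z h - w) = G' (z, ψ z) ((h, fderiv ℝ ψ z h) - (h, w)) := by
      rw [← ContinuousLinearEquiv.coe_coe, he]
      simp
    rw [this, map_sub, e1, e2, sub_zero]
  exact sub_eq_zero.mp (e.injective (e3.trans (map_zero e).symm))

/-- If the vector fields `x ↦ S x ξ`, `ξ ∈ T`, commute and take the values `ξ` at `x₀`, then the map which follows the field `S · ξ` for unit time from the point `x₀ + c`, where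
`z = ξ + c` is the decomposition given by a projection onto `T`, sends the directions of `T`
to the fields. -/
theorem exists_rectifying_map {E T : Type} [NormedAddCommGroup E] [NormedSpace ℝ E]
    [FiniteDimensional ℝ E] [NormedAddCommGroup T] [NormedSpace ℝ T]
    (ι : T →L[ℝ] E) (Pr : E →L[ℝ] T) (hPr : ∀ ξ : T, Pr (ι ξ) = ξ)
    {k : WithTop ℕ∞} (hk : k = ∞ ∨ k = ω) {X : Set E} (hX : IsOpen X) {S : E → T →L[ℝ] E}
    (hS : ContDiffOn ℝ k S X) {x₀ : E} (hx₀ : x₀ ∈ X) (hS₀ : ∀ ξ : T, S x₀ ξ = ι ξ)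
    (hcomm : ∀ x ∈ X, ∀ ξ η : T, fderiv ℝ S x (S x ξ) η = fderiv ℝ S x (S x η) ξ) :
    ∃ Θ : E → E, (∀ᶠ z in 𝓝 0, ContDiffAt ℝ k Θ z) ∧ Θ 0 = x₀ ∧
      HasFDerivAt Θ (ContinuousLinearMap.id ℝ E) 0 ∧
      ∀ᶠ z in 𝓝 0, ∀ η : T, fderiv ℝ Θ z (ι η) = S (Θ z) η := by
  have : CompleteSpace E := FiniteDimensional.complete ℝ E
  have hk1 : (1 : WithTop ℕ∞) ≤ k := by
    rcases hk with rfl | rfl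
    · exact_mod_cast le_top
    · exact le_top
  have hk0 : k ≠ 0 := (zero_lt_one.trans_le hk1).ne'
  obtain ⟨g, hgS, hN⟩ := exists_continuousMap_contDiffAt_postcomp (K := I) hk hX hS hx₀
  -- The unknown is a curve solving `v t = x₀ + (z - ι (Pr z)) + ∫₀ᵗ g (v s) (Pr z) ds`. Dependence
  -- on `z` in the class `C^k` comes from the implicit function theorem in `C(I, E)`; the rectifying
  -- map is the value at time `1`.
  obtain ⟨ψ, hψ0, hψc, hψs⟩ := exists_implicit_solution (V := C(I, E)) (A := C(I, T →L[ℝ] E))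
    (T := C(I, T)) hk1 (N := fun v => g.comp v) (c₀ := constFun E x₀) hN
    (pointwiseApply I T E) ((constFun E).comp (ContinuousLinearMap.id ℝ E - ι.comp Pr))
    ((constFun T).comp Pr) (primitive E)
  have hψt : Tendsto ψ (𝓝 0) (𝓝 (constFun E x₀)) :=
    hψ0 ▸ hψc.self_of_nhds.continuousAt.tendsto
  obtain ⟨r, hr, hball⟩ := Metric.eventually_nhds_iff.mp
    ((eventually_eventually_nhds.mpr hgS).and (hX.mem_nhds hx₀))
  have hψb : ∀ᶠ z in 𝓝 (0 : E), ∀ t, dist (ψ z t) x₀ < r := by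
    filter_upwards [hψt.eventually (Metric.ball_mem_nhds (constFun E x₀) hr)] with z hz t
    exact (ContinuousMap.dist_apply_le_dist t).trans_lt hz
  have hΘd : ∀ z, DifferentiableAt ℝ ψ z → HasFDerivAt (fun z => ψ z 1)
      ((ContinuousLinearMap.comp (M₂ := C(I, E)) (ContinuousMap.evalCLM ℝ (1 : I))
        (fderiv ℝ ψ z))) z := by
    intro z hz
    exact HasFDerivAt.comp (g := fun v : C(I, E) => v 1) z
      (ContinuousLinearMap.hasFDerivAt (E := C(I, E)) (ContinuousMap.evalCLM ℝ (1 : I)))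
      hz.hasFDerivAt
  have hone : ((1 : I) : ℝ) = 1 := rfl
  refine ⟨fun z => ψ z 1, ?_, ?_, ?_, ?_⟩
  · filter_upwards [hψc] with z hz
    exact ContDiffAt.comp (g := fun v : C(I, E) => v 1) z
      (ContinuousLinearMap.contDiff (E := C(I, E)) (ContinuousMap.evalCLM ℝ (1 : I))).contDiffAt hz
  · simp [hψ0]
  -- At `z = 0` the curve is constant, and the linearized equation evaluated at time `1` gives `(h -
  -- ι (Pr h)) + ι (Pr h) = h`.
  · refine (hΘd 0 (hψc.self_of_nhds.differentiableAt hk0)).congr_fderiv ?_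
    ext h
    have h0 : g x₀ = S x₀ := hgS.self_of_nhds
    have h1 := (hψs.self_of_nhds).2 h
      ((constFun E).comp (ContinuousLinearMap.id ℝ E - ι.comp Pr) h +
        primitive E (pointwiseApply I T E (g.comp (ψ 0)) ((constFun T).comp Pr h))) (by
          rw [map_zero ((constFun T).comp Pr), map_zero, add_zero])
    have h2 : ∀ s, extendI (pointwiseApply I T E (g.comp (ψ 0)) ((constFun T).comp Pr h)) s
        = ι (Pr h) := by
      intro s
      simp [extendI, hψ0, h0, hS₀]
    have h3 : (ContinuousLinearMap.comp (M₂ := C(I, E)) (ContinuousMap.evalCLM ℝ (1 : I))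
        (fderiv ℝ ψ 0)) h = fderiv ℝ ψ 0 h 1 := rfl
    rw [h3, h1, ContinuousMap.add_apply, primitive_apply]
    simp only [h2]
    simp
  · filter_upwards [hψc, hψb, hψs, hψt.eventually hN] with z h1 h2 h3 h4 η
    set u := ψ z with hu
    set ξ := Pr z with hξ
    have hgu : ∀ t : I, g (u t) = S (u t) ∧ fderiv ℝ g (u t) = fderiv ℝ S (u t) ∧ u t ∈ X := by
      intro t
      have h5 : g =ᶠ[𝓝 (u t)] S := (hball (h2 t)).1
      exact ⟨h5.self_of_nhds, h5.fderiv_eq, (hball (h2 t)).2⟩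
    have hgd : ∀ t : I, DifferentiableAt ℝ g (u t) := fun t =>
      ((hS.contDiffAt (hX.mem_nhds (hgu t).2.2)).congr_of_eventuallyEq
        (hball (h2 t)).1).differentiableAt hk0
    -- Candidate for the derivative of the curve in the direction `ι η`. At time `1` it is the field
    -- `S · η` along the curve, as wanted.
    set Z : C(I, E) := ⟨fun t => (t : ℝ) • g (u t) η, by fun_prop⟩ with hZ
    have hv : Continuous fun s => g (extendI u s) ξ :=
      (g.continuous.comp (continuous_extendI u)).clm_apply continuous_const
    have hut : ∀ t : I, u t = x₀ + (z - ι ξ) + ∫ s in (0 : ℝ)..t, g (extendI u s) ξ := by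
      intro t
      have := congrArg (fun v : C(I, E) => v t) h3.1
      simp only [ContinuousMap.add_apply, primitive_apply] at this
      have e : ∀ s, extendI (pointwiseApply I T E (g.comp u) ((constFun T).comp Pr z)) s =
        g (extendI u s) ξ := fun s => rfl
      simp only [e] at this
      simpa using this
    have hU : ∀ s ∈ Ioo (0 : ℝ) 1, HasDerivAt (extendI u) (g (extendI u s) ξ) s := by
      intro s hs
      have h5 : HasDerivAt (fun t => x₀ + (z - ι ξ) + ∫ s in (0 : ℝ)..t, g (extendI u s) ξ)
          (g (extendI u s) ξ) s := (hv.integral_hasStrictDerivAt 0 s).hasDerivAt.const_add _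
      refine h5.congr_of_eventuallyEq ?_
      filter_upwards [Ioo_mem_nhds hs.1 hs.2] with t ht
      rw [extendI_of_mem u ⟨ht.1.le, ht.2.le⟩]
      exact hut _
    -- `Z` solves the linearized equation: its time derivative is `S η + t S' (S ξ) η` along the
    -- curve, and commutation exchanges `ξ` and `η` in the last term.
    have key : Z = (constFun E).comp (ContinuousLinearMap.id ℝ E - ι.comp Pr) (ι η) +
        primitive E (pointwiseApply I T E (g.comp u) ((constFun T).comp Pr (ι η)) +
          pointwiseApply I T E (fderiv ℝ (fun v : C(I, E) => g.comp v) u Z)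
            ((constFun T).comp Pr z)) := by
      ext t
      rw [ContinuousMap.add_apply, primitive_apply]
      have e0 : (constFun E).comp (ContinuousLinearMap.id ℝ E - ι.comp Pr) (ι η) t = 0 := by
        simp [hPr]
      have hD := (h4.differentiableAt hk0).hasFDerivAt
      set w : C(I, E) := pointwiseApply I T E (g.comp u) ((constFun T).comp Pr (ι η)) +
          pointwiseApply I T E (fderiv ℝ (fun v : C(I, E) => g.comp v) u Z)
            ((constFun T).comp Pr z) with hw
      have e1 : ∀ s : I, w s = g (u s) η + fderiv ℝ g (u s) (Z s) ξ := by
        intro s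
        rw [hw, ContinuousMap.add_apply, pointwiseApply_apply, pointwiseApply_apply,
          fderiv_postcomp_apply hD Z s (hgd s)]
        simp [hPr, hξ]
      have hF : ∀ s ∈ Ioo (0 : ℝ) t, HasDerivAt (fun s => s • g (extendI u s) η)
          (extendI w s) s := by
        intro s hs
        have hs1 : s ∈ Ioo (0 : ℝ) 1 := ⟨hs.1, hs.2.trans_le t.2.2⟩
        have hsI : s ∈ Icc (0 : ℝ) 1 := ⟨hs1.1.le, hs1.2.le⟩
        have hus := extendI_of_mem u hsI
        have h5 : HasDerivAt (fun s => g (extendI u s))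
            (fderiv ℝ g (u ⟨s, hsI⟩) (g (u ⟨s, hsI⟩) ξ)) s := by
          have h6 := hU s hs1
          rw [hus] at h6
          exact ((hgd ⟨s, hsI⟩).hasFDerivAt.congr_fderiv rfl).comp_hasDerivAt_of_eq s h6 hus.symm
        have h7 := (hasDerivAt_id s).smul (h5.clm_apply (hasDerivAt_const s η))
        refine h7.congr_deriv ?_
        rw [extendI_of_mem w hsI, e1]
        have hc := hcomm _ (hgu ⟨s, hsI⟩).2.2 ξ η
        have e2 : Z ⟨s, hsI⟩ = s • g (u ⟨s, hsI⟩) η := rfl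
        rw [e2, map_smul, (hgu ⟨s, hsI⟩).2.1, (hgu ⟨s, hsI⟩).1, smul_apply, ← hc, hus]
        simp [(hgu ⟨s, hsI⟩).1, add_comm]
      have h8 := intervalIntegral.integral_eq_sub_of_hasDerivAt_of_le t.2.1
        (f := fun s => s • g (extendI u s) η) (f' := extendI w)
        ((continuous_id.smul ((g.continuous.comp (continuous_extendI u)).clm_apply
          continuous_const)).continuousOn) hF ((continuous_extendI w).intervalIntegrable _ _)
      rw [e0, h8, extendI_of_mem u t.2]
      simp [hZ]
    have h9 := h3.2 (ι η) Z key
    rw [(hΘd z (h1.differentiableAt hk0)).fderiv]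
    have h10 : (ContinuousLinearMap.comp (M₂ := C(I, E)) (ContinuousMap.evalCLM ℝ (1 : I))
        (fderiv ℝ ψ z)) (ι η) = fderiv ℝ ψ z (ι η) 1 := rfl
    rw [h10, h9, ← (hgu 1).1]
    simp [hZ]

end

/-! ### The Frobenius theorem -/

theorem one_le_of_smooth_or_analytic {k : WithTop ℕ∞} (hk : k = ∞ ∨ k = ω) : 1 ≤ k := by
  rcases hk with rfl | rfl
  · exact_mod_cast le_top
  · exact le_top

theorem IsSection.mono {n : ℕ} {k : WithTop ℕ∞} {Δ : Vec n → Submodule ℝ (Vec n)}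
    {V V' : Set (Vec n)} {Y : Vec n → Vec n} (h : IsSection k Δ V Y) (hV' : IsOpen V')
    (hVV' : V' ⊆ V) : IsSection k Δ V' Y :=
  ⟨hV', h.2.1.mono hVV', fun x hx => h.2.2 x (hVV' hx)⟩

/-- A distribution which is spanned at `x₀` by local sections and has constant dimension is the
range, near `x₀`, of a `C^k` family of injective linear maps, normalized by a projection. -/
theorem exists_parametrization {n : ℕ} {k : WithTop ℕ∞} {X : Set (Vec n)} (hX : IsOpen X)
    {Δ : Vec n → Submodule ℝ (Vec n)}
    {r : ℕ} (hr : ∀ x ∈ X, Module.finrank ℝ (Δ x) = r) {x₀ : Vec n} (hx₀ : x₀ ∈ X)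
    (hreg : ∀ v ∈ Δ x₀, ∃ (V : Set (Vec n)) (Y : Vec n → Vec n), V ⊆ X ∧ x₀ ∈ V ∧
      IsSection k Δ V Y ∧ Y x₀ = v)
    (Pr : Vec n →L[ℝ] Δ x₀) (hPr : ∀ ξ : Δ x₀, Pr ξ = ξ) :
    ∃ (V : Set (Vec n)) (S : Vec n → Δ x₀ →L[ℝ] Vec n), IsOpen V ∧ x₀ ∈ V ∧ V ⊆ X ∧
      ContDiffOn ℝ k S V ∧ (∀ ξ : Δ x₀, S x₀ ξ = ξ) ∧
      (∀ x ∈ V, ∀ ξ : Δ x₀, Pr (S x ξ) = ξ ∧ S x ξ ∈ Δ x) ∧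
      ∀ x ∈ V, ∀ v ∈ Δ x, S x (Pr v) = v := by
  classical
  set b := Module.finBasis ℝ (Δ x₀)
  choose V Y hVX hxV hsec hY using fun i => hreg (b i) (b i).2
  set V₀ : Set (Vec n) := X ∩ ⋂ i, V i with hV₀
  have hV₀o : IsOpen V₀ := hX.inter (isOpen_iInter_of_finite fun i => (hsec i).1)
  have hxV₀ : x₀ ∈ V₀ := ⟨hx₀, mem_iInter.mpr hxV⟩
  have hV₀i : ∀ i, V₀ ⊆ V i := fun i x hx => mem_iInter.mp hx.2 i
  set c : ∀ i, Δ x₀ →L[ℝ] ℝ := fun i => LinearMap.toContinuousLinearMap (b.coord i) with hc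
  set M : Vec n → Δ x₀ →L[ℝ] Vec n := fun x => ∑ i, (c i).smulRight (Y i x) with hM
  have hMc : ContDiffOn ℝ k M V₀ := by
    refine ContDiffOn.sum fun i _ => ?_
    exact contDiffOn_const.smulRight ((hsec i).2.1.mono (hV₀i i))
  have hMx : ∀ x ξ, M x ξ = ∑ i, b.repr ξ i • Y i x := by
    intro x ξ
    simp [hM, hc]
  have hM0 : ∀ ξ : Δ x₀, M x₀ ξ = ξ := by
    intro ξ
    rw [hMx]
    simp only [hY]
    simpa only [map_sum, map_smul, Submodule.subtype_apply] using
      congrArg (Δ x₀).subtype (b.sum_repr ξ)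
  have hMΔ : ∀ x ∈ V₀, ∀ ξ, M x ξ ∈ Δ x := by
    intro x hx ξ
    rw [hMx]
    exact Submodule.sum_mem _ fun i _ => Submodule.smul_mem _ _ ((hsec i).2.2 x (hV₀i i hx))
  -- `P` is the identity at `x₀`, hence invertible nearby; composing `M` with its inverse normalizes
  -- the frame so that `Pr (S x ξ) = ξ`.
  set P : Vec n → Δ x₀ →L[ℝ] Δ x₀ := fun x => Pr.comp (M x) with hP
  have hPc : ContDiffOn ℝ k P V₀ := contDiffOn_const.clm_comp hMc
  set V₁ : Set (Vec n) := {x ∈ V₀ | (P x).IsInvertible} with hV₁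
  have hV₁o : IsOpen V₁ := hPc.continuousOn.isOpen_inter_preimage hV₀o
    (ContinuousLinearEquiv.isOpen (𝕜 := ℝ) (E := Δ x₀) (F := Δ x₀))
  have hP0 : P x₀ = ContinuousLinearMap.id ℝ (Δ x₀) := by
    ext1 ξ
    simp [hP, hM0, hPr]
  have hxV₁ : x₀ ∈ V₁ := ⟨hxV₀, by rw [hP0]; exact ⟨ContinuousLinearEquiv.refl ℝ (Δ x₀), rfl⟩⟩
  set S : Vec n → Δ x₀ →L[ℝ] Vec n := fun x => (M x).comp (P x).inverse with hS
  have hPS : ∀ x ∈ V₁, ∀ ξ, Pr (S x ξ) = ξ := by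
    rintro x ⟨-, e, he⟩ ξ
    have : Pr (S x ξ) = (P x) ((P x).inverse ξ) := rfl
    rw [this, ← he]
    simp
  have hSΔ : ∀ x ∈ V₁, ∀ ξ, S x ξ ∈ Δ x := fun x hx ξ => hMΔ x hx.1 _
  refine ⟨V₁, S, hV₁o, hxV₁, fun x hx => hx.1.1, ?_, ?_, fun x hx ξ => ⟨hPS x hx ξ, hSΔ x hx ξ⟩, ?_⟩
  · refine (hMc.mono fun x hx => hx.1).clm_comp ?_
    intro x hx
    exact (hx.2.contDiffAt_map_inverse).comp_contDiffWithinAt x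
      ((hPc x hx.1).mono fun x hx => hx.1)
  · intro ξ
    simp [hS, hP0, hM0]
  · intro x hx v hv
    -- Constant dimension turns injectivity of `S x` into surjectivity onto `Δ x`.
    set L : Δ x₀ →ₗ[ℝ] Δ x := LinearMap.codRestrict (Δ x) (S x : Δ x₀ →ₗ[ℝ] Vec n) (hSΔ x hx)
    have hLi : Function.Injective L := by
      intro ξ η h
      have h1 : S x ξ = S x η := congrArg Subtype.val h
      rw [← hPS x hx ξ, h1, hPS x hx η]
    have hLs : Function.Surjective L :=
      (LinearMap.injective_iff_surjective_of_finrank_eq_finrank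
        ((hr x₀ hx₀).trans (hr x hx.1.1).symm)).mp hLi
    obtain ⟨ξ, hξ⟩ := hLs ⟨v, hv⟩
    have h1 : S x ξ = v := congrArg Subtype.val hξ
    rw [← h1, hPS x hx ξ]

/-- **Frobenius theorem**: the covectors that annihilate an integrable distribution at a point are
differentials of functions that annihilate it near this point. -/
theorem exists_firstIntegrals {n : ℕ} {k : WithTop ℕ∞} (hk : k = ∞ ∨ k = ω) {X : Set (Vec n)}
    (hX : IsOpen X) {Δ : Vec n → Submodule ℝ (Vec n)} (hΔ : IsIntegrable k X Δ) {x₀ : Vec n}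
    (hx₀ : x₀ ∈ X)
    (hreg : ∀ v ∈ Δ x₀, ∃ (V : Set (Vec n)) (Y : Vec n → Vec n), V ⊆ X ∧ x₀ ∈ V ∧
      IsSection k Δ V Y ∧ Y x₀ = v) :
    ∃ X' : Set (Vec n), IsOpen X' ∧ x₀ ∈ X' ∧ X' ⊆ X ∧ ∀ l : Vec n →L[ℝ] ℝ,
      (∀ v ∈ Δ x₀, l v = 0) → ∃ h : Vec n → ℝ, ContDiffOn ℝ k h X' ∧
        (∀ x ∈ X', ∀ v ∈ Δ x, fderiv ℝ h x v = 0) ∧ fderiv ℝ h x₀ = l := by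
  have hk1 := one_le_of_smooth_or_analytic hk
  have hk0 : k ≠ 0 := (zero_lt_one.trans_le hk1).ne'
  obtain ⟨⟨r, hr⟩, hinv⟩ := hΔ
  set Pr : Vec n →L[ℝ] Δ x₀ := (Δ x₀).orthogonalProjectionOnto with hPrdef
  have hPr : ∀ ξ : Δ x₀, Pr ξ = ξ := fun ξ => by simp [hPrdef]
  obtain ⟨V, S, hVo, hxV, hVX, hSc, hS0, hS1, hS2⟩ :=
    exists_parametrization hX hr hx₀ hreg Pr hPr
  -- The bracket of two fields of the normalized frame lies in `Δ x` by involutivity. It is killed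
  -- by `Pr`, because `Pr (S y ζ) = ζ` is constant in `y`. As `S x ∘ Pr` is the identity on `Δ x`,
  -- the bracket vanishes.
  have hcomm : ∀ x ∈ V, ∀ ξ η, fderiv ℝ S x (S x ξ) η = fderiv ℝ S x (S x η) ξ := by
    intro x hx ξ η
    have hsec : ∀ ζ : Δ x₀, IsSection k Δ V fun y => S y ζ := fun ζ =>
      ⟨hVo, hSc.clm_apply contDiffOn_const, fun y hy => (hS1 y hy ζ).2⟩
    have hbr := hinv V _ _ hVX (hsec ξ) (hsec η) x hx
    have hSd : HasFDerivAt S (fderiv ℝ S x) x :=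
      ((hSc.contDiffAt (hVo.mem_nhds hx)).differentiableAt hk0).hasFDerivAt
    have hYd : ∀ ζ : Δ x₀, HasFDerivAt (fun y => S y ζ) ((fderiv ℝ S x).flip ζ) x := by
      intro ζ
      refine (hSd.clm_apply (hasFDerivAt_const ζ x)).congr_fderiv ?_
      ext v
      simp
    have hPd : ∀ ζ : Δ x₀, ∀ v, Pr (fderiv ℝ S x v ζ) = 0 := by
      intro ζ v
      have h1 : HasFDerivAt (fun y => Pr (S y ζ)) (Pr.comp ((fderiv ℝ S x).flip ζ)) x :=
        Pr.hasFDerivAt.comp x (hYd ζ)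
      have h2 : HasFDerivAt (fun y => Pr (S y ζ)) (0 : Vec n →L[ℝ] Δ x₀) x := by
        refine (hasFDerivAt_const ζ x).congr_of_eventuallyEq ?_
        filter_upwards [hVo.mem_nhds hx] with y hy
        exact (hS1 y hy ζ).1
      have := congrArg (fun L : Vec n →L[ℝ] Δ x₀ => L v) (h1.unique h2)
      simpa using this
    rw [VectorField.lieBracket_eq] at hbr
    simp only [(hYd _).fderiv, ContinuousLinearMap.flip_apply] at hbr
    have h3 := hS2 x hx _ hbr
    rw [map_sub, hPd, hPd, sub_zero, map_zero] at h3
    exact sub_eq_zero.mp h3.symm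
  obtain ⟨Θ, hΘc, hΘ0, hΘi, hΘs⟩ := exists_rectifying_map (Δ x₀).subtypeL Pr hPr hk hVo hSc hxV
    hS0 hcomm
  obtain ⟨O, hO, hOo, h0O⟩ := eventually_nhds_iff.mp (hΘc.and hΘs)
  have hΘO : ContDiffOn ℝ k Θ O := fun z hz => (hO z hz).1.contDiffWithinAt
  obtain ⟨Φ, hΦ, h0Φ, hΦO, hΦc, hΦd⟩ := exists_openPartialHomeomorph_of_contDiffOn hk1 hOo hΘO h0O
    (e := ContinuousLinearEquiv.refl ℝ (Vec n)) hΘi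
  have hxt : x₀ ∈ Φ.target := by
    rw [← hΘ0, ← hΦ]; exact Φ.map_source h0Φ
  have hsymm : ∀ x ∈ Φ.target, ∃ e' : Vec n ≃L[ℝ] Vec n,
      HasFDerivAt Θ (e' : Vec n →L[ℝ] Vec n) (Φ.symm x) ∧
      HasFDerivAt Φ.symm (e'.symm : Vec n →L[ℝ] Vec n) x := by
    intro x hx
    obtain ⟨e', he'⟩ := hΦd _ (Φ.map_target hx)
    exact ⟨e', he', Φ.hasFDerivAt_symm hx (by rw [hΦ]; exact he')⟩
  -- In the coordinates `Φ.symm` the distribution is the constant subspace `Δ x₀`, so linear forms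
  -- annihilating this subspace are first integrals.
  refine ⟨Φ.target ∩ V, Φ.open_target.inter hVo, ⟨hxt, hxV⟩, fun x hx => hVX hx.2, fun l hl =>
    ⟨fun x => l (Φ.symm x), l.contDiff.comp_contDiffOn (hΦc.mono inter_subset_left), ?_, ?_⟩⟩
  · rintro x ⟨hx, hxV'⟩ v hv
    obtain ⟨e', he', hes⟩ := hsymm x hx
    have h1 : HasFDerivAt (fun x => l (Φ.symm x)) (l.comp (e'.symm : Vec n →L[ℝ] Vec n)) x :=
      l.hasFDerivAt.comp x hes
    have h2 := (hO _ (hΦO (Φ.map_target hx))).2 (Pr v)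
    have h3 : Θ (Φ.symm x) = x := by rw [← hΦ]; exact Φ.right_inv hx
    rw [h3, hS2 x hxV' v hv, he'.fderiv] at h2
    have h4 : e'.symm v = (Δ x₀).subtypeL (Pr v) := by
      exact (ContinuousLinearEquiv.symm_apply_eq e').mpr h2.symm
    rw [h1.fderiv]
    change l (e'.symm v) = 0
    rw [h4]
    exact hl _ (Pr v).2
  · obtain ⟨e', he', hes⟩ := hsymm x₀ hxt
    have h3 : Φ.symm x₀ = 0 := by
      rw [← hΘ0, ← hΦ]; exact Φ.left_inv h0Φ
    rw [h3] at he'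
    have h4 : ∀ v, e' v = v := fun v =>
      congrArg (fun L : Vec n →L[ℝ] Vec n => L v) (he'.unique hΘi)
    have h1 : HasFDerivAt (fun x => l (Φ.symm x)) (l.comp (e'.symm : Vec n →L[ℝ] Vec n)) x₀ :=
      l.hasFDerivAt.comp x₀ hes
    rw [h1.fderiv]
    ext1 v
    change l (e'.symm v) = l v
    congr 1
    rw [ContinuousLinearEquiv.symm_apply_eq, h4]

/-! ### Linearizing coordinates -/

/-- A subspace on which a linear map is injective can be enlarged, inside a given subspace, so as
to have the same image as this subspace. -/
theorem exists_le_disjoint_ker_map_eq {K M V : Type*} [Field K] [AddCommGroup M] [Module K M]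
    [AddCommGroup V] [Module K V] (d : M →ₗ[K] V) {Y H : Submodule K M} (hYH : Y ≤ H)
    (hY : Disjoint Y (LinearMap.ker d)) :
    ∃ Z, Y ≤ Z ∧ Z ≤ H ∧ Disjoint Z (LinearMap.ker d) ∧ Z.map d = H.map d := by
  -- Inside `H`, a complement of `ker d ⊓ H` containing `Y` is needed: a complement `a` in the whole
  -- space is cut with `H`, and the modular law restores `a ⊓ H ⊔ ker d ⊓ H = H`.
  obtain ⟨a, hYa, ha⟩ := (hY.mono_right (inf_le_left (b := H))).exists_isCompl
  refine ⟨a ⊓ H, le_inf hYa hYH, inf_le_right, ?_, le_antisymm (Submodule.map_mono inf_le_right) ?_⟩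
  · rw [disjoint_iff, inf_assoc, inf_comm H, ha.inf_eq_bot]
  · have h1 : a ⊓ H ⊔ LinearMap.ker d ⊓ H = H := by
      rw [sup_comm, ← sup_inf_assoc_of_le a inf_le_right, sup_comm, ha.sup_eq_top, top_inf_eq]
    conv_lhs => rw [← h1]
    rw [Submodule.map_sup]
    refine sup_le le_rfl ?_
    rw [Submodule.map_le_iff_le_comap]
    intro z hz
    have : d z = 0 := hz.1
    simp [this]

/-- Given an operator `L` and a filtration `H` which is compatible with it, there is a linear
section of `d`, compatible with the first step of the filtration, whose range contains the image
under `L` of this step. -/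
theorem exists_section_of_filtration {K M V : Type*} [Field K] [AddCommGroup M] [Module K M]
    [AddCommGroup V] [Module K V] (d : M →ₗ[K] V) (L : M →ₗ[K] M) (H : ℕ → Submodule K M)
    (hH : ∀ j, H (j + 1) ≤ H j) (hL : ∀ j, ∀ h ∈ H (j + 1), L h ∈ H j)
    (hd : ∀ j, ∀ h ∈ H (j + 1), d (L h) ∈ (H (j + 1)).map d → d h ∈ (H (j + 2)).map d)
    {N : ℕ} (hN : (H N).map d = ⊥) (h0 : (H 0).map d = ⊤) :
    ∃ σ : V →ₗ[K] M, (∀ v, d (σ v) = v) ∧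
      ∀ v ∈ (H 1).map d, σ v ∈ H 1 ∧ L (σ v) = σ (d (L (σ v))) := by
  -- Induction from the deepest step of the filtration upwards: lifts `Z` of the values of `d` on
  -- one step are enlarged by `L Z`, then completed to lifts for the preceding step.
  have key : ∀ i j, i + j = N → ∃ Z Z' : Submodule K M, Z' ≤ Z ∧ Z ≤ H j ∧ Z' ≤ H (j + 1) ∧
      Disjoint Z (LinearMap.ker d) ∧ Z.map d = (H j).map d ∧ Z'.map d = (H (j + 1)).map d ∧
      Z' ≤ Z.comap L := by
    intro i
    induction i with
    | zero =>
      intro j hj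
      obtain rfl : j = N := by omega
      refine ⟨⊥, ⊥, le_rfl, bot_le, bot_le, disjoint_bot_left, ?_, ?_, bot_le⟩
      · rw [hN, Submodule.map_bot]
      · rw [Submodule.map_bot, eq_comm, eq_bot_iff, ← hN]
        exact Submodule.map_mono (hH j)
    | succ i ih =>
      intro j hj
      obtain ⟨Z, Z', hZZ, hZ, hZ', hdis, hmap, hmap', hLZ⟩ := ih (j + 1) (by omega)
      have hYH : Z ⊔ Z.map L ≤ H j := by
        refine sup_le (hZ.trans (hH j)) ?_
        rw [Submodule.map_le_iff_le_comap]
        exact fun z hz => hL j z (hZ hz)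
      -- If `a + L b` lies in `ker d` with `a, b ∈ Z`, then `hd` gives `d b ∈ (H (j + 2)).map d`.
      -- Since `d` is injective on `Z`, `b` belongs to `Z'`; thus `L b ∈ Z`, and `a + L b ∈ Z`
      -- vanishes.
      have hYd : Disjoint (Z ⊔ Z.map L) (LinearMap.ker d) := by
        rw [Submodule.disjoint_def] at hdis ⊢
        intro y hy hyd
        obtain ⟨a, ha, _, ⟨b, hb, rfl⟩, rfl⟩ := Submodule.mem_sup.mp hy
        have h1 : d (L b) = d (-a) := by
          rw [LinearMap.mem_ker, map_add] at hyd
          rw [map_neg, eq_neg_iff_add_eq_zero, add_comm]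
          exact hyd
        have h2 := hd j b (hZ hb) (h1 ▸ Submodule.mem_map_of_mem ((H (j + 1)).neg_mem (hZ ha)))
        rw [← hmap'] at h2
        obtain ⟨b', hb', hbb⟩ := h2
        have h3 : b' - b = 0 := hdis _ (Z.sub_mem (hZZ hb') hb) (by
          rw [LinearMap.mem_ker, map_sub, hbb, sub_self])
        obtain rfl := sub_eq_zero.mp h3
        exact hdis _ (Z.add_mem ha (hLZ hb')) hyd
      obtain ⟨Z₂, h1, h2, h3, h4⟩ := exists_le_disjoint_ker_map_eq d hYH hYd
      refine ⟨Z₂, Z, le_sup_left.trans h1, h2, hZ, h3, h4, hmap, ?_⟩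
      rw [← Submodule.map_le_iff_le_comap]
      exact le_sup_right.trans h1
  obtain ⟨Z, Z', hZZ, -, hZ', hdis, hmap, hmap', hLZ⟩ := key N 0 rfl
  rw [h0] at hmap
  have hinj : Function.Injective (d.domRestrict Z) := by
    rw [← LinearMap.ker_eq_bot, eq_bot_iff]
    intro z hz
    have := Submodule.disjoint_def.mp hdis z z.2 hz
    simpa using this
  have hsurj : Function.Surjective (d.domRestrict Z) := by
    intro v
    obtain ⟨z, hz, rfl⟩ : v ∈ Z.map d := hmap ▸ Submodule.mem_top
    exact ⟨⟨z, hz⟩, rfl⟩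
  set e := LinearEquiv.ofBijective (d.domRestrict Z) ⟨hinj, hsurj⟩ with he
  have hσ : ∀ z ∈ Z, (e.symm (d z) : M) = z := by
    intro z hz
    have : e ⟨z, hz⟩ = d z := rfl
    rw [← this, e.symm_apply_apply]
  refine ⟨Z.subtype ∘ₗ (e.symm : V →ₗ[K] Z), fun v => e.apply_symm_apply v, fun v hv => ?_⟩
  rw [← hmap'] at hv
  obtain ⟨z, hz, rfl⟩ := hv
  have h1 : (Z.subtype ∘ₗ (e.symm : V →ₗ[K] Z)) (d z) = z := hσ z (hZZ hz)
  rw [h1]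
  exact ⟨hZ' hz, (hσ _ (hLZ hz)).symm⟩

/-- A vector is determined by its pairings with linear forms. -/
theorem Vec.apply_sum_single {n : ℕ} (T : (Vec n →L[ℝ] ℝ) →ₗ[ℝ] ℝ) (l : Vec n →L[ℝ] ℝ) :
    l (∑ i, T (EuclideanSpace.proj i) • EuclideanSpace.single i (1 : ℝ)) = T l := by
  have h1 : l = ∑ i, l (EuclideanSpace.single i (1 : ℝ)) •
      (EuclideanSpace.proj i : Vec n →L[ℝ] ℝ) := by
    refine ContinuousLinearMap.coe_injective
      ((EuclideanSpace.basisFun (Fin n) ℝ).toBasis.ext fun j => ?_)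
    simp [Finset.sum_apply]
  conv_rhs => rw [h1]
  simp [map_sum, mul_comm]

/-- Transposition in coordinates. It converts linear relations between coordinate functions, which
are statements on forms, into a linear vector field. -/
theorem Vec.exists_transpose {n : ℕ} (τ : (Vec n →L[ℝ] ℝ) →ₗ[ℝ] (Vec n →L[ℝ] ℝ)) :
    ∃ A : Vec n →ₗ[ℝ] Vec n, ∀ l w, l (A w) = τ l w := by
  refine ⟨∑ i, (τ (EuclideanSpace.proj i) : Vec n →ₗ[ℝ] ℝ).smulRight
    (EuclideanSpace.single i (1 : ℝ)), fun l w => ?_⟩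
  have := Vec.apply_sum_single ((LinearMap.applyₗ w : (Vec n →ₗ[ℝ] ℝ) →ₗ[ℝ] ℝ) ∘ₗ
    (ContinuousLinearMap.coeLM ℝ) ∘ₗ τ) l
  simpa using this

/-- Linear forms separate vectors. -/
theorem Vec.ext_forms {n : ℕ} {v w : Vec n} (h : ∀ l : Vec n →L[ℝ] ℝ, l v = l w) : v = w := by
  ext i
  exact h (EuclideanSpace.proj i)

/-- A vector on which all forms that annihilate a subspace vanish belongs to it. -/
theorem Vec.mem_of_forms {n : ℕ} {D : Submodule ℝ (Vec n)} {v : Vec n}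
    (h : ∀ l : Vec n →L[ℝ] ℝ, (∀ w ∈ D, l w = 0) → l v = 0) : v ∈ D := by
  by_contra hv
  obtain ⟨l, hl, hD⟩ := Submodule.exists_le_ker_of_notMem hv
  exact hl (h (LinearMap.toContinuousLinearMap l) fun w hw => hD hw)

/-- The space of functions which are `C^k` on `X`. -/
def smoothOn {n : ℕ} (k : WithTop ℕ∞) (X : Set (Vec n)) : Submodule ℝ (Vec n → ℝ) where
  carrier := {h | ContDiffOn ℝ k h X}
  add_mem' := fun h h' => ContDiffOn.add h h'
  zero_mem' := contDiffOn_const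
  smul_mem' := fun _ _ h => contDiffOn_const.smul h

theorem differentiableAt_of_smoothOn {n : ℕ} {k : WithTop ℕ∞} (hk : k ≠ 0) {X : Set (Vec n)}
    (hX : IsOpen X) (h : smoothOn k X) {x : Vec n} (hx : x ∈ X) :
    DifferentiableAt ℝ (h : Vec n → ℝ) x :=
  (h.2.contDiffAt (hX.mem_nhds hx)).differentiableAt hk

/-- The differential at a point, as a linear map on smooth functions. -/
def differentialAt {n : ℕ} {k : WithTop ℕ∞} (hk : k ≠ 0) {X : Set (Vec n)} (hX : IsOpen X)
    {x : Vec n} (hx : x ∈ X) : smoothOn k X →ₗ[ℝ] (Vec n →L[ℝ] ℝ) where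
  toFun h := fderiv ℝ (h : Vec n → ℝ) x
  map_add' h h' := fderiv_add (differentiableAt_of_smoothOn hk hX h hx)
    (differentiableAt_of_smoothOn hk hX h' hx)
  map_smul' c h := fderiv_const_smul (differentiableAt_of_smoothOn hk hX h hx) c

theorem two_le_of_smooth_or_analytic {k : WithTop ℕ∞} (hk : k = ∞ ∨ k = ω) : 2 ≤ k := by
  rcases hk with rfl | rfl
  · change ((2 : ℕ∞) : WithTop ℕ∞) ≤ _
    exact WithTop.coe_le_coe.mpr le_top
  · exact le_top

theorem add_one_le_of_smooth_or_analytic {k : WithTop ℕ∞} (hk : k = ∞ ∨ k = ω) : k + 1 ≤ k := by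
  rcases hk with rfl | rfl
  · exact le_rfl
  · exact le_top

open Classical in
/-- The Lie derivative along a vector field, as an operator on smooth functions. -/
def lieDerivative {n : ℕ} {k : WithTop ℕ∞} (hk : k = ∞ ∨ k = ω) {X : Set (Vec n)} (hX : IsOpen X)
    {F : Vec n → Vec n} (hF : ContDiffOn ℝ k F X) : smoothOn k X →ₗ[ℝ] smoothOn k X where
  -- The value `0` outside `X` is what makes the operator linear: there `h` may fail to be
  -- differentiable and `fderiv` need not be additive.
  toFun h := ⟨fun x => if x ∈ X then fderiv ℝ (h : Vec n → ℝ) x (F x) else 0, by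
    refine ((h.2.fderiv_of_isOpen hX (add_one_le_of_smooth_or_analytic hk)).clm_apply
      hF).congr fun x hx => ?_
    simp [hx]⟩
  map_add' h h' := by
    ext x
    by_cases hx : x ∈ X
    · have : fderiv ℝ ((h : Vec n → ℝ) + (h' : Vec n → ℝ)) x = _ := (differentialAt
        (zero_lt_one.trans_le (one_le_of_smooth_or_analytic hk)).ne' hX hx).map_add h h'
      simp [hx, this, differentialAt]
    · simp [hx]
  map_smul' c h := by
    ext x
    by_cases hx : x ∈ X
    · have : fderiv ℝ (c • (h : Vec n → ℝ)) x = _ := (differentialAt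
        (zero_lt_one.trans_le (one_le_of_smooth_or_analytic hk)).ne' hX hx).map_smul c h
      simp [hx, this, differentialAt]
    · simp [hx]

theorem lieDerivative_apply {n : ℕ} {k : WithTop ℕ∞} (hk : k = ∞ ∨ k = ω) {X : Set (Vec n)}
    (hX : IsOpen X) {F : Vec n → Vec n} (hF : ContDiffOn ℝ k F X) (h : smoothOn k X) {x : Vec n}
    (hx : x ∈ X) : (lieDerivative hk hX hF h : Vec n → ℝ) x = fderiv ℝ (h : Vec n → ℝ) x (F x) :=
  if_pos hx

theorem fderiv_lieDerivative {n : ℕ} {k : WithTop ℕ∞} (hk : k = ∞ ∨ k = ω) {X : Set (Vec n)}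
    (hX : IsOpen X) {F : Vec n → Vec n} (hF : ContDiffOn ℝ k F X) (h : smoothOn k X) {x : Vec n}
    (hx : x ∈ X) : fderiv ℝ (lieDerivative hk hX hF h : Vec n → ℝ) x =
      fderiv ℝ (fun y => fderiv ℝ (h : Vec n → ℝ) y (F y)) x := by
  refine Filter.EventuallyEq.fderiv_eq ?_
  filter_upwards [hX.mem_nhds hx] with y hy
  exact lieDerivative_apply hk hX hF h hy

/-- The smooth functions that are annihilated by a distribution. -/
def firstIntegrals {n : ℕ} {k : WithTop ℕ∞} (hk : k ≠ 0) {X : Set (Vec n)} (hX : IsOpen X)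
    (Δ : Vec n → Submodule ℝ (Vec n)) : Submodule ℝ (smoothOn k X) where
  carrier := {h | ∀ x ∈ X, ∀ v ∈ Δ x, fderiv ℝ (h : Vec n → ℝ) x v = 0}
  add_mem' {h h'} hh hh' x hx v hv := by
    have := congrArg (fun l : Vec n →L[ℝ] ℝ => l v) ((differentialAt hk hX hx).map_add h h')
    refine this.trans ?_
    simp [differentialAt, hh x hx v hv, hh' x hx v hv]
  zero_mem' x hx v hv := by
    have := congrArg (fun l : Vec n →L[ℝ] ℝ => l v) (differentialAt (k := k) hk hX hx).map_zero
    exact this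
  smul_mem' c h hh x hx v hv := by
    have := congrArg (fun l : Vec n →L[ℝ] ℝ => l v) ((differentialAt hk hX hx).map_smul c h)
    refine this.trans ?_
    simp [differentialAt, hh x hx v hv]

/-- The derivative of a first integral along a bracket with one of the vector fields. -/
theorem fderiv_lieBracket_of_firstIntegral {n : ℕ} {k : WithTop ℕ∞} (hk : k = ∞ ∨ k = ω)
    {X V : Set (Vec n)} (hX : IsOpen X) {F Y : Vec n → Vec n} (hF : ContDiffOn ℝ k F X)
    (hVX : V ⊆ X) {Δ : Vec n → Submodule ℝ (Vec n)} (hY : IsSection k Δ V Y) {h : smoothOn k X}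
    (hh : ∀ x ∈ X, ∀ v ∈ Δ x, fderiv ℝ (h : Vec n → ℝ) x v = 0) {x : Vec n} (hx : x ∈ V) :
    fderiv ℝ (h : Vec n → ℝ) x (VectorField.lieBracket ℝ F Y x) =
      - fderiv ℝ (lieDerivative hk hX hF h : Vec n → ℝ) x (Y x) := by
  have hk0 : k ≠ 0 := (zero_lt_one.trans_le (one_le_of_smooth_or_analytic hk)).ne'
  have hk2 : minSmoothness ℝ 2 ≤ k := by
    rw [minSmoothness_of_isRCLikeNormedField]
    exact two_le_of_smooth_or_analytic hk
  rw [VectorField.fderiv_apply_lieBracket (h.2.contDiffAt (hX.mem_nhds (hVX hx))) hk2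
    ((hY.2.1.contDiffAt (hY.1.mem_nhds hx)).differentiableAt hk0)
    ((hF.contDiffAt (hX.mem_nhds (hVX hx))).differentiableAt hk0),
    fderiv_lieDerivative hk hX hF h (hVX hx)]
  -- In `[F, Y] h = F (Y h) - Y (F h)` the function `Y h` vanishes identically near `x`.
  have h1 : fderiv ℝ (fun y => fderiv ℝ (h : Vec n → ℝ) y (Y y)) x = 0 := by
    have h2 : (fun y => fderiv ℝ (h : Vec n → ℝ) y (Y y)) =ᶠ[𝓝 x] fun _ => (0 : ℝ) := by
      filter_upwards [hY.1.mem_nhds hx] with y hy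
      exact hh y (hVX hy) _ (hY.2.2 y hy)
    rw [h2.fderiv_eq]
    simp
  rw [h1]
  simp

/-- A linear form vanishes on `Δ + [F, Δ]` as soon as it vanishes on the distribution and on the
brackets near a point. -/
theorem forall_mem_addBracket {n : ℕ} {k : WithTop ℕ∞} {X X' : Set (Vec n)} (hX' : IsOpen X')
    {F : Vec n → Vec n} {Δ : Vec n → Submodule ℝ (Vec n)} {x : Vec n} (hx : x ∈ X')
    {l : Vec n →L[ℝ] ℝ} (h : ∀ v ∈ Δ x, l v = 0)
    (hbr : ∀ V ⊆ X', ∀ Y, x ∈ V → IsSection k Δ V Y → l (VectorField.lieBracket ℝ F Y x) = 0) :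
    ∀ v ∈ addBracket k X F Δ x, l v = 0 := by
  have : addBracket k X F Δ x ≤ LinearMap.ker (l : Vec n →ₗ[ℝ] ℝ) := by
    refine sup_le (fun v hv => h v hv) (Submodule.span_le.mpr ?_)
    rintro _ ⟨V, Y, hV, hxV, hY, rfl⟩
    exact hbr (V ∩ X') inter_subset_right Y ⟨hxV, hx⟩
      (hY.mono (hY.1.inter hX') inter_subset_left)
  exact this

theorem lieBracket_mem_addBracket {n : ℕ} {k : WithTop ℕ∞} {X V : Set (Vec n)}
    {F Y : Vec n → Vec n} {Δ : Vec n → Submodule ℝ (Vec n)} {x : Vec n} (hVX : V ⊆ X)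
    (hx : x ∈ V) (hY : IsSection k Δ V Y) :
    VectorField.lieBracket ℝ F Y x ∈ addBracket k X F Δ x :=
  Submodule.mem_sup_right (Submodule.subset_span ⟨V, Y, hVX, hx, hY, rfl⟩)

/-- **Linearizing coordinates**: if the flag generated by a distribution and a vector field `F` is
made of integrable distributions and exhausts the tangent space, there are coordinates in which
`F` is linear up to an element of the first distribution, which is constant. Moreover the linear
part and this constant subspace form a controllable pair. -/
theorem exists_linearizing_coordinates {n : ℕ} {k : WithTop ℕ∞} (hk : k = ∞ ∨ k = ω)
    {X : Set (Vec n)} (hX : IsOpen X) {F : Vec n → Vec n} (hF : ContDiffOn ℝ k F X)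
    {Δ : ℕ → Vec n → Submodule ℝ (Vec n)} (hΔ : ∀ j, Δ (j + 1) = addBracket k X F (Δ j))
    (hint : ∀ j ≤ n - 1, IsIntegrable k X (Δ j)) (htop : ∀ x ∈ X, Δ (n - 1) x = ⊤)
    (hreg : ∀ j, ∀ x ∈ X, ∀ v ∈ Δ j x, ∃ (V : Set (Vec n)) (Y : Vec n → Vec n), V ⊆ X ∧ x ∈ V ∧
      IsSection k (Δ j) V Y ∧ Y x = v)
    {x₀ : Vec n} (hx₀ : x₀ ∈ X) (Pr : Vec n →L[ℝ] Vec n) (hPr : ∀ v, Pr v ∈ Δ 0 x₀)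
    (hPr' : ∀ v ∈ Δ 0 x₀, Pr v = v) :
    ∃ (X' : Set (Vec n)) (φ : Vec n → Vec n) (A : Vec n →ₗ[ℝ] Vec n), IsOpen X' ∧ x₀ ∈ X' ∧
      X' ⊆ X ∧ ContDiffOn ℝ k φ X' ∧ fderiv ℝ φ x₀ = ContinuousLinearMap.id ℝ (Vec n) ∧
      (∀ x ∈ X', fderiv ℝ φ x (F x) = A (φ x) + Pr (fderiv ℝ φ x (F x))) ∧
      (∀ x ∈ X', ∀ v ∈ Δ 0 x, fderiv ℝ φ x v ∈ Δ 0 x₀) ∧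
      ∀ l : Vec n →L[ℝ] ℝ, (∀ j < n, ∀ v ∈ Δ 0 x₀, l ((A ^ j) v) = 0) → l = 0 := by
  have hk0 : k ≠ 0 := (zero_lt_one.trans_le (one_le_of_smooth_or_analytic hk)).ne'
  choose X' hX'o hxX' hX'X hfro using fun j : Fin (n - 1 + 1) =>
    exists_firstIntegrals hk hX (hint j (by omega)) hx₀ (hreg j x₀ hx₀)
  set X₁ := ⋂ j, X' j with hX₁
  have hX₁o : IsOpen X₁ := isOpen_iInter_of_finite hX'o
  have hx₁ : x₀ ∈ X₁ := mem_iInter.mpr hxX'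
  have hX₁X : X₁ ⊆ X := fun x hx => hX'X 0 (mem_iInter.mp hx 0)
  have hF₁ : ContDiffOn ℝ k F X₁ := hF.mono hX₁X
  set d := differentialAt hk0 hX₁o hx₁ with hd
  have hdh : ∀ h, d h = fderiv ℝ (h : Vec n → ℝ) x₀ := fun h => rfl
  set L := lieDerivative hk hX₁o hF₁ with hL
  -- The index is shifted by one: `H 0` consists of all functions and `H (j + 1)` of the first
  -- integrals of `Δ j`.
  set H : ℕ → Submodule ℝ (smoothOn k X₁) := fun j =>
    Nat.casesOn j ⊤ fun i => firstIntegrals hk0 hX₁o (Δ i) with hH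
  have hmemH : ∀ {j h}, h ∈ H (j + 1) ↔
      ∀ x ∈ X₁, ∀ v ∈ Δ j x, fderiv ℝ (h : Vec n → ℝ) x v = 0 := Iff.rfl
  have hmono : ∀ j x, Δ j x ≤ Δ (j + 1) x := fun j x => by
    rw [hΔ j]; exact le_sup_left
  have hmono' : ∀ i j x, Δ i x ≤ Δ (i + j) x := by
    intro i j x
    induction j with
    | zero => exact le_rfl
    | succ j ih => exact ih.trans (hmono _ x)
  have hann : ∀ j ≤ n - 1, ∀ l : Vec n →L[ℝ] ℝ, (∀ v ∈ Δ j x₀, l v = 0) →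
      l ∈ (H (j + 1)).map d := by
    intro j hj l hl
    obtain ⟨h, h1, h2, h3⟩ := hfro ⟨j, by omega⟩ l hl
    have hs : X₁ ⊆ X' ⟨j, by omega⟩ := iInter_subset _ _
    exact ⟨⟨h, h1.mono hs⟩, fun x hx v hv => h2 x (hs hx) v hv, h3⟩
  have hzero : ∀ j, n - 1 ≤ j → ∀ h ∈ H (j + 1), d h = 0 := by
    intro j hj h hh
    ext1 v
    refine hmemH.mp hh x₀ hx₁ v ?_
    have h1 := hmono' (n - 1) (j - (n - 1)) x₀
    rw [htop x₀ hx₀, Nat.add_sub_cancel' hj] at h1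
    exact h1 Submodule.mem_top
  have hbr : ∀ {h j}, h ∈ H (j + 1) → ∀ x ∈ X₁, ∀ V ⊆ X₁, ∀ Y, x ∈ V → IsSection k (Δ j) V Y →
      fderiv ℝ (h : Vec n → ℝ) x (VectorField.lieBracket ℝ F Y x) =
        - fderiv ℝ (L h : Vec n → ℝ) x (Y x) := fun hh x hx V hV Y hxV hY =>
    fderiv_lieBracket_of_firstIntegral hk hX₁o hF₁ hV hY (hmemH.mp hh) hxV
  have hHH : ∀ j, H (j + 1) ≤ H j := by
    rintro (_ | j)
    · exact le_top
    · exact fun h hh x hx v hv => hmemH.mp hh x hx v (hmono j x hv)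
  -- If `h` annihilates `Δ (j + 1)`, it annihilates `[F, Y]` for every section `Y` of `Δ j`, so `Y
  -- (L h) = 0`; sections take all values of `Δ j` by `hreg`.
  have hLH : ∀ j, ∀ h ∈ H (j + 1), L h ∈ H j := by
    rintro (_ | j) h hh
    · exact Submodule.mem_top
    · intro x hx v hv
      obtain ⟨V, Y, hVX, hxV, hY, rfl⟩ := hreg j x (hX₁X hx) v hv
      have hY' := hY.mono (hY.1.inter hX₁o) inter_subset_left
      have h1 := hbr (hHH _ hh) x hx (V ∩ X₁) inter_subset_right Y ⟨hxV, hx⟩ hY'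
      rw [hmemH.mp hh x hx _ (by
        rw [hΔ]
        exact lieBracket_mem_addBracket (inter_subset_right.trans hX₁X) ⟨hxV, hx⟩ hY')] at h1
      exact neg_eq_zero.mp h1.symm
  -- Converse at the point `x₀` only: if `d (L h)` annihilates `Δ j x₀`, then `d h` annihilates `Δ
  -- (j + 1) x₀`. Frobenius then replaces `h` by a genuine first integral with the same
  -- differential. Beyond index `n - 1` the differentials are zero.
  have hdH : ∀ j, ∀ h ∈ H (j + 1), d (L h) ∈ (H (j + 1)).map d → d h ∈ (H (j + 2)).map d := by
    rintro j h hh ⟨h', hh', hd'⟩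
    by_cases hj : j + 1 ≤ n - 1
    · refine hann (j + 1) hj _ ?_
      rw [hΔ]
      refine forall_mem_addBracket hX₁o hx₁ (fun v hv => hh x₀ hx₁ v hv) ?_
      intro V hV Y hxV hY
      refine (hbr hh x₀ hx₁ V hV Y hxV hY).trans ?_
      change - (d (L h)) (Y x₀) = 0
      rw [← hd', neg_eq_zero]
      exact hh' x₀ hx₁ _ (hY.2.2 x₀ hxV)
    · rw [hzero j (by omega) h hh]
      exact Submodule.zero_mem _
  have hHL : ∀ j, ∀ h ∈ H (j + 1), L h ∈ H (j + 1) → h ∈ H (j + 2) := by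
    intro j h hh hLh
    rw [hmemH]
    intro x hx
    rw [hΔ]
    refine forall_mem_addBracket hX₁o hx (fun v hv => hh x hx v hv) ?_
    intro V hV Y hxV hY
    rw [hbr hh x hx V hV Y hxV hY, neg_eq_zero]
    exact hLh x hx _ (hY.2.2 x hxV)
  have hHN : (H (n - 1 + 1)).map d = ⊥ := by
    rw [eq_bot_iff, Submodule.map_le_iff_le_comap]
    exact fun h hh => hzero (n - 1) le_rfl h hh
  have hH0 : (H 0).map d = ⊤ := by
    rw [eq_top_iff]
    intro l _
    exact ⟨⟨l, l.contDiff.contDiffOn⟩, Submodule.mem_top, l.fderiv⟩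
  obtain ⟨σ, hσ, hσ1⟩ := exists_section_of_filtration (V := Vec n →L[ℝ] ℝ) d L H hHH hLH hdH
    (N := n - 1 + 1) hHN hH0
  -- On forms annihilating `Δ 0 x₀`, `τ` is the action of `L` read on differentials at `x₀`.
  -- Composition with `1 - Pr` extends it to all forms.
  set τ : (Vec n →L[ℝ] ℝ) →ₗ[ℝ] (Vec n →L[ℝ] ℝ) := d ∘ₗ L ∘ₗ σ ∘ₗ
    { toFun := fun l => l.comp (ContinuousLinearMap.id ℝ (Vec n) - Pr)
      map_add' := fun l l' => ContinuousLinearMap.add_comp _ _ _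
      map_smul' := fun c l => ContinuousLinearMap.smul_comp _ _ _ } with hτ
  have hτl : ∀ l : Vec n →L[ℝ] ℝ,
      τ l = d (L (σ (l.comp (ContinuousLinearMap.id ℝ (Vec n) - Pr)))) := fun l => rfl
  obtain ⟨A, hA⟩ := Vec.exists_transpose τ
  -- The coordinates are chosen so that `l ∘ φ = σ l` for every form `l`.
  set φ : Vec n → Vec n := fun x => ∑ i, (σ (EuclideanSpace.proj i) : Vec n → ℝ) x •
    EuclideanSpace.single i (1 : ℝ) with hφ
  have hlφ : ∀ (l : Vec n →L[ℝ] ℝ) x, l (φ x) = (σ l : Vec n → ℝ) x := fun l x =>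
    Vec.apply_sum_single ((LinearMap.proj x) ∘ₗ (smoothOn k X₁).subtype ∘ₗ σ) l
  have hφc : ContDiffOn ℝ k φ X₁ :=
    ContDiffOn.sum fun i _ => (σ (EuclideanSpace.proj i)).2.smul contDiffOn_const
  have hφd : ∀ x ∈ X₁, ∀ (l : Vec n →L[ℝ] ℝ) v,
      l (fderiv ℝ φ x v) = fderiv ℝ (σ l : Vec n → ℝ) x v := by
    intro x hx l v
    have h1 := l.hasFDerivAt.comp x
      ((hφc.contDiffAt (hX₁o.mem_nhds hx)).differentiableAt hk0).hasFDerivAt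
    have h2 : (l ∘ φ) = (σ l : Vec n → ℝ) := funext (hlφ l)
    rw [h2] at h1
    rw [h1.fderiv]
    rfl
  have hann1 : ∀ l : Vec n →L[ℝ] ℝ, (∀ v ∈ Δ 0 x₀, l v = 0) →
      σ l ∈ H 1 ∧ L (σ l) = σ (d (L (σ l))) := fun l hl => hσ1 l (hann 0 (Nat.zero_le _) l hl)
  refine ⟨X₁, φ, A, hX₁o, hx₁, hX₁X, hφc, ?_, ?_, ?_, ?_⟩
  · ext1 v
    refine Vec.ext_forms fun l => ?_
    rw [hφd x₀ hx₁, ← hdh, hσ]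
    rfl
  · intro x hx
    refine Vec.ext_forms fun l => ?_
    set l' := l.comp (ContinuousLinearMap.id ℝ (Vec n) - Pr) with hl'
    have h1 : ∀ v ∈ Δ 0 x₀, l' v = 0 := by
      intro v hv
      simp [hl', hPr' v hv]
    have h2 : l' (fderiv ℝ φ x (F x)) = l (A (φ x)) := by
      rw [hφd x hx, hA, hτl, hlφ, ← (hann1 l' h1).2]
      exact (lieDerivative_apply hk hX₁o hF₁ _ hx).symm
    rw [map_add, ← h2]
    simp [hl']
  · intro x hx v hv
    refine Vec.mem_of_forms fun l hl => ?_
    rw [hφd x hx]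
    exact (hann1 l hl).1 x hx v hv
  · intro l hl
    rcases Nat.eq_zero_or_pos n with rfl | hn
    · exact Subsingleton.elim _ _
    -- With `lj j = l ∘ A ^ j` one has `L (σ (lj j)) = σ (lj (j + 1))` for `j < n`. Iterating `hHL`,
    -- `σ l` becomes a first integral of `Δ (n - 1)`, which is everything, so its differential `l`
    -- at `x₀` is zero.
    set lj : ℕ → Vec n →L[ℝ] ℝ := fun j => l.comp (LinearMap.toContinuousLinearMap (A ^ j)) with hlj
    have hl1 : ∀ j < n, ∀ v ∈ Δ 0 x₀, lj j v = 0 := hl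
    have hl2 : ∀ j < n, L (σ (lj j)) = σ (lj (j + 1)) := by
      intro j hj
      rw [(hann1 _ (hl1 j hj)).2]
      congr 1
      have h3 : (lj j).comp (ContinuousLinearMap.id ℝ (Vec n) - Pr) = lj j := by
        ext1 v
        have := hl1 j hj (Pr v) (hPr v)
        simp [this]
      ext1 w
      have h4 := hA (lj j) w
      rw [hτl, h3] at h4
      rw [← h4]
      simp [hlj, pow_succ]
    have hl3 : ∀ i j, i + j < n → σ (lj j) ∈ H (i + 1) := by
      intro i
      induction i with
      | zero => exact fun j hj => (hann1 _ (hl1 j (by omega))).1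
      | succ i ih =>
        intro j hj
        refine hHL i _ (ih j (by omega)) ?_
        rw [hl2 j (by omega)]
        exact ih (j + 1) (by omega)
    have h5 : lj 0 = l := by
      ext1 v
      simp [hlj]
    rw [← h5, ← hσ (lj 0)]
    exact hzero (n - 1) le_rfl _ (hl3 (n - 1) 0 (by omega))

/-! ### The generalized range and sections of the flag -/

theorem hasFDerivAt_control {n m : ℕ} {f : Vec n × Vec m → Vec n} {x : Vec n} {u : Vec m}
    (hf : DifferentiableAt ℝ f (x, u)) :
    HasFDerivAt (fun w => f (x, w))
      ((fderiv ℝ f (x, u)).comp (ContinuousLinearMap.inr ℝ (Vec n) (Vec m))) u :=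
  HasFDerivAt.comp u hf.hasFDerivAt (hasFDerivAt_prodMk_right x u)

/-- The generalized range contains the range of the differential with respect to the control. -/
theorem fderiv_control_mem_genRange {n m : ℕ} {f : Vec n × Vec m → Vec n} {U : Set (Vec m)}
    (hU : IsOpen U) {x : Vec n} {u : Vec m} (hu : u ∈ U) (hf : DifferentiableAt ℝ f (x, u))
    (e : Vec m) : fderiv ℝ f (x, u) (0, e) ∈ genRange f U x u := by
  set v := fderiv ℝ f (x, u) (0, e) with hv
  rcases eq_or_ne v 0 with h0 | h0
  · rw [h0]; exact Submodule.zero_mem _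
  have hd : HasDerivAt (fun t : ℝ => f (x, u + t • e)) v 0 := by
    have h1 : HasDerivAt (fun t : ℝ => u + t • e) e 0 := by
      simpa using ((hasDerivAt_id (0 : ℝ)).smul_const e).const_add u
    have h2 : HasFDerivAt (fun w => f (x, w))
        ((fderiv ℝ f (x, u)).comp (ContinuousLinearMap.inr ℝ (Vec n) (Vec m)))
        (u + (0 : ℝ) • e) := by
      rw [zero_smul, add_zero]
      exact hasFDerivAt_control hf
    exact HasFDerivAt.comp_hasDerivAt (l := fun w => f (x, w)) (0 : ℝ) h2 h1
  set t : ℕ → ℝ := fun i => 1 / ((i : ℝ) + 1) with ht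
  have ht0 : ∀ i, 0 < t i := fun i => Nat.one_div_pos_of_nat
  have htt : Tendsto t atTop (𝓝[≠] 0) :=
    tendsto_nhdsWithin_iff.mpr ⟨tendsto_one_div_add_atTop_nhds_zero_nat,
      Eventually.of_forall fun i => (ht0 i).ne'⟩
  set D : ℕ → Vec n := fun i => f (x, u + t i • e) - f (x, u) with hD
  have hs : Tendsto (fun i => (t i)⁻¹ • D i) atTop (𝓝 v) := by
    have := (hasDerivAt_iff_tendsto_slope_zero.mp hd).comp htt
    simpa [hD, Function.comp_def] using this
  have hw : Tendsto (fun i => u + t i • e) atTop (𝓝 u) := by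
    have h1 : Tendsto t atTop (𝓝 0) := htt.mono_right nhdsWithin_le_nhds
    simpa using (h1.smul_const e).const_add u
  have hne : ∀ᶠ i in atTop, D i ≠ 0 := by
    filter_upwards [hs.eventually_ne h0] with i hi h
    exact hi (by rw [h, smul_zero])
  -- Every term of an admissible sequence must lie in `U` with a nonzero increment, which only holds
  -- for a tail.
  obtain ⟨N, hN⟩ := eventually_atTop.mp (hne.and (hw.eventually_mem (hU.mem_nhds hu)))
  have hlim : Tendsto (fun i => ‖D i‖⁻¹ • D i) atTop (𝓝 (‖v‖⁻¹ • v)) := by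
    have h1 := (hs.norm.inv₀ (norm_ne_zero_iff.mpr h0)).smul hs
    refine h1.congr fun i => ?_
    rw [norm_smul, norm_inv, Real.norm_of_nonneg (ht0 i).le, smul_smul, mul_inv, inv_inv,
      mul_assoc, mul_comm, mul_assoc, inv_mul_cancel₀ (ht0 i).ne', mul_one]
  have hmem : ‖v‖⁻¹ • v ∈ limitDirections f U x u :=
    ⟨fun i => u + t (i + N) • e, fun i => (hN (i + N) (by omega)).2,
      fun i => sub_ne_zero.mp (hN (i + N) (by omega)).1,
      hw.comp (tendsto_add_atTop_nat N), hlim.comp (tendsto_add_atTop_nat N)⟩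
  have h2 := Submodule.smul_mem (genRange f U x u) ‖v‖ (Submodule.subset_span hmem)
  rwa [smul_smul, mul_inv_cancel₀ (norm_ne_zero_iff.mpr h0), one_smul] at h2

/-- A linear form that annihilates the differentials with respect to the control is constant
along the control. -/
theorem apply_eq_of_forall_fderiv_control {n m : ℕ} {f : Vec n × Vec m → Vec n} {x : Vec n}
    {B : Set (Vec m)} (hB : IsOpen B) (hBc : IsPreconnected B)
    (hf : ∀ u ∈ B, DifferentiableAt ℝ f (x, u)) {l : Vec n →L[ℝ] ℝ}
    (hl : ∀ u ∈ B, ∀ e, l (fderiv ℝ f (x, u) (0, e)) = 0) {u u' : Vec m} (hu : u ∈ B)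
    (hu' : u' ∈ B) : l (f (x, u)) = l (f (x, u')) := by
  have hd : ∀ w ∈ B, HasFDerivAt (fun w => l (f (x, w))) (0 : Vec m →L[ℝ] ℝ) w := by
    intro w hw
    refine (l.hasFDerivAt.comp w (hasFDerivAt_control (hf w hw))).congr_fderiv ?_
    ext1 e
    exact hl w hw e
  exact hB.is_const_of_fderiv_eq_zero (𝕜 := ℝ) hBc
    (fun w hw => (hd w hw).differentiableAt.differentiableWithinAt)
    (fun w hw => (hd w hw).fderiv) hu hu'

/-- The form kills all normalized increments for controls close to `u`, hence their limits by
continuity, hence the span. -/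
theorem apply_eq_zero_of_mem_genRange {n m : ℕ} {f : Vec n × Vec m → Vec n} {U : Set (Vec m)}
    {x : Vec n} {u : Vec m} {B : Set (Vec m)} (hB : B ∈ 𝓝 u) {l : Vec n →L[ℝ] ℝ}
    (hl : ∀ w ∈ B, l (f (x, w)) = l (f (x, u))) {v : Vec n} (hv : v ∈ genRange f U x u) :
    l v = 0 := by
  have : genRange f U x u ≤ LinearMap.ker (l : Vec n →ₗ[ℝ] ℝ) := by
    refine Submodule.span_le.mpr ?_
    rintro y ⟨w, -, -, hw, hy⟩
    have h1 : Tendsto (fun i => l (‖f (x, w i) - f (x, u)‖⁻¹ • (f (x, w i) - f (x, u)))) atTop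
        (𝓝 (l y)) := (l.continuous.tendsto y).comp hy
    have h2 : Tendsto (fun i => l (‖f (x, w i) - f (x, u)‖⁻¹ • (f (x, w i) - f (x, u)))) atTop
        (𝓝 0) := by
      refine tendsto_const_nhds.congr' ?_
      filter_upwards [hw.eventually_mem hB] with i hi
      rw [map_smul, map_sub, hl _ hi, sub_self, smul_zero]
    exact tendsto_nhds_unique h1 h2
  exact this hv

/-- The values at `x` of local `C^k` sections of a distribution. -/
def sectionValues {n : ℕ} (k : WithTop ℕ∞) (X : Set (Vec n)) (Δ : Vec n → Submodule ℝ (Vec n))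
    (hX : IsOpen X) {x : Vec n} (hx : x ∈ X) : Submodule ℝ (Vec n) where
  carrier := {v | ∃ (V : Set (Vec n)) (Y : Vec n → Vec n), V ⊆ X ∧ x ∈ V ∧ IsSection k Δ V Y ∧
    Y x = v}
  add_mem' := by
    rintro _ _ ⟨V, Y, hV, hxV, hY, rfl⟩ ⟨V', Y', -, hxV', hY', rfl⟩
    exact ⟨V ∩ V', Y + Y', inter_subset_left.trans hV, ⟨hxV, hxV'⟩, ⟨hY.1.inter hY'.1,
      (hY.2.1.mono inter_subset_left).add (hY'.2.1.mono inter_subset_right),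
      fun y hy => (Δ y).add_mem (hY.2.2 y hy.1) (hY'.2.2 y hy.2)⟩, rfl⟩
  zero_mem' := ⟨X, 0, le_rfl, hx, ⟨hX, contDiffOn_const, fun y _ => (Δ y).zero_mem⟩, rfl⟩
  smul_mem' := by
    rintro c _ ⟨V, Y, hV, hxV, hY, rfl⟩
    exact ⟨V, c • Y, hV, hxV, ⟨hY.1, hY.2.1.const_smul c,
      fun y hy => (Δ y).smul_mem c (hY.2.2 y hy)⟩, rfl⟩

/-- The bracket of `F` with a section of `Δ` is itself a section of the enlarged distribution; no
regularity is lost because `k + 1 ≤ k` for these classes. -/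
theorem addBracket_le_sectionValues {n : ℕ} {k : WithTop ℕ∞} (hk : k = ∞ ∨ k = ω)
    {X : Set (Vec n)} (hX : IsOpen X) {F : Vec n → Vec n} (hF : ContDiffOn ℝ k F X)
    {Δ : Vec n → Submodule ℝ (Vec n)} {x : Vec n} (hx : x ∈ X)
    (hΔ : Δ x ≤ sectionValues k X Δ hX hx) :
    addBracket k X F Δ x ≤ sectionValues k X (addBracket k X F Δ) hX hx := by
  have hk1 := add_one_le_of_smooth_or_analytic hk
  have hk' := le_self_add.trans hk1
  refine sup_le (fun v hv => ?_) (Submodule.span_le.mpr ?_)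
  · obtain ⟨V, Y, hV, hxV, hY, rfl⟩ := hΔ hv
    exact ⟨V, Y, hV, hxV, ⟨hY.1, hY.2.1, fun y hy => Submodule.mem_sup_left (hY.2.2 y hy)⟩, rfl⟩
  · rintro _ ⟨V, Y, hV, hxV, hY, rfl⟩
    have hFV := hF.mono hV
    refine ⟨V, VectorField.lieBracket ℝ F Y, hV, hxV, ⟨hY.1, ?_, fun y hy =>
      lieBracket_mem_addBracket hV hy hY⟩, rfl⟩
    exact ((hY.2.1.fderiv_of_isOpen hY.1 hk1).clm_apply hFV).sub
      ((hFV.fderiv_of_isOpen hY.1 hk1).clm_apply hY.2.1)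

section

variable {n m : ℕ} {k : WithTop ℕ∞} {f : Vec n × Vec m → Vec n} {Ω : Set (Vec n × Vec m)}
  {X : Set (Vec n)} {U : Set (Vec m)}

theorem contDiffOn_drift (hf : ContDiffOn ℝ k f Ω) (hXU : X ×ˢ U ⊆ Ω) {u : Vec m} (hu : u ∈ U) :
    ContDiffOn ℝ k (fun x => f (x, u)) X :=
  hf.comp (contDiff_id.prodMk contDiff_const).contDiffOn fun _ hx => hXU ⟨hx, hu⟩

theorem differentiableAt_of_prod_subset (hk : k = ∞ ∨ k = ω) (hΩ : IsOpen Ω)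
    (hf : ContDiffOn ℝ k f Ω) (hXU : X ×ˢ U ⊆ Ω) {x : Vec n} (hx : x ∈ X) {u : Vec m}
    (hu : u ∈ U) : DifferentiableAt ℝ f (x, u) :=
  (hf.contDiffAt (hΩ.mem_nhds (hXU ⟨hx, hu⟩))).differentiableAt
    (zero_lt_one.trans_le (one_le_of_smooth_or_analytic hk)).ne'

/-- If the generalized range does not depend on the control, a linear form that annihilates it
is constant along the control. -/
theorem apply_eq_of_genRange (hk : k = ∞ ∨ k = ω) (hΩ : IsOpen Ω)
    (hf : ContDiffOn ℝ k f Ω) (hXU : X ×ˢ U ⊆ Ω) (hU : IsOpen U)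
    (hD : ∀ x ∈ X, ∀ u ∈ U, ∀ u' ∈ U, genRange f U x u = genRange f U x u')
    {B : Set (Vec m)} (hB : IsOpen B) (hBc : IsPreconnected B) (hBU : B ⊆ U) {u₀ : Vec m}
    (hu₀ : u₀ ∈ B) {x : Vec n} (hx : x ∈ X) {u : Vec m} (hu : u ∈ B) :
    f (x, u) - f (x, u₀) ∈ genRange f U x u₀ := by
  refine Vec.mem_of_forms fun l hl => ?_
  rw [map_sub, sub_eq_zero]
  refine apply_eq_of_forall_fderiv_control hB hBc
    (fun w hw => differentiableAt_of_prod_subset hk hΩ hf hXU hx (hBU hw)) ?_ hu hu₀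
  intro w hw e
  refine hl _ ?_
  rw [hD x hx u₀ (hBU hu₀) w (hBU hw)]
  exact fderiv_control_mem_genRange hU (hBU hw)
    (differentiableAt_of_prod_subset hk hΩ hf hXU hx (hBU hw)) e

/-- For a fixed control `u` near `u₀`, the fields `y ↦ ∂f/∂u (y, u) e` are `C^k` and take values in
the generalized range at `u₀`, since this range does not depend on the control. A form killing their
values at `x` is constant along nearby controls, so it kills all limit directions. -/
theorem genRange_le_sectionValues (hk : k = ∞ ∨ k = ω) (hΩ : IsOpen Ω)
    (hf : ContDiffOn ℝ k f Ω) (hXU : X ×ˢ U ⊆ Ω) (hX : IsOpen X) (hU : IsOpen U)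
    (hD : ∀ x ∈ X, ∀ u ∈ U, ∀ u' ∈ U, genRange f U x u = genRange f U x u')
    {u₀ : Vec m} (hu₀ : u₀ ∈ U) {x : Vec n} (hx : x ∈ X) :
    genRange f U x u₀ ≤ sectionValues k X (fun y => genRange f U y u₀) hX hx := by
  obtain ⟨ε, hε, hB⟩ := Metric.isOpen_iff.mp hU u₀ hu₀
  intro v hv
  refine Vec.mem_of_forms fun l hl => ?_
  refine apply_eq_zero_of_mem_genRange (Metric.ball_mem_nhds u₀ hε) ?_ hv
  intro w hw
  refine apply_eq_of_forall_fderiv_control Metric.isOpen_ball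
    (convex_ball u₀ ε).isPreconnected
    (fun w hw => differentiableAt_of_prod_subset hk hΩ hf hXU hx (hB hw)) ?_ hw
    (Metric.mem_ball_self hε)
  intro u hu e
  refine hl _ ⟨X, fun y => fderiv ℝ f (y, u) (0, e), le_rfl, hx, ⟨hX, ?_, fun y hy => ?_⟩, rfl⟩
  · refine ContDiffOn.clm_apply ?_ contDiffOn_const
    exact (hf.fderiv_of_isOpen hΩ (add_one_le_of_smooth_or_analytic hk)).comp
      (contDiff_id.prodMk contDiff_const).contDiffOn fun _ hy => hXU ⟨hy, hB hu⟩
  · change _ ∈ genRange f U y u₀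
    rw [hD y hy u₀ hu₀ u (hB hu)]
    exact fderiv_control_mem_genRange hU (hB hu)
      (differentiableAt_of_prod_subset hk hΩ hf hXU hy (hB hu)) e

/-- The flag is spanned by local sections. -/
theorem flag_le_sectionValues (hk : k = ∞ ∨ k = ω) (hΩ : IsOpen Ω)
    (hf : ContDiffOn ℝ k f Ω) (hXU : X ×ˢ U ⊆ Ω) (hX : IsOpen X) (hU : IsOpen U)
    (hD : ∀ x ∈ X, ∀ u ∈ U, ∀ u' ∈ U, genRange f U x u = genRange f U x u')
    {u₀ : Vec m} (hu₀ : u₀ ∈ U) (j : ℕ) {x : Vec n} (hx : x ∈ X) :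
    flag k f X U u₀ j x ≤ sectionValues k X (flag k f X U u₀ j) hX hx := by
  induction j with
  | zero => exact genRange_le_sectionValues hk hΩ hf hXU hX hU hD hu₀ hx
  | succ j ih => exact addBracket_le_sectionValues hk hX (contDiffOn_drift hf hXU hu₀) hx ih

end

/-! ### The rank of the generalized range -/

/-- Around a point of maximal rank, the difference quotients of a map are controlled by a linear
map of this rank. -/
theorem exists_factor_of_maximal_rank {E F : Type*} [NormedAddCommGroup E] [NormedSpace ℝ E]
    [FiniteDimensional ℝ E] [NormedAddCommGroup F] [InnerProductSpace ℝ F] [FiniteDimensional ℝ F]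
    {U : Set E} (hU : IsOpen U) {g : E → F} (hg : ContDiffOn ℝ 1 g U) {u₁ : E} (hu₁ : u₁ ∈ U)
    (hmax : ∀ u ∈ U, Module.finrank ℝ (LinearMap.range (fderiv ℝ g u : E →ₗ[ℝ] F)) ≤
      Module.finrank ℝ (LinearMap.range (fderiv ℝ g u₁ : E →ₗ[ℝ] F))) :
    ∃ (T : Submodule ℝ F) (p : F →L[ℝ] T) (G : T → F), Module.finrank ℝ T ≤ Module.finrank ℝ E ∧
      DifferentiableAt ℝ G (p (g u₁)) ∧ ∀ᶠ u in 𝓝 u₁, g u = G (p (g u)) := by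
  have hgd : ∀ u ∈ U, HasFDerivAt g (fderiv ℝ g u) u := fun u hu =>
    ((hg.contDiffAt (hU.mem_nhds hu)).differentiableAt one_ne_zero).hasFDerivAt
  set T : Submodule ℝ F := LinearMap.range (fderiv ℝ g u₁ : E →ₗ[ℝ] F) with hT
  set p : F →L[ℝ] T := T.orthogonalProjectionOnto with hp
  set q : E → E →L[ℝ] T := fun u => p.comp (fderiv ℝ g u) with hq
  have hqc : ContinuousOn q U :=
    continuousOn_const.clm_comp (hg.continuousOn_fderiv_of_isOpen hU le_rfl)
  have hq₁ : Function.Surjective (q u₁) := by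
    rintro ⟨_, e, rfl⟩
    exact ⟨e, Submodule.orthogonalProjectionOnto_mem_subspace_eq_self (K := T) ⟨_, e, rfl⟩⟩
  obtain ⟨s, hs⟩ := (q u₁).exists_rightInverse_of_surjective (LinearMap.range_eq_top.mpr hq₁)
  set U₁ : Set E := {u ∈ U | ((q u).comp s).IsInvertible} with hU₁
  have hU₁o : IsOpen U₁ := (hqc.clm_comp continuousOn_const).isOpen_inter_preimage hU
    (ContinuousLinearEquiv.isOpen (𝕜 := ℝ) (E := T) (F := T))
  have hu₁' : u₁ ∈ U₁ := ⟨hu₁, by rw [hs]; exact ⟨ContinuousLinearEquiv.refl ℝ T, rfl⟩⟩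
  -- The rank cannot exceed its value at `u₁`, so the projection `p` is injective on the range of
  -- the differential at `u`: `p ∘ g` and `g` have differentials with the same kernel.
  have hker : ∀ u ∈ U₁, ∀ e, q u e = 0 → fderiv ℝ g u e = 0 := by
    rintro u ⟨hu, a, ha⟩ e he
    set R := LinearMap.range (fderiv ℝ g u : E →ₗ[ℝ] F)
    set b : R →ₗ[ℝ] T := (p : F →ₗ[ℝ] T) ∘ₗ R.subtype with hb
    have hbs : Function.Surjective b := by
      intro y
      refine ⟨⟨fderiv ℝ g u (s (a.symm y)), LinearMap.mem_range_self _ _⟩, ?_⟩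
      have : ((q u).comp s) (a.symm y) = y := by rw [← ha]; simp
      exact this
    have hbi : Function.Injective b :=
      (LinearMap.injective_iff_surjective_of_finrank_eq_finrank (le_antisymm (hmax u hu)
        (LinearMap.finrank_le_finrank_of_surjective hbs))).mpr hbs
    have := @hbi ⟨fderiv ℝ g u e, LinearMap.mem_range_self _ _⟩ 0 (by rw [map_zero]; exact he)
    exact congrArg Subtype.val this
  -- Completing `p ∘ g` by a projection onto the kernel of its differential at `u₁` gives local
  -- coordinates in which `g` depends on the first component only.
  set K := LinearMap.ker (q u₁ : E →ₗ[ℝ] T) with hK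
  obtain ⟨κ, hκ⟩ : ∃ κ : E →L[ℝ] K, ∀ x : K, κ x = x :=
    Submodule.ClosedComplemented.of_finiteDimensional K
  set Θ : E → T × K := fun u => (p (g u), κ u) with hΘ
  have hpc : ContDiffOn ℝ 1 (fun u => p (g u)) U₁ :=
    p.contDiff.comp_contDiffOn (hg.mono fun u hu => hu.1)
  have hΘc : ContDiffOn ℝ 1 Θ U₁ := hpc.prodMk κ.contDiff.contDiffOn
  have hΘd : ∀ u ∈ U₁, HasFDerivAt Θ ((q u).prod κ) u := fun u hu =>
    (p.hasFDerivAt.comp u (hgd u hu.1)).prodMk κ.hasFDerivAt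
  have hbij : Function.Bijective ((q u₁).prod κ : E →ₗ[ℝ] T × K) := by
    constructor
    · rw [← LinearMap.ker_eq_bot, eq_bot_iff]
      intro e he
      have h1 : (q u₁ e, κ e) = 0 := he
      have h2 : e ∈ K := (Prod.ext_iff.mp h1).1
      have h3 : κ e = 0 := (Prod.ext_iff.mp h1).2
      have h4 := hκ ⟨e, h2⟩
      rw [h3] at h4
      exact (congrArg Subtype.val h4).symm
    · rintro ⟨y, c⟩
      obtain ⟨e, rfl⟩ := hq₁ y
      refine ⟨e + ((c - κ e : K) : E), ?_⟩
      have h5 : q u₁ ((c - κ e : K) : E) = 0 := (c - κ e).2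
      have h6 := hκ (c - κ e)
      refine Prod.ext ?_ ?_
      · change q u₁ (e + ((c - κ e : K) : E)) = q u₁ e
        rw [map_add, h5, add_zero]
      · change κ (e + ((c - κ e : K) : E)) = c
        rw [map_add, h6, add_sub_cancel]
  set e₁ : E ≃L[ℝ] T × K := (LinearEquiv.ofBijective _ hbij).toContinuousLinearEquiv with he₁
  have he : HasFDerivAt Θ (e₁ : E →L[ℝ] T × K) u₁ := hΘd u₁ hu₁'
  obtain ⟨Φ, hΦ, hu₁Φ, hΦU, hΦc, hΦd⟩ :=
    exists_openPartialHomeomorph_of_contDiffOn le_rfl hU₁o hΘc hu₁' he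
  have ht : Θ u₁ ∈ Φ.target := by rw [← hΦ]; exact Φ.map_source hu₁Φ
  obtain ⟨ε, hε, hball⟩ := Metric.isOpen_iff.mp Φ.open_target _ ht
  have hsymmd : ∀ z ∈ Φ.target, ∃ e' : E ≃L[ℝ] T × K,
      HasFDerivAt Θ (e' : E →L[ℝ] T × K) (Φ.symm z) ∧
      HasFDerivAt Φ.symm (e'.symm : T × K →L[ℝ] E) z := by
    intro z hz
    obtain ⟨e', he'⟩ := hΦd _ (Φ.map_target hz)
    exact ⟨e', he', Φ.hasFDerivAt_symm hz (by rw [hΦ]; exact he')⟩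
  -- A motion in the second coordinate leaves `p ∘ g` fixed, so by `hker` the derivative of `g`
  -- along it is zero.
  have hconst : ∀ a ∈ Metric.ball (p (g u₁)) ε, ∀ c ∈ Metric.ball (κ u₁) ε,
      g (Φ.symm (a, c)) = g (Φ.symm (a, κ u₁)) := by
    intro a ha c hc
    have hd : ∀ c ∈ Metric.ball (κ u₁) ε,
        HasFDerivAt (fun c => g (Φ.symm (a, c))) (0 : K →L[ℝ] F) c := by
      intro c hc
      have hz : (a, c) ∈ Φ.target := hball (by rw [← ball_prod_same]; exact ⟨ha, hc⟩)
      obtain ⟨e', he', hes⟩ := hsymmd _ hz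
      have hu := hΦU (Φ.map_target hz)
      refine ((hgd _ hu.1).comp c (hes.comp c (hasFDerivAt_prodMk_right a c))).congr_fderiv ?_
      ext1 δ
      change fderiv ℝ g (Φ.symm (a, c)) (e'.symm (0, δ)) = 0
      refine hker _ hu _ ?_
      have h7 := congrArg (fun l : E →L[ℝ] T × K => (l (e'.symm (0, δ))).1) ((hΘd _ hu).unique he')
      simpa using h7
    exact Metric.isOpen_ball.is_const_of_fderiv_eq_zero (𝕜 := ℝ)
      (convex_ball (κ u₁) ε).isPreconnected
      (fun w hw => (hd w hw).differentiableAt.differentiableWithinAt)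
      (fun w hw => (hd w hw).fderiv) hc (Metric.mem_ball_self hε)
  refine ⟨T, p, fun a => g (Φ.symm (a, κ u₁)), LinearMap.finrank_range_le _, ?_, ?_⟩
  · obtain ⟨e', he', hes⟩ := hsymmd _ ht
    exact ((hgd _ (hΦU (Φ.map_target ht)).1).comp (p (g u₁))
      (HasFDerivAt.comp (p (g u₁)) (f := fun a => (a, κ u₁)) hes
        (hasFDerivAt_prodMk_left _ _))).differentiableAt
  · have h8 : Tendsto Θ (𝓝 u₁) (𝓝 (Θ u₁)) := he.continuousAt
    filter_upwards [Φ.open_source.mem_nhds hu₁Φ, h8.eventually_mem (Metric.ball_mem_nhds _ hε)]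
      with u hu hu'
    rw [← ball_prod_same] at hu'
    have h9 := hconst (p (g u)) hu'.1 (κ u) hu'.2
    rw [← h9]
    change g u = g (Φ.symm (Θ u))
    rw [← hΦ, Φ.left_inv hu]

/-- From `f = G ∘ p ∘ f` near `u`, an increment `D` of `f` satisfies `D = G' (p D) + o(D)`. Limit
directions therefore lie in the range of `G'`, a closed subspace of dimension at most that of `T`.
-/
theorem finrank_genRange_le {n m : ℕ} {f : Vec n × Vec m → Vec n} {U : Set (Vec m)}
    {x : Vec n} {u : Vec m} {T : Submodule ℝ (Vec n)} {p : Vec n →L[ℝ] T} {G : T → Vec n}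
    (hG : DifferentiableAt ℝ G (p (f (x, u)))) (hfc : ContinuousAt (fun w => f (x, w)) u)
    (hfG : ∀ᶠ w in 𝓝 u, f (x, w) = G (p (f (x, w)))) :
    Module.finrank ℝ (genRange f U x u) ≤ Module.finrank ℝ T := by
  set G' := fderiv ℝ G (p (f (x, u))) with hG'
  have hle : genRange f U x u ≤ LinearMap.range (G' : T →ₗ[ℝ] Vec n) := by
    refine Submodule.span_le.mpr ?_
    rintro y ⟨w, -, -, hw, hy⟩
    set D : ℕ → Vec n := fun i => f (x, w i) - f (x, u) with hD
    have hlim : Tendsto (fun i => p (f (x, w i))) atTop (𝓝 (p (f (x, u)))) :=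
      (p.continuous.tendsto _).comp (hfc.tendsto.comp hw)
    have h1 : (fun i => G (p (f (x, w i))) - G (p (f (x, u))) - G' (p (D i))) =o[atTop] D := by
      have h2 := hG.hasFDerivAt.isLittleO.comp_tendsto hlim
      have h3 : (fun i => p (f (x, w i)) - p (f (x, u))) =O[atTop] D := by
        have := p.isBigO_comp D atTop
        simpa [hD, map_sub] using this
      simpa [Function.comp_def, hD, map_sub] using h2.trans_isBigO h3
    have h4 : (fun i => D i - G' (p (D i))) =o[atTop] D := by
      refine h1.congr' ?_ EventuallyEq.rfl
      filter_upwards [hw.eventually hfG] with i hi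
      rw [← hi, ← hfG.self_of_nhds]
    have h5 : Tendsto (fun i => ‖D i‖⁻¹ • (D i - G' (p (D i)))) atTop (𝓝 0) :=
      (h4.norm_right).tendsto_inv_smul_nhds_zero
    have h6 : Tendsto (fun i => ‖D i‖⁻¹ • G' (p (D i))) atTop (𝓝 y) := by
      have := hy.sub h5
      rw [sub_zero] at this
      refine this.congr fun i => ?_
      change ‖D i‖⁻¹ • D i - _ = _
      rw [smul_sub ‖D i‖⁻¹ (D i) (G' _), sub_sub_cancel]
    refine (Submodule.closed_of_finiteDimensional
      (LinearMap.range (G' : T →ₗ[ℝ] Vec n))).mem_of_tendsto h6 (Eventually.of_forall fun i => ?_)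
    exact Submodule.smul_mem _ _ (LinearMap.mem_range_self (G' : T →ₗ[ℝ] Vec n) _)
  exact (Submodule.finrank_mono hle).trans (LinearMap.finrank_range_le _)

/-- If the generalized range does not depend on the control, its dimension is at most the number
of controls. -/
theorem finrank_genRange_le_card {n m : ℕ} {k : WithTop ℕ∞} (hk : k = ∞ ∨ k = ω)
    {f : Vec n × Vec m → Vec n} {Ω : Set (Vec n × Vec m)} {X : Set (Vec n)} {U : Set (Vec m)}
    (hf : ContDiffOn ℝ k f Ω) (hXU : X ×ˢ U ⊆ Ω) (hU : IsOpen U)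
    (hD : ∀ x ∈ X, ∀ u ∈ U, ∀ u' ∈ U, genRange f U x u = genRange f U x u')
    {u₀ : Vec m} (hu₀ : u₀ ∈ U) {x : Vec n} (hx : x ∈ X) :
    Module.finrank ℝ (genRange f U x u₀) ≤ m := by
  set g : Vec m → Vec n := fun w => f (x, w) with hg
  have hgc : ContDiffOn ℝ 1 g U :=
    (hf.comp (contDiff_const.prodMk contDiff_id).contDiffOn fun _ hu => hXU ⟨hx, hu⟩).of_le
      (one_le_of_smooth_or_analytic hk)
  set ρ : Vec m → ℕ := fun u => Module.finrank ℝ (LinearMap.range (fderiv ℝ g u : Vec m →ₗ[ℝ] Vec n))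
  have hbdd : BddAbove (ρ '' U) := ⟨Module.finrank ℝ (Vec m), by
    rintro _ ⟨u, -, rfl⟩
    exact LinearMap.finrank_range_le _⟩
  -- A control where the rank of the partial differential is maximal. The bound obtained there
  -- transfers to `u₀` because the generalized range is the same.
  obtain ⟨u₁, hu₁, h1⟩ := Nat.sSup_mem (s := ρ '' U) ⟨_, u₀, hu₀, rfl⟩ hbdd
  obtain ⟨T, p, G, hT, hG, hgG⟩ := exists_factor_of_maximal_rank hU hgc hu₁ fun u hu => by
    change ρ u ≤ ρ u₁
    rw [h1]
    exact le_csSup hbdd ⟨u, hu, rfl⟩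
  rw [hD x hx u₀ hu₀ u₁ hu₁]
  refine (finrank_genRange_le hG (hgc.continuousOn.continuousAt (hU.mem_nhds hu₁)) hgG).trans
    (hT.trans ?_)
  simp

/-! ### Transport of solutions -/

/-- A Lipschitz function is the integral of its almost everywhere derivative. -/
theorem sub_eq_integral_of_lipschitzOnWith {F : Type*} [NormedAddCommGroup F] [NormedSpace ℝ F]
    [CompleteSpace F] {y w : ℝ → F} {a b C : ℝ} (hab : a ≤ b) {K : NNReal}
    (hy : LipschitzOnWith K y (Icc a b)) (hw : IntervalIntegrable w volume a b)
    (hC : ∀ t ∈ Icc a b, ‖w t‖ ≤ C) (hd : ∀ᵐ t, t ∈ Icc a b → HasDerivAt y (w t) t) :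
    y b - y a = ∫ t in a..b, w t := by
  have hint : ∀ s ∈ Icc a b, IntervalIntegrable w volume a s := fun s hs =>
    hw.mono_set (by rw [uIcc_of_le hs.1, uIcc_of_le hab]; exact Icc_subset_Icc_right hs.2)
  have hC0 : 0 ≤ C := (norm_nonneg _).trans (hC a (left_mem_Icc.mpr hab))
  have hlip : LipschitzOnWith C.toNNReal (fun s => ∫ t in a..s, w t) (Icc a b) := by
    refine LipschitzOnWith.of_dist_le_mul fun s hs t ht => ?_
    rw [dist_eq_norm, intervalIntegral.integral_interval_sub_left (hint s hs) (hint t ht),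
      Real.coe_toNNReal C hC0, Real.dist_eq]
    refine intervalIntegral.norm_integral_le_of_norm_le_const fun r hr => hC r ?_
    have hr' := uIoc_subset_uIcc hr
    exact ordConnected_Icc.uIcc_subset ht hs hr'
  -- The difference between `y` and the primitive of `w` is absolutely continuous with derivative
  -- zero almost everywhere, hence constant.
  have hac := (hy.mono (uIcc_of_le hab).subset).absolutelyContinuousOnInterval.sub
    (hlip.mono (uIcc_of_le hab).subset).absolutelyContinuousOnInterval
  obtain ⟨c, hc⟩ := hac.const_of_ae_hasDerivAt_zero (by
    filter_upwards [hd, hw.ae_hasDerivAt_integral] with t h1 h2 ht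
    have := (h1 (uIcc_of_le hab ▸ ht)).sub (h2 ht a left_mem_uIcc)
    rwa [sub_self] at this)
  have h1 := hc a left_mem_uIcc
  have h2 := hc b right_mem_uIcc
  simp only [Pi.sub_apply, intervalIntegral.integral_same, sub_zero] at h1 h2
  rw [h1, ← h2, sub_sub_cancel]

section

variable {n m : ℕ} {f g : Vec n × Vec m → Vec n} {Ω Ω' : Set (Vec n × Vec m)} {I : Set ℝ}
  {γ δ : ℝ → Vec n × Vec m}

theorem IsSolution.lipschitzOnWith {C : ℝ} (hf : ∀ p ∈ Ω, ‖f p‖ ≤ C) (hC : 0 ≤ C)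
    (hγ : IsSolution f Ω I γ) {a b : ℝ} (hI : Icc a b ⊆ I) :
    LipschitzOnWith C.toNNReal (fun t => (γ t).1) (Icc a b) := by
  have key : ∀ s ∈ Icc a b, ∀ t ∈ Icc a b, s ≤ t → ‖(γ t).1 - (γ s).1‖ ≤ C * |t - s| := by
    intro s hs t ht hst
    have hsub : Icc s t ⊆ I := (Icc_subset_Icc hs.1 ht.2).trans hI
    rw [(hγ.integralEq s t hst hsub).2]
    refine intervalIntegral.norm_integral_le_of_norm_le_const fun r hr => hf _ (hγ.remains r ?_)
    rw [uIoc_of_le hst] at hr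
    exact hsub ⟨hr.1.le, hr.2⟩
  refine LipschitzOnWith.of_dist_le_mul fun s hs t ht => ?_
  rw [Real.coe_toNNReal C hC, dist_eq_norm, Real.dist_eq]
  rcases le_total t s with h | h
  · exact key t ht s hs h
  · rw [norm_sub_rev, abs_sub_comm]
    exact key s hs t ht h

theorem IsSolution.ae_hasDerivAt (hγ : IsSolution f Ω I γ) {a b : ℝ} (hab : a ≤ b)
    (hI : Icc a b ⊆ I) : ∀ᵐ t, t ∈ Icc a b → HasDerivAt (fun t => (γ t).1) (f (γ t)) t := by
  have h1 : ∀ᵐ t : ℝ, t ≠ a := by simp [ae_iff, measure_singleton]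
  have h2 : ∀ᵐ t : ℝ, t ≠ b := by simp [ae_iff, measure_singleton]
  filter_upwards [h1, h2, (hγ.integralEq a b hab hI).1.ae_hasDerivAt_integral] with t hta htb h ht
  have h3 := (h (uIcc_of_le hab ▸ ht) a left_mem_uIcc).const_add (γ a).1
  refine h3.congr_of_eventuallyEq ?_
  filter_upwards [Icc_mem_nhds (lt_of_le_of_ne ht.1 hta.symm) (lt_of_le_of_ne ht.2 htb)] with s hs
  rw [← (hγ.integralEq a s hs.1 ((Icc_subset_Icc_right hs.2).trans hI)).2]
  simp

theorem _root_.ContDiffOn.exists_lipschitzOnWith_of_isCompact {E F : Type*}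
    [NormedAddCommGroup E] [NormedSpace ℝ E] [NormedAddCommGroup F] [NormedSpace ℝ F] {φ : E → F}
    {V K : Set E} (hφ : ContDiffOn ℝ 1 φ V) (hV : IsOpen V) (hK : IsCompact K) (hKV : K ⊆ V) :
    ∃ L, LipschitzOnWith L φ K := by
  refine LocallyLipschitzOn.exists_lipschitzOnWith_of_compact hK fun x hx => ?_
  obtain ⟨L, t, ht, hL⟩ := (hφ.contDiffAt (hV.mem_nhds (hKV hx))).exists_lipschitzOnWith
  exact ⟨L, t, mem_nhdsWithin_of_mem_nhds ht, hL⟩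

/-- A change of variables `χ` whose first component is `φ (x)` transports solutions of
`ẋ = f (x, u)` to solutions of `ż = g (z, v)` as soon as `dφ (f) = g ∘ χ` and everything is
bounded. -/
theorem IsSolution.transport {χ : Vec n × Vec m → Vec n × Vec m} {φ : Vec n → Vec n}
    {V : Set (Vec n)} (hΩ : IsOpen Ω) (hV : IsOpen V) (hχ : ContinuousOn χ Ω)
    (hmaps : MapsTo χ Ω Ω') (hφ : ContDiffOn ℝ 1 φ V) (hΩV : ∀ p ∈ Ω, p.1 ∈ V)
    (hχφ : ∀ p ∈ Ω, (χ p).1 = φ p.1) (hD : ∀ p ∈ Ω, fderiv ℝ φ p.1 (f p) = g (χ p)) {C C' : ℝ}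
    (hf : ∀ p ∈ Ω, ‖f p‖ ≤ C) (hg : ∀ p ∈ Ω', ‖g p‖ ≤ C') (hΩ' : IsOpen Ω')
    (hgc : ContinuousOn g Ω') (hbdd : Bornology.IsBounded Ω') (hI : I.OrdConnected)
    (hδ : ∀ t ∈ I, δ t = χ (γ t)) (hγ : IsSolution f Ω I γ) : IsSolution g Ω' I δ := by
  classical
  have hrem : ∀ t ∈ I, δ t ∈ Ω' := fun t ht => by
    rw [hδ t ht]; exact hmaps (hγ.remains t ht)
  have hIm : MeasurableSet I := hI.measurableSet
  have hmeas : AEMeasurable δ (volume.restrict I) := by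
    -- `χ` is only continuous on `Ω`; its extension by zero is Borel and agrees with it along the
    -- solution.
    have h1 : Measurable (Ω.piecewise χ fun _ => 0) :=
      hχ.measurable_piecewise continuousOn_const hΩ.measurableSet
    refine (h1.comp_aemeasurable hγ.measurable).congr ?_
    filter_upwards [ae_restrict_mem hIm] with t ht
    rw [hδ t ht, Function.comp_apply, piecewise_eq_of_mem _ _ _ (hγ.remains t ht)]
  have hgmeas : AEMeasurable (fun t => g (δ t)) (volume.restrict I) := by
    have h1 : Measurable (Ω'.piecewise g fun _ => 0) :=
      hgc.measurable_piecewise continuousOn_const hΩ'.measurableSet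
    refine (h1.comp_aemeasurable hmeas).congr ?_
    filter_upwards [ae_restrict_mem hIm] with t ht
    rw [Function.comp_apply, piecewise_eq_of_mem _ _ _ (hrem t ht)]
  have hlip : ∀ a b : ℝ, a ≤ b → Icc a b ⊆ I →
      ∃ L, LipschitzOnWith L (fun t => (δ t).1) (Icc a b) := by
    intro a b hab hab'
    have hC : 0 ≤ C := (norm_nonneg _).trans
      (hf _ (hγ.remains a (hab' (left_mem_Icc.mpr hab))))
    have h1 := hγ.lipschitzOnWith hf hC hab'
    obtain ⟨L, hL⟩ := hφ.exists_lipschitzOnWith_of_isCompact hV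
      (isCompact_Icc.image_of_continuousOn h1.continuousOn) (by
        rintro _ ⟨t, ht, rfl⟩
        exact hΩV _ (hγ.remains t (hab' ht)))
    refine ⟨L * C.toNNReal, fun s hs t ht => ?_⟩
    simp only [hδ _ (hab' hs), hδ _ (hab' ht), hχφ _ (hγ.remains _ (hab' hs)),
      hχφ _ (hγ.remains _ (hab' ht))]
    exact hL.comp h1 (mapsTo_image _ _) hs ht
  refine ⟨hrem, hmeas, fun a b hab => hbdd.subset ?_, fun a b hab hab' => ?_,
    fun a b hab hab' => ?_⟩
  · rintro _ ⟨t, ht, rfl⟩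
    exact hrem t (hab ht)
  · obtain ⟨L, hL⟩ := hlip a b hab hab'
    exact (hL.mono (uIcc_of_le hab).subset).absolutelyContinuousOnInterval
  · have hint : IntervalIntegrable (fun t => g (δ t)) volume a b := by
      rw [intervalIntegrable_iff_integrableOn_Icc_of_le hab]
      refine Integrable.of_bound
        ((hgmeas.mono_measure (Measure.restrict_mono hab' le_rfl)).aestronglyMeasurable) C' ?_
      filter_upwards [ae_restrict_mem measurableSet_Icc] with t ht
      exact hg _ (hrem t (hab' ht))
    refine ⟨hint, ?_⟩
    obtain ⟨L, hL⟩ := hlip a b hab hab'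
    -- The chain rule holds at almost every time, where the state is differentiable. Lipschitz
    -- continuity of the transported state upgrades this to the integral equation.
    refine sub_eq_integral_of_lipschitzOnWith (y := fun t => (δ t).1) hab hL hint
      (fun t ht => hg _ (hrem t (hab' ht))) ?_
    have h1 : ∀ᵐ t : ℝ, t ≠ a := by simp [ae_iff, measure_singleton]
    have h2 : ∀ᵐ t : ℝ, t ≠ b := by simp [ae_iff, measure_singleton]
    filter_upwards [h1, h2, hγ.ae_hasDerivAt hab hab'] with t hta htb h ht
    have hγt := hγ.remains t (hab' ht)
    have h3 : HasFDerivAt φ (fderiv ℝ φ (γ t).1) (γ t).1 :=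
      ((hφ.contDiffAt (hV.mem_nhds (hΩV _ hγt))).differentiableAt one_ne_zero).hasFDerivAt
    have h4 := h3.comp_hasDerivAt t (h ht)
    rw [hD _ hγt, ← hδ t (hab' ht)] at h4
    refine h4.congr_of_eventuallyEq ?_
    filter_upwards [Icc_mem_nhds (lt_of_le_of_ne ht.1 hta.symm) (lt_of_le_of_ne ht.2 htb)]
      with s hs
    rw [hδ s (hab' hs), hχφ _ (hγ.remains s (hab' hs))]
    rfl

end

/-! ### Kalman's criterion -/

/-- Kalman's rank condition in terms of linear forms. -/
theorem isControllable_iff {n m : ℕ} {A : Matrix (Fin n) (Fin n) ℝ} {B : Matrix (Fin n) (Fin m) ℝ} :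
    IsControllable A B ↔ ∀ l : Vec n →L[ℝ] ℝ,
      (∀ j < n, ∀ u, l ((Matrix.toEuclideanLin A ^ j) (Matrix.toEuclideanLin B u)) = 0) →
        l = 0 := by
  have hpow : ∀ j u, (Matrix.toEuclideanLin A ^ j) (Matrix.toEuclideanLin B u) =
      WithLp.toLp 2 ((A ^ j * B).mulVec (WithLp.ofLp u)) := by
    intro j u
    rw [← Matrix.toLpLin_pow, Matrix.toLpLin_apply, Matrix.toLpLin_apply, Matrix.mulVec_mulVec]
  have hcol : ∀ q : Fin n × Fin m, (kalmanMatrix A B).col q =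
      (A ^ (q.1 : ℕ) * B).mulVec (Pi.single q.2 1) := by
    intro q
    rw [Matrix.mulVec_single_one]
    rfl
  rw [IsControllable, Matrix.rank, Matrix.range_mulVecLin]
  have htop : Module.finrank ℝ (Submodule.span ℝ (range (kalmanMatrix A B).col)) = n ↔
      Submodule.span ℝ (range (kalmanMatrix A B).col) = ⊤ := by
    constructor
    · intro h
      exact Submodule.eq_top_of_finrank_eq (by simpa using h)
    · intro h
      rw [h]
      simp
  rw [htop]
  constructor
  · intro h l hl
    have h1 : Submodule.span ℝ (range (kalmanMatrix A B).col) ≤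
        LinearMap.ker ((l : Vec n →ₗ[ℝ] ℝ) ∘ₗ
          ((WithLp.linearEquiv 2 ℝ (Fin n → ℝ)).symm : (Fin n → ℝ) →ₗ[ℝ] Vec n)) := by
      refine Submodule.span_le.mpr ?_
      rintro _ ⟨q, rfl⟩
      rw [hcol]
      have := hl q.1 q.1.2 (WithLp.toLp 2 (Pi.single q.2 1))
      rw [hpow] at this
      exact this
    rw [h] at h1
    ext1 v
    exact h1 (Submodule.mem_top (x := WithLp.ofLp v))
  · intro h
    by_contra hne
    obtain ⟨l, hl0, hl⟩ := Submodule.exists_le_ker_of_lt_top _ (lt_top_iff_ne_top.mpr hne)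
    refine hl0 ?_
    have h2 := h (LinearMap.toContinuousLinearMap (l ∘ₗ
      ((WithLp.linearEquiv 2 ℝ (Fin n → ℝ)) : Vec n →ₗ[ℝ] (Fin n → ℝ)))) ?_
    · refine LinearMap.ext fun v => ?_
      exact congrArg (fun l : Vec n →L[ℝ] ℝ => l (WithLp.toLp 2 v)) h2
    · intro j hj u
      rw [hpow]
      change l ((A ^ j * B).mulVec (WithLp.ofLp u)) = 0
      have h3 : (A ^ j * B).mulVec (WithLp.ofLp u) =
          ∑ i, WithLp.ofLp u i • (A ^ j * B).mulVec (Pi.single i 1) := by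
        conv_lhs => rw [pi_eq_sum_univ' (WithLp.ofLp u)]
        rw [Matrix.mulVec_sum]
        refine Finset.sum_congr rfl fun i _ => ?_
        rw [Matrix.mulVec_smul]
      rw [h3, map_sum]
      refine Finset.sum_eq_zero fun i _ => ?_
      rw [map_smul, ← hcol (⟨j, hj⟩, i)]
      have := hl (Submodule.subset_span ⟨(⟨j, hj⟩, i), rfl⟩)
      rw [LinearMap.mem_ker.mp this, smul_zero]

/-! ### From the geometric conditions to linearizability -/

/-- A fibration provides a continuous coordinate which is complementary to the projection. -/
theorem exists_fiber_coordinate {E B F : Type*} [TopologicalSpace E] [TopologicalSpace B]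
    [TopologicalSpace F] [Nonempty F] {g : E → B} {W : Set E} {p : E} (hW : W ∈ 𝓝 p)
    (h : IsC0Fibration F (imageFactorization g W)) :
    ∃ (M : Set E) (y : E → F), IsOpen M ∧ p ∈ M ∧ M ⊆ W ∧ ContinuousOn y M ∧
      InjOn (fun q => (g q, y q)) M := by
  classical
  obtain ⟨hc, hloc⟩ := h
  set p' : W := ⟨p, mem_of_mem_nhds hW⟩
  obtain ⟨O, hO, ψ, hψ⟩ := hloc (imageFactorization g W p')
  have hN : Subtype.val '' (imageFactorization g W ⁻¹' O) ∈ 𝓝 p := by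
    rw [← map_nhds_subtype_coe_eq_nhds (mem_of_mem_nhds hW) hW]
    exact image_mem_map (hc.continuousAt hO)
  -- The fiber component of a local trivialization, with an arbitrary value where the trivialization
  -- is not defined.
  set y : E → F := fun q => if h : ∃ hq : q ∈ W, imageFactorization g W ⟨q, hq⟩ ∈ O then
    (ψ ⟨⟨q, h.1⟩, h.2⟩).2 else Classical.arbitrary F with hy
  have hNex : ∀ q ∈ Subtype.val '' (imageFactorization g W ⁻¹' O),
      ∃ hq : q ∈ W, imageFactorization g W ⟨q, hq⟩ ∈ O := by
    rintro _ ⟨q, hq, rfl⟩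
    exact ⟨q.2, hq⟩
  have hyq : ∀ q (h : ∃ hq : q ∈ W, imageFactorization g W ⟨q, hq⟩ ∈ O),
      y q = (ψ ⟨⟨q, h.1⟩, h.2⟩).2 := fun q h => dif_pos h
  have hyc : ContinuousOn y (Subtype.val '' (imageFactorization g W ⁻¹' O)) := by
    rw [continuousOn_iff_continuous_domRestrict]
    have h1 : Continuous fun q : ↥(Subtype.val '' (imageFactorization g W ⁻¹' O)) =>
        (ψ ⟨⟨q, (hNex q q.2).1⟩, (hNex q q.2).2⟩).2 :=
      continuous_snd.comp (ψ.continuous.comp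
        ((continuous_subtype_val.subtype_mk _).subtype_mk _))
    exact h1.congr fun q => (hyq q (hNex q q.2)).symm
  refine ⟨interior (Subtype.val '' (imageFactorization g W ⁻¹' O)), y, isOpen_interior,
    mem_interior_iff_mem_nhds.mpr hN, ?_, hyc.mono interior_subset, ?_⟩
  · intro q hq
    exact (hNex q (interior_subset hq)).1
  · intro q hq q' hq' hqq
    have h1 := hNex q (interior_subset hq)
    have h2 := hNex q' (interior_subset hq')
    have hg : g q = g q' := (Prod.ext_iff.mp hqq).1
    have hy' : y q = y q' := (Prod.ext_iff.mp hqq).2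
    rw [hyq q h1, hyq q' h2] at hy'
    have h3 : ψ ⟨⟨q, h1.1⟩, h1.2⟩ = ψ ⟨⟨q', h2.1⟩, h2.2⟩ := by
      refine Prod.ext (Subtype.ext (Subtype.ext ?_)) hy'
      rw [hψ, hψ]
      exact hg
    exact congrArg (fun z => ((z : W) : E)) (congrArg Subtype.val (ψ.injective h3))

/-- A continuous injective map between spaces of the same finite dimension, defined on an open set,
is an open partial homeomorphism. -/
theorem exists_openPartialHomeomorph_of_injOn {E : Type*} [NormedAddCommGroup E] [NormedSpace ℝ E]
    [FiniteDimensional ℝ E] {f : E → E} {s : Set E} (hs : IsOpen s) (hf : ContinuousOn f s)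
    (hinj : InjOn f s) :
    ∃ χ : OpenPartialHomeomorph E E, (χ : E → E) = f ∧ χ.source = s ∧ χ.target = f '' s := by
  refine ⟨OpenPartialHomeomorph.ofContinuousOpenRestrict (hinj.toPartialEquiv f s) hf ?_ hs,
    rfl, rfl, rfl⟩
  intro t ht
  obtain ⟨t', ht', rfl⟩ := isOpen_induced_iff.mp ht
  have h1 : (hinj.toPartialEquiv f s).source.domRestrict (hinj.toPartialEquiv f s) ''
      (Subtype.val ⁻¹' t') = f '' (s ∩ t') := by
    ext z
    constructor
    · rintro ⟨⟨q, hq⟩, hq', rfl⟩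
      exact ⟨q, ⟨hq, hq'⟩, rfl⟩
    · rintro ⟨q, ⟨hq, hq'⟩, rfl⟩
      exact ⟨⟨q, hq⟩, hq', rfl⟩
  rw [h1]
  -- Invariance of domain supplies the continuity of the inverse.
  exact isOpen_image_of_injOn rfl (hs.inter ht') (hf.mono inter_subset_left)
    (hinj.mono inter_subset_left)

theorem continuous_linearRHS {n m : ℕ} (A : Matrix (Fin n) (Fin n) ℝ)
    (B : Matrix (Fin n) (Fin m) ℝ) : Continuous (linearRHS A B) :=
  ((LinearMap.continuous_of_finiteDimensional _).comp continuous_fst).add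
    ((LinearMap.continuous_of_finiteDimensional _).comp continuous_snd)

/-- A bounded quasi-diffeomorphism which intertwines the dynamics conjugates them. -/
theorem conjugates_of_fderiv_eq {n m : ℕ} {f g : Vec n × Vec m → Vec n}
    {χ : OpenPartialHomeomorph (Vec n × Vec m) (Vec n × Vec m)}
    {φ : OpenPartialHomeomorph (Vec n) (Vec n)} (hφ : ContDiffOn ℝ 1 φ φ.source)
    (hφ' : ContDiffOn ℝ 1 φ.symm φ.target)
    (hφd : ∀ x ∈ φ.source, ∃ e : Vec n ≃L[ℝ] Vec n, HasFDerivAt φ (e : Vec n →L[ℝ] Vec n) x)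
    (hs : ∀ p ∈ χ.source, p.1 ∈ φ.source) (hχφ : ∀ p ∈ χ.source, (χ p).1 = φ p.1)
    (hD : ∀ p ∈ χ.source, fderiv ℝ φ p.1 (f p) = g (χ p)) {C C' : ℝ}
    (hf : ∀ p ∈ χ.source, ‖f p‖ ≤ C) (hg : ∀ p ∈ χ.target, ‖g p‖ ≤ C')
    (hfc : ContinuousOn f χ.source) (hgc : ContinuousOn g χ.target)
    (hb : Bornology.IsBounded χ.source) (hb' : Bornology.IsBounded χ.target) :
    Conjugates f g χ := by
  intro I hI γ hγ
  constructor
  · exact fun h => h.transport χ.open_source φ.open_source χ.continuousOn χ.mapsTo hφ hs hχφ hD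
      hf hg χ.open_target hgc hb' hI fun _ _ => rfl
  -- The converse direction is the same transport applied to the inverse maps, whose differential is
  -- the inverse one.
  · have hsy : ∀ q ∈ χ.target, q.1 = φ (χ.symm q).1 := fun q hq => by
      rw [← hχφ _ (χ.map_target hq), χ.right_inv hq]
    refine fun h => h.transport χ.open_target φ.open_target χ.continuousOn_symm χ.mapsTo_symm hφ'
      (fun q hq => ?_) (fun q hq => ?_) (fun q hq => ?_) hg hf χ.open_source hfc hb hI
      fun t ht => (χ.left_inv (hγ t ht)).symm
    · rw [hsy q hq]
      exact φ.map_source (hs _ (χ.map_target hq))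
    · rw [hsy q hq, φ.left_inv (hs _ (χ.map_target hq))]
    · have hx := hs _ (χ.map_target hq)
      obtain ⟨e, he⟩ := hφd _ hx
      have hD' := hD _ (χ.map_target hq)
      rw [χ.right_inv hq, he.fderiv] at hD'
      rw [hsy q hq]
      have h1 := φ.hasFDerivAt_symm (φ.map_source hx) (f' := e) (by rwa [φ.left_inv hx])
      rw [h1.fderiv, ← hD']
      simp

/-- A homeomorphism between open sets need not preserve bounded controls. Shrinking until source,
image and velocities are bounded makes local boundedness and integrability automatic. -/
theorem exists_bounded_neighborhood {E F G : Type*} [PseudoMetricSpace E] [PseudoMetricSpace F]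
    [PseudoMetricSpace G] {S : Set E} (hS : IsOpen S) {p : E} (hp : p ∈ S) {f : E → F} {g : E → G}
    (hf : ContinuousOn f S) (hg : ContinuousOn g S) :
    ∃ S₁, IsOpen S₁ ∧ p ∈ S₁ ∧ S₁ ⊆ S ∧ Bornology.IsBounded S₁ ∧
      (∀ q ∈ S₁, f q ∈ Metric.ball (f p) 1) ∧ ∀ q ∈ S₁, g q ∈ Metric.ball (g p) 1 :=
  ⟨(S ∩ f ⁻¹' Metric.ball (f p) 1) ∩ ((S ∩ g ⁻¹' Metric.ball (g p) 1) ∩ Metric.ball p 1),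
    (hf.isOpen_inter_preimage hS Metric.isOpen_ball).inter
      ((hg.isOpen_inter_preimage hS Metric.isOpen_ball).inter Metric.isOpen_ball),
    ⟨⟨hp, Metric.mem_ball_self one_pos⟩, ⟨hp, Metric.mem_ball_self one_pos⟩,
      Metric.mem_ball_self one_pos⟩,
    fun _ hq => hq.1.1, Metric.isBounded_ball.subset fun _ hq => hq.2.2, fun _ hq => hq.1.2,
    fun _ hq => hq.2.1.2⟩

/-- Coordinates in which the dynamics is linear up to a term in a fixed subspace, together with a
continuous coordinate which is complementary to this term, provide a linearization. -/
theorem locallyQuasiLinearizableAt_of_coordinates {n m : ℕ} {k : WithTop ℕ∞} (hk1 : 1 ≤ k)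
    {f : Vec n × Vec m → Vec n} {Ω S₀ : Set (Vec n × Vec m)} {x₀ : Vec n} {u₀ : Vec m}
    {R : Submodule ℝ (Vec n)} (hRm : Module.finrank ℝ R ≤ m) {X : Set (Vec n)} (hX : IsOpen X)
    (hx₀ : x₀ ∈ X) {φ : Vec n → Vec n} (hφc : ContDiffOn ℝ k φ X)
    (hφ0 : fderiv ℝ φ x₀ = ContinuousLinearMap.id ℝ (Vec n)) {A : Vec n →ₗ[ℝ] Vec n}
    (hctrl : ∀ l : Vec n →L[ℝ] ℝ, (∀ j < n, ∀ v ∈ R, l ((A ^ j) v) = 0) → l = 0)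
    (hS₀o : IsOpen S₀) (hS₀Ω : S₀ ⊆ Ω) (hpS₀ : (x₀, u₀) ∈ S₀) (hS₀X : ∀ p ∈ S₀, p.1 ∈ X)
    (hfS₀ : ContinuousOn f S₀) (hR : ∀ p ∈ S₀, fderiv ℝ φ p.1 (f p) - A (φ p.1) ∈ R)
    {y : Vec n × Vec m → Vec (m - Module.finrank ℝ R)} (hyS₀ : ContinuousOn y S₀)
    (hyinj : InjOn (fun q => ((q.1, f q), y q)) S₀) :
    LocallyQuasiLinearizableAt k f Ω (x₀, u₀) := by
  have hk0 : k ≠ 0 := (zero_lt_one.trans_le hk1).ne'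
  have hφd0 : HasFDerivAt φ ((ContinuousLinearEquiv.refl ℝ (Vec n) : Vec n →L[ℝ] Vec n)) x₀ := by
    have h1 := ((hφc.contDiffAt (hX.mem_nhds hx₀)).differentiableAt hk0).hasFDerivAt
    rw [hφ0] at h1
    exact h1
  obtain ⟨Φ, hΦ, hx₀Φ, hΦX', hΦc, hΦd⟩ :=
    exists_openPartialHomeomorph_of_contDiffOn hk1 hX hφc hx₀ hφd0
  -- The dimensions match because `hRm` makes the natural subtraction exact.
  obtain ⟨e⟩ : Nonempty (Vec m ≃L[ℝ] R × Vec (m - Module.finrank ℝ R)) :=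
    ⟨ContinuousLinearEquiv.ofFinrankEq (by simp [hRm])⟩
  obtain ⟨S, hS⟩ : ∃ S, S = S₀ ∩ Prod.fst ⁻¹' Φ.source := ⟨_, rfl⟩
  have hSS₀ : S ⊆ S₀ := hS ▸ inter_subset_left
  have hSΦ : ∀ p ∈ S, p.1 ∈ Φ.source := fun p hp => (hS ▸ hp : p ∈ S₀ ∩ _).2
  have hSo : IsOpen S := hS ▸ hS₀o.inter (Φ.open_source.preimage continuous_fst)
  have hSΩ : S ⊆ Ω := hSS₀.trans hS₀Ω
  have hpS : (x₀, u₀) ∈ S := hS ▸ ⟨hpS₀, hx₀Φ⟩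
  have hSX : ∀ p ∈ S, p.1 ∈ X := fun p hp => hS₀X p (hSS₀ hp)
  have hfc : ContinuousOn f S := hfS₀.mono hSS₀
  have hyc : ContinuousOn y S := hyS₀.mono hSS₀
  have hφc' : ContinuousOn (fun p : Vec n × Vec m => φ p.1) S :=
    hφc.continuousOn.comp continuous_fst.continuousOn hSX
  -- The part of the new control that acts on the state: the deviation of the velocity from its
  -- linear part. The projection only serves to give it the type `R`.
  set v : Vec n × Vec m → R := fun p =>
    R.orthogonalProjectionOnto (fderiv ℝ φ p.1 (f p) - A (φ p.1)) with hv
  have hvf : ∀ p ∈ S, fderiv ℝ φ p.1 (f p) = A (φ p.1) + v p := by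
    intro p hp
    have h1 : (v p : Vec n) = fderiv ℝ φ p.1 (f p) - A (φ p.1) := congrArg Subtype.val
      (Submodule.orthogonalProjectionOnto_mem_subspace_eq_self
        (⟨_, hR p (hSS₀ hp)⟩ : R))
    rw [h1, add_sub_cancel]
  have hvc : ContinuousOn v S := by
    refine (R.orthogonalProjectionOnto).continuous.comp_continuousOn
      ((ContinuousOn.clm_apply ?_ hfc).sub ?_)
    · exact (hφc.continuousOn_fderiv_of_isOpen hX hk1).comp continuous_fst.continuousOn hSX
    · exact (LinearMap.continuous_of_finiteDimensional A).comp_continuousOn hφc'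
  set χ₀ : Vec n × Vec m → Vec n × Vec m := fun p => (φ p.1, e.symm (v p, y p)) with hχ₀
  have hχ₀c : ContinuousOn χ₀ S :=
    hφc'.prodMk (e.symm.continuous.comp_continuousOn (hvc.prodMk hyc))
  -- `φ` determines `x`; then `v` and the invertibility of `φ'` determine `f (x, u)`; then `y`
  -- determines `u`.
  have hχ₀i : InjOn χ₀ S := by
    rintro ⟨x, u⟩ hp ⟨x', u'⟩ hp' h
    have h1 : φ x = φ x' := (Prod.ext_iff.mp h).1
    have h2 : (v (x, u), y (x, u)) = (v (x', u'), y (x', u')) :=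
      e.symm.injective (Prod.ext_iff.mp h).2
    rw [← hΦ] at h1
    obtain rfl : x = x' := Φ.injOn (hSΦ _ hp) (hSΦ _ hp') h1
    have h3 : fderiv ℝ φ x (f (x, u)) = fderiv ℝ φ x (f (x, u')) := by
      have h4 := hvf _ hp
      have h5 := hvf _ hp'
      have h6 : v (x, u) = v (x, u') := (Prod.ext_iff.mp h2).1
      rw [h6] at h4
      exact h4.trans h5.symm
    obtain ⟨a, ha⟩ := hΦd x (hSΦ _ hp)
    rw [ha.fderiv] at h3
    exact hyinj (hSS₀ hp) (hSS₀ hp') (Prod.ext (Prod.ext rfl (a.injective h3)) (Prod.ext_iff.mp h2).2)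
  obtain ⟨S₁, hS₁o, hpS₁, hS₁S, hS₁b, hS₁f, hS₁χ⟩ :=
    exists_bounded_neighborhood hSo hpS hfc hχ₀c
  obtain ⟨χ, hχ, hχs, hχt⟩ := exists_openPartialHomeomorph_of_injOn hS₁o (hχ₀c.mono hS₁S)
    (hχ₀i.mono hS₁S)
  set B : Vec m →ₗ[ℝ] Vec n := R.subtype ∘ₗ LinearMap.fst ℝ R (Vec (m - Module.finrank ℝ R)) ∘ₗ
    (e : Vec m →ₗ[ℝ] R × Vec (m - Module.finrank ℝ R)) with hB
  set MA := Matrix.toEuclideanLin.symm A with hMA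
  set MB := Matrix.toEuclideanLin.symm B with hMB
  have hA' : Matrix.toEuclideanLin MA = A := Matrix.toEuclideanLin.apply_symm_apply A
  have hB' : Matrix.toEuclideanLin MB = B := Matrix.toEuclideanLin.apply_symm_apply B
  refine ⟨MA, MB, ?_, χ, hχs ▸ hpS₁, hχs ▸ hS₁S.trans hSΩ, ?_, ?_⟩
  · rw [isControllable_iff, hA', hB']
    intro l hl
    refine hctrl l fun j hj w hw => ?_
    have := hl j hj (e.symm (⟨w, hw⟩, 0))
    simpa [hB] using this
  · have hop : IsOpen (Prod.fst '' S₁) := isOpenMap_fst _ hS₁o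
    have hsub : Prod.fst '' S₁ ⊆ Φ.source := by
      rintro _ ⟨p, hp, rfl⟩
      exact hSΦ _ (hS₁S hp)
    have hs : (Φ.restrOpen _ hop).source = Prod.fst '' S₁ := by
      rw [OpenPartialHomeomorph.restrOpen_source]
      exact inter_eq_right.mpr hsub
    have ht : (Φ.restrOpen _ hop).target = Prod.fst '' (χ₀ '' S₁) := by
      rw [← (Φ.restrOpen _ hop).image_source_eq_target, hs, image_image, image_image]
      exact image_congr fun p _ => congrFun hΦ p.1
    refine ⟨Φ.restrOpen _ hop, by rw [hs, hχs], by rw [ht, hχt], ?_, ?_, ?_⟩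
    · rw [hs]
      change ContDiffOn ℝ k Φ _
      rw [hΦ]
      exact hφc.mono (hsub.trans hΦX')
    · refine hΦc.mono ?_
      rintro z hz
      have : z ∈ (Φ.restrOpen _ hop).target := hz
      rw [← (Φ.restrOpen _ hop).image_source_eq_target, hs] at this
      obtain ⟨x, hx, rfl⟩ := this
      exact Φ.map_source (hsub hx)
    · intro p _
      rw [hχ]
      exact (congrFun hΦ p.1).symm
  · have hχp : ∀ p, (χ p).1 = φ p.1 := fun p => by rw [hχ]
    have hbt : χ.target ⊆ Metric.ball (χ₀ (x₀, u₀)) 1 := by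
      rw [hχt]
      rintro _ ⟨p, hp, rfl⟩
      exact hS₁χ p hp
    obtain ⟨C', hC'⟩ := (isCompact_closedBall (χ₀ (x₀, u₀)) 1).exists_bound_of_continuousOn
      (continuous_linearRHS MA MB).continuousOn
    refine conjugates_of_fderiv_eq (φ := Φ) (C := ‖f (x₀, u₀)‖ + 1) (C' := C') ?_
      (hΦc.of_le hk1) ?_ ?_ ?_ ?_ ?_ ?_ ?_ (continuous_linearRHS MA MB).continuousOn ?_ ?_
    · rw [hΦ]
      exact (hφc.mono hΦX').of_le hk1
    · rw [hΦ]
      exact hΦd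
    · rw [hχs]
      exact fun p hp => hSΦ _ (hS₁S hp)
    · rw [hΦ]
      exact fun p _ => hχp p
    · rw [hχs, hΦ, hχ]
      intro p hp
      rw [hvf p (hS₁S hp), linearRHS, hA', hB']
      simp [hχ₀, hB]
    · rw [hχs]
      intro p hp
      have h1 : ‖f p - f (x₀, u₀)‖ < 1 := by
        rw [← dist_eq_norm]; exact hS₁f p hp
      have h2 := norm_le_norm_add_norm_sub' (f p) (f (x₀, u₀))
      linarith
    · exact fun q hq => hC' q (Metric.ball_subset_closedBall (hbt hq))
    · rw [hχs]
      exact hfc.mono hS₁S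
    · rw [hχs]
      exact hS₁b
    · exact Metric.isBounded_ball.subset hbt


/-- The geometric conditions imply local quasi-linearizability. -/
theorem locallyQuasiLinearizableAt_of_isIntegrable {n m : ℕ} {k : WithTop ℕ∞} (hk : k = ∞ ∨ k = ω)
    {f : Vec n × Vec m → Vec n} {Ω : Set (Vec n × Vec m)} (hΩ : IsOpen Ω)
    (hf : ContDiffOn ℝ k f Ω) {x₀ : Vec n} {u₀ : Vec m} {X : Set (Vec n)} {U : Set (Vec m)}
    (hX : IsOpen X) (hU : IsOpen U) (hx₀ : x₀ ∈ X) (hu₀ : u₀ ∈ U) (hXU : X ×ˢ U ⊆ Ω)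
    (hD : ∀ x ∈ X, ∀ u ∈ U, ∀ u' ∈ U, genRange f U x u = genRange f U x u')
    (hint : ∀ j ≤ n - 1, IsIntegrable k X (flag k f X U u₀ j))
    (hrank : ∀ x ∈ X, Module.finrank ℝ (flag k f X U u₀ (n - 1) x) = n)
    {W : Set (Vec n × Vec m)} (hW : W ∈ 𝓝 (x₀, u₀)) (hWXU : W ⊆ X ×ˢ U)
    (hfib : IsC0Fibration (Vec (m - Module.finrank ℝ (flag k f X U u₀ 0 x₀)))
      (imageFactorization (fun p : Vec n × Vec m => (p.1, f p)) W)) :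
    LocallyQuasiLinearizableAt k f Ω (x₀, u₀) := by
  have hk1 := one_le_of_smooth_or_analytic hk
  have hk0 : k ≠ 0 := (zero_lt_one.trans_le hk1).ne'
  set R := flag k f X U u₀ 0 x₀ with hR
  have hRm : Module.finrank ℝ R ≤ m := finrank_genRange_le_card hk hf hXU hU hD hu₀ hx₀
  set Q : Vec n →L[ℝ] R := R.orthogonalProjectionOnto with hQ
  have hQR : ∀ v ∈ R, (Q v : Vec n) = v := fun v hv =>
    congrArg Subtype.val (Submodule.orthogonalProjectionOnto_mem_subspace_eq_self (⟨v, hv⟩ : R))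
  have hF : ContDiffOn ℝ k (fun x => f (x, u₀)) X := contDiffOn_drift hf hXU hu₀
  obtain ⟨X', φ, A, hX'o, hxX', hX'X, hφc, hφ0, hφF, hφR, hctrl⟩ :=
    exists_linearizing_coordinates hk hX hF (Δ := flag k f X U u₀) (fun j => rfl) hint
      (fun x hx => Submodule.eq_top_of_finrank_eq (by rw [hrank x hx]; simp))
      (fun j x hx v hv => flag_le_sectionValues hk hΩ hf hXU hX hU hD hu₀ j hx hv) hx₀
      (R.subtypeL.comp Q) (fun v => (Q v).2) hQR
  obtain ⟨M, y, hMo, hpM, hMW, hyc, hyinj⟩ := exists_fiber_coordinate hW hfib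
  -- `U` need not be connected, whereas constancy along the control requires a connected set of
  -- controls.
  obtain ⟨ε, hε, hball⟩ := Metric.isOpen_iff.mp hU u₀ hu₀
  have hSX' : ∀ p ∈ X' ×ˢ Metric.ball u₀ ε ∩ M, p.1 ∈ X' := fun p hp => hp.1.1
  have hSΩ : X' ×ˢ Metric.ball u₀ ε ∩ M ⊆ Ω := fun p hp => hXU (hWXU (hMW hp.2))
  refine locallyQuasiLinearizableAt_of_coordinates hk1 hRm hX'o hxX' hφc hφ0 hctrl
    ((hX'o.prod Metric.isOpen_ball).inter hMo) hSΩ ⟨⟨hxX', Metric.mem_ball_self hε⟩, hpM⟩ hSX'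
    (hf.continuousOn.mono hSΩ) ?_ (hyc.mono inter_subset_right) (hyinj.mono inter_subset_right)
  rintro ⟨x, u⟩ ⟨⟨hx, hu⟩, -⟩
  -- The increment due to the control lies in the first distribution, which `φ'` sends into `R`; the
  -- drift itself is linear modulo `R`.
  have h1 : fderiv ℝ φ x (f (x, u) - f (x, u₀)) ∈ R := hφR x hx _
    (apply_eq_of_genRange hk hΩ hf hXU hU hD Metric.isOpen_ball
      (convex_ball u₀ ε).isPreconnected hball (Metric.mem_ball_self hε) (hX'X hx) hu)
  have h2 : fderiv ℝ φ x (f (x, u₀)) - A (φ x) ∈ R := by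
    have h3 := sub_eq_iff_eq_add'.mpr (hφF x hx)
    rw [h3]
    exact (Q _).2
  have h4 := R.add_mem h1 h2
  rw [map_sub, sub_add_sub_cancel] at h4
  exact h4

/-! ### The infinitesimal form of a conjugacy -/

/-- Classical solutions with constant control are solutions. -/
theorem isSolution_of_hasDerivAt {n m : ℕ} {g : Vec n × Vec m → Vec n} {Ω : Set (Vec n × Vec m)}
    {I : Set ℝ} (hI : I.OrdConnected) {z : ℝ → Vec n} {v : Vec m} {δ : ℝ → Vec n × Vec m}
    (hg : Continuous g) (hz : ∀ t ∈ I, HasDerivAt z (g (z t, v)) t) (hΩ : ∀ t ∈ I, (z t, v) ∈ Ω)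
    (hδ : ∀ t ∈ I, δ t = (z t, v)) : IsSolution g Ω I δ := by
  have hzc : ContinuousOn z I := fun t ht => (hz t ht).continuousAt.continuousWithinAt
  have hδc : ContinuousOn δ I := (hzc.prodMk continuousOn_const).congr hδ
  refine ⟨fun t ht => hδ t ht ▸ hΩ t ht, hδc.aemeasurable hI.measurableSet, fun a b hab =>
    (isCompact_Icc.image_of_continuousOn (hδc.mono hab)).isBounded, fun a b hab hab' => ?_,
    fun a b hab hab' => ?_⟩
  · obtain ⟨C, hC⟩ := isCompact_Icc.exists_bound_of_continuousOn
      (hg.comp_continuousOn (hδc.mono hab'))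
    have hlip : LipschitzOnWith C.toNNReal z (Icc a b) := by
      refine (convex_Icc a b).lipschitzOnWith_of_nnnorm_hasDerivWithin_le
        (fun t ht => (hz t (hab' ht)).hasDerivWithinAt) fun t ht => ?_
      rw [← NNReal.coe_le_coe, coe_nnnorm]
      refine le_trans ?_ (Real.le_coe_toNNReal C)
      have := hC t ht
      rwa [Function.comp_apply, hδ t (hab' ht)] at this
    refine LipschitzOnWith.absolutelyContinuousOnInterval (K := C.toNNReal) ?_
    rw [uIcc_of_le hab]
    intro s hs t ht
    simp only [hδ s (hab' hs), hδ t (hab' ht)]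
    exact hlip hs ht
  · have hint : IntervalIntegrable (fun t => g (δ t)) volume a b := by
      refine ContinuousOn.intervalIntegrable ?_
      rw [uIcc_of_le hab]
      exact hg.comp_continuousOn (hδc.mono hab')
    refine ⟨hint, ?_⟩
    rw [intervalIntegral.integral_eq_sub_of_hasDerivAt (f := z) (fun t ht => ?_) hint,
      hδ a (hab' (left_mem_Icc.mpr hab)), hδ b (hab' (right_mem_Icc.mpr hab))]
    rw [uIcc_of_le hab] at ht
    rw [hδ t (hab' ht)]
    exact hz t (hab' ht)

/-- A continuous solution is differentiable. -/
theorem IsSolution.hasDerivAt_of_continuousOn {n m : ℕ} {f : Vec n × Vec m → Vec n}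
    {Ω : Set (Vec n × Vec m)} {I : Set ℝ} (hIo : IsOpen I) (hI : I.OrdConnected)
    {γ : ℝ → Vec n × Vec m} (hγ : IsSolution f Ω I γ) (hc : ContinuousOn (fun t => f (γ t)) I)
    {t₀ : ℝ} (ht₀ : t₀ ∈ I) : HasDerivAt (fun t => (γ t).1) (f (γ t₀)) t₀ := by
  have h1 := intervalIntegral.integral_hasDerivAt_right (a := t₀) (b := t₀)
    (f := fun t => f (γ t)) IntervalIntegrable.refl (hc.stronglyMeasurableAtFilter hIo t₀ ht₀)
    (hc.continuousAt (hIo.mem_nhds ht₀))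
  refine (h1.const_add (γ t₀).1).congr_of_eventuallyEq ?_
  filter_upwards [hIo.mem_nhds ht₀] with t ht
  rcases le_total t₀ t with h | h
  · rw [← (hγ.integralEq t₀ t h (hI.out ht₀ ht)).2]
    simp
  · rw [intervalIntegral.integral_symm, ← (hγ.integralEq t t₀ h (hI.out ht ht₀)).2]
    simp

/-- The linear system has a classical trajectory through `χ p` with constant control. Its pullback
by `χ` is a continuous solution, hence differentiable, and comparing velocities at time `0` through
`φ` gives the identity. -/
theorem fderiv_eq_of_conjugates {n m : ℕ} {f : Vec n × Vec m → Vec n}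
    {A : Matrix (Fin n) (Fin n) ℝ} {B : Matrix (Fin n) (Fin m) ℝ}
    {χ : OpenPartialHomeomorph (Vec n × Vec m) (Vec n × Vec m)}
    (hfc : ContinuousOn f χ.source) (hconj : Conjugates f (linearRHS A B) χ)
    {φ : Vec n → Vec n} (hχφ : ∀ p ∈ χ.source, (χ p).1 = φ p.1) {p : Vec n × Vec m}
    (hp : p ∈ χ.source) (hφ : DifferentiableAt ℝ φ p.1) :
    fderiv ℝ φ p.1 (f p) = linearRHS A B (χ p) := by
  set q := χ p with hq
  have hqt : q ∈ χ.target := χ.map_source hp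
  have hgc : ContDiff ℝ 1 fun z => linearRHS A B (z, q.2) :=
    (LinearMap.toContinuousLinearMap (Matrix.toEuclideanLin A)).contDiff.add
      (contDiff_const (c := Matrix.toEuclideanLin B q.2))
  obtain ⟨z, hz0, ε, hε, hz⟩ :=
    hgc.contDiffAt.exists_forall_mem_closedBall_exists_eq_forall_mem_Ioo_hasDerivAt₀
      (x₀ := q.1) 0
  have hzc : ContinuousAt (fun t => (z t, q.2)) 0 :=
    ((hz 0 (by constructor <;> linarith)).continuousAt).prodMk continuousAt_const
  have hz0' : (z 0, q.2) = q := by rw [hz0]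
  have hev : ∀ᶠ t in 𝓝 0, (z t, q.2) ∈ χ.target :=
    hzc.eventually_mem (χ.open_target.mem_nhds (hz0' ▸ hqt))
  obtain ⟨ρ, hρ, hball⟩ := Metric.eventually_nhds_iff.mp hev
  set I := Ioo (-(min ε ρ)) (min ε ρ) with hI
  have h0I : (0 : ℝ) ∈ I := by
    have := lt_min hε hρ
    exact ⟨by linarith, this⟩
  have hIz : ∀ t ∈ I, HasDerivAt z (linearRHS A B (z t, q.2)) t := fun t ht =>
    hz t ⟨by linarith [ht.1, min_le_left ε ρ], by linarith [ht.2, min_le_left ε ρ]⟩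
  have hIt : ∀ t ∈ I, (z t, q.2) ∈ χ.target := fun t ht => hball (by
    rw [Real.dist_eq, sub_zero, abs_lt]
    exact ⟨by linarith [ht.1, min_le_right ε ρ], by linarith [ht.2, min_le_right ε ρ]⟩)
  have hsol := (hconj I ordConnected_Ioo (fun t => χ.symm (z t, q.2))
    fun t ht => χ.map_target (hIt t ht)).mpr
    (isSolution_of_hasDerivAt ordConnected_Ioo (continuous_linearRHS A B) hIz hIt
      fun t ht => χ.right_inv (hIt t ht))
  have hcont : ContinuousOn (fun t => χ.symm (z t, q.2)) I :=
    χ.continuousOn_symm.comp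
      (ContinuousOn.prodMk (fun t ht => (hIz t ht).continuousAt.continuousWithinAt)
        continuousOn_const) hIt
  have h1 := hsol.hasDerivAt_of_continuousOn isOpen_Ioo ordConnected_Ioo
    (hfc.comp hcont fun t ht => χ.map_target (hIt t ht)) h0I
  have hp0 : χ.symm (z 0, q.2) = p := by rw [hz0', hq, χ.left_inv hp]
  simp only [hp0] at h1
  have h2 : HasFDerivAt φ (fderiv ℝ φ p.1) ((fun t => (χ.symm (z t, q.2)).1) 0) := by
    simp only [hp0]
    exact hφ.hasFDerivAt
  have h3 := h2.comp_hasDerivAt (0 : ℝ) h1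
  have h4 : HasDerivAt z (fderiv ℝ φ p.1 (f p)) 0 := by
    refine h3.congr_of_eventuallyEq ?_
    filter_upwards [isOpen_Ioo.mem_nhds h0I] with t ht
    change z t = φ _
    rw [← hχφ _ (χ.map_target (hIt t ht)), χ.right_inv (hIt t ht)]
  rw [h4.unique (hIz 0 h0I), hz0']

/-- The differential of a diffeomorphism is invertible. -/
theorem exists_continuousLinearEquiv_fderiv {E : Type*} [NormedAddCommGroup E] [NormedSpace ℝ E]
    {φ : OpenPartialHomeomorph E E} (hφ : DifferentiableOn ℝ φ φ.source)
    (hφ' : DifferentiableOn ℝ φ.symm φ.target) {x : E} (hx : x ∈ φ.source) :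
    ∃ e : E ≃L[ℝ] E, (e : E →L[ℝ] E) = fderiv ℝ φ x ∧
      (e.symm : E →L[ℝ] E) = fderiv ℝ φ.symm (φ x) := by
  have h1 : HasFDerivAt φ (fderiv ℝ φ x) x :=
    (hφ.differentiableAt (φ.open_source.mem_nhds hx)).hasFDerivAt
  have h2 : HasFDerivAt φ.symm (fderiv ℝ φ.symm (φ x)) (φ x) :=
    (hφ'.differentiableAt (φ.open_target.mem_nhds (φ.map_source hx))).hasFDerivAt
  have h3 : (fderiv ℝ φ.symm (φ x)).comp (fderiv ℝ φ x) = ContinuousLinearMap.id ℝ E := by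
    refine (h2.comp x h1).unique ((hasFDerivAt_id x).congr_of_eventuallyEq ?_)
    filter_upwards [φ.open_source.mem_nhds hx] with y hy
    exact φ.left_inv hy
  have h4 : (fderiv ℝ φ x).comp (fderiv ℝ φ.symm (φ x)) = ContinuousLinearMap.id ℝ E := by
    have h1' : HasFDerivAt φ (fderiv ℝ φ x) (φ.symm (φ x)) := by rwa [φ.left_inv hx]
    refine (h1'.comp (φ x) h2).unique ((hasFDerivAt_id (φ x)).congr_of_eventuallyEq ?_)
    filter_upwards [φ.open_target.mem_nhds (φ.map_source hx)] with y hy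
    exact φ.right_inv hy
  exact ⟨ContinuousLinearEquiv.equivOfInverse _ _
    (fun v => congrArg (fun l : E →L[ℝ] E => l v) h3)
    (fun v => congrArg (fun l : E →L[ℝ] E => l v) h4), rfl, rfl⟩

/-- The generalized range of a system which is conjugate to a linear one. -/
theorem genRange_eq_comap {n m : ℕ} {f : Vec n × Vec m → Vec n}
    {A : Matrix (Fin n) (Fin n) ℝ} {B : Matrix (Fin n) (Fin m) ℝ}
    {χ : OpenPartialHomeomorph (Vec n × Vec m) (Vec n × Vec m)} {φ : Vec n → Vec n}
    (hχφ : ∀ p ∈ χ.source, (χ p).1 = φ p.1) (hφi : InjOn φ (Prod.fst '' χ.source))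
    (hD : ∀ p ∈ χ.source, fderiv ℝ φ p.1 (f p) = linearRHS A B (χ p))
    {x : Vec n} {u : Vec m} {U : Set (Vec m)} (hU : IsOpen U) (hu : u ∈ U)
    (hxU : ∀ w ∈ U, (x, w) ∈ χ.source) (e : Vec n ≃L[ℝ] Vec n)
    (he : (e : Vec n →L[ℝ] Vec n) = fderiv ℝ φ x) :
    genRange f U x u = (LinearMap.range (Matrix.toEuclideanLin B)).comap
      (fderiv ℝ φ x : Vec n →ₗ[ℝ] Vec n) := by
  have hfe : ∀ w ∈ U, fderiv ℝ φ x (f (x, w) - f (x, u)) =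
      Matrix.toEuclideanLin B ((χ (x, w)).2 - (χ (x, u)).2) := by
    intro w hw
    have h1 := hD _ (hxU w hw)
    have h2 := hD _ (hxU u hu)
    simp only [linearRHS, hχφ _ (hxU w hw), hχφ _ (hxU u hu)] at h1 h2
    rw [map_sub, h1, h2, map_sub, add_sub_add_left_eq_sub]
  refine le_antisymm (Submodule.span_le.mpr ?_) ?_
  · rintro y ⟨w, hwU, -, -, hy⟩
    refine (Submodule.closed_of_finiteDimensional _).mem_of_tendsto hy
      (Eventually.of_forall fun i => Submodule.smul_mem _ _ ?_)
    exact ⟨_, (hfe (w i) (hwU i)).symm⟩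
  · rintro y ⟨v, hv⟩
    rcases eq_or_ne y 0 with rfl | hy
    · exact Submodule.zero_mem _
    have hev : e y = Matrix.toEuclideanLin B v := by
      rw [hv, ← he]; rfl
    -- The new control moves along the straight line of direction `v` with the state fixed. Pulled
    -- back, the increment of `f` is exactly `t • y`, so `y / ‖y‖` is a limit direction.
    set q : ℝ → Vec n × Vec m := fun t => (φ x, (χ (x, u)).2 + t • v) with hq
    have hq0 : q 0 = χ (x, u) := by
      refine Prod.ext ?_ (by simp [hq])
      exact (hχφ _ (hxU u hu)).symm
    have hqc : Continuous q := by fun_prop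
    have hqt : ∀ᶠ t in 𝓝 0, q t ∈ χ.target := hqc.continuousAt.eventually_mem
      (χ.open_target.mem_nhds (hq0 ▸ χ.map_source (hxU u hu)))
    have hsq : Tendsto (fun t => (χ.symm (q t)).2) (𝓝 0) (𝓝 u) := by
      have h1 : ContinuousAt χ.symm (q 0) :=
        χ.symm.continuousAt (hq0 ▸ χ.map_source (hxU u hu))
      have h2 := (h1.comp (f := q) hqc.continuousAt).snd
      have h3 : ((χ.symm ∘ q) 0).2 = u := by
        rw [Function.comp_apply, hq0, χ.left_inv (hxU u hu)]
      rw [ContinuousAt, h3] at h2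
      exact h2
    have hfst : ∀ t, q t ∈ χ.target → (χ.symm (q t)).1 = x := by
      intro t ht
      refine hφi ⟨_, χ.map_target ht, rfl⟩ ⟨_, hxU u hu, rfl⟩ ?_
      rw [← hχφ _ (χ.map_target ht), χ.right_inv ht]
    have hdiff : ∀ t, q t ∈ χ.target → (χ.symm (q t)).2 ∈ U →
        f (x, (χ.symm (q t)).2) - f (x, u) = t • y := by
      intro t ht htU
      have h4 : (x, (χ.symm (q t)).2) = χ.symm (q t) := Prod.ext (hfst t ht).symm rfl
      have h5 := hfe _ htU
      rw [h4, χ.right_inv ht, ← he] at h5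
      apply e.injective
      rw [h4, map_smul, hev]
      refine h5.trans ?_
      simp [hq]
    obtain ⟨ρ, hρ, hball⟩ := Metric.eventually_nhds_iff.mp
      (hqt.and (hsq.eventually_mem (hU.mem_nhds hu)))
    set t : ℕ → ℝ := fun i => ρ / 2 / ((i : ℝ) + 1) with ht
    have ht0 : ∀ i, 0 < t i := fun i => by positivity
    have htρ : ∀ i, dist (t i) 0 < ρ := by
      intro i
      rw [Real.dist_eq, sub_zero, abs_of_pos (ht0 i)]
      have h6 : t i ≤ ρ / 2 := div_le_self (by positivity) (by linarith [i.cast_nonneg (α := ℝ)])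
      linarith
    have htt : Tendsto t atTop (𝓝 0) := by
      have := (tendsto_one_div_add_atTop_nhds_zero_nat (𝕜 := ℝ)).const_mul (ρ / 2)
      rw [mul_zero] at this
      exact this.congr fun i => by rw [ht]; ring
    have hdi : ∀ i, f (x, (χ.symm (q (t i))).2) - f (x, u) = t i • y := fun i =>
      hdiff _ (hball (htρ i)).1 (hball (htρ i)).2
    have hmem : ‖y‖⁻¹ • y ∈ limitDirections f U x u := by
      refine ⟨fun i => (χ.symm (q (t i))).2, fun i => (hball (htρ i)).2, fun i => ?_,
        hsq.comp htt, ?_⟩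
      · rw [← sub_ne_zero, hdi]
        exact smul_ne_zero (ht0 i).ne' hy
      · refine tendsto_const_nhds.congr fun i => ?_
        rw [hdi, norm_smul, Real.norm_of_nonneg (ht0 i).le, smul_smul, mul_inv, mul_assoc,
          mul_comm, mul_assoc, mul_inv_cancel₀ (ht0 i).ne', mul_one]
    have h2 := Submodule.smul_mem (genRange f U x u) ‖y‖ (Submodule.subset_span hmem)
    rwa [smul_smul, mul_inv_cancel₀ (norm_ne_zero_iff.mpr hy), one_smul] at h2

/-! ### The flag of a linearizable system -/

theorem finrank_comap_fderiv {n : ℕ} {L : Vec n →L[ℝ] Vec n} (e : Vec n ≃L[ℝ] Vec n)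
    (he : (e : Vec n →L[ℝ] Vec n) = L) (E : Submodule ℝ (Vec n)) :
    Module.finrank ℝ (E.comap (L : Vec n →ₗ[ℝ] Vec n)) = Module.finrank ℝ E := by
  have h1 : E.comap ((e : Vec n →L[ℝ] Vec n) : Vec n →ₗ[ℝ] Vec n) =
      E.map (e.symm.toLinearEquiv : Vec n →ₗ[ℝ] Vec n) :=
    (Submodule.map_equiv_eq_comap_symm e.symm.toLinearEquiv E).symm
  rw [← he, h1]
  exact LinearEquiv.finrank_map_eq e.symm.toLinearEquiv E

/-- The derivative of a map with values in a subspace takes its values there. -/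
theorem fderiv_mem_of_eventually_mem {E : Type*} [NormedAddCommGroup E] [NormedSpace ℝ E] {n : ℕ}
    {D : Submodule ℝ (Vec n)} {h : E → Vec n} {x : E} (hh : ∀ᶠ y in 𝓝 x, h y ∈ D) (v : E) :
    fderiv ℝ h x v ∈ D := by
  by_cases hd : DifferentiableAt ℝ h x
  · refine Vec.mem_of_forms fun l hl => ?_
    have h1 := l.hasFDerivAt.comp x hd.hasFDerivAt
    have h2 : HasFDerivAt (l ∘ h) (0 : E →L[ℝ] ℝ) x := by
      refine (hasFDerivAt_const (0 : ℝ) x).congr_of_eventuallyEq ?_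
      filter_upwards [hh] with y hy
      exact hl _ hy
    exact congrArg (fun l : E →L[ℝ] ℝ => l v) (h1.unique h2)
  · rw [fderiv_zero_of_not_differentiableAt hd]
    exact D.zero_mem

section

variable {n : ℕ} {k : WithTop ℕ∞} {X V : Set (Vec n)} {φ : Vec n → Vec n}

theorem fderiv_apply_lieBracket_of_contDiffOn (hk : k = ∞ ∨ k = ω) (hV : IsOpen V)
    (hφ : ContDiffOn ℝ k φ V) {Y Z : Vec n → Vec n} (hY : ContDiffOn ℝ k Y V)
    (hZ : ContDiffOn ℝ k Z V) {x : Vec n} (hx : x ∈ V) :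
    fderiv ℝ φ x (VectorField.lieBracket ℝ Y Z x) =
      fderiv ℝ (fun y => fderiv ℝ φ y (Z y)) x (Y x) -
        fderiv ℝ (fun y => fderiv ℝ φ y (Y y)) x (Z x) := by
  have hk0 : k ≠ 0 := (zero_lt_one.trans_le (one_le_of_smooth_or_analytic hk)).ne'
  refine VectorField.fderiv_apply_lieBracket (hφ.contDiffAt (hV.mem_nhds hx)) ?_
    ((hZ.contDiffAt (hV.mem_nhds hx)).differentiableAt hk0)
    ((hY.contDiffAt (hV.mem_nhds hx)).differentiableAt hk0)
  rw [minSmoothness_of_isRCLikeNormedField]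
  exact two_le_of_smooth_or_analytic hk

/-- The inverse image of a constant distribution under a diffeomorphism is integrable. -/
theorem isIntegrable_of_eq_comap (hk : k = ∞ ∨ k = ω) (hφ : ContDiffOn ℝ k φ X)
    (hφe : ∀ x ∈ X, ∃ e : Vec n ≃L[ℝ] Vec n, (e : Vec n →L[ℝ] Vec n) = fderiv ℝ φ x)
    {E : Submodule ℝ (Vec n)} {Δ : Vec n → Submodule ℝ (Vec n)}
    (hΔ : ∀ x ∈ X, Δ x = E.comap (fderiv ℝ φ x : Vec n →ₗ[ℝ] Vec n)) : IsIntegrable k X Δ := by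
  refine ⟨⟨Module.finrank ℝ E, fun x hx => ?_⟩, fun V Y Z hVX hY hZ x hx => ?_⟩
  · obtain ⟨e, he⟩ := hφe x hx
    rw [hΔ x hx, finrank_comap_fderiv e he]
  · have hmem : ∀ {Y}, IsSection k Δ V Y → ∀ᶠ y in 𝓝 x, fderiv ℝ φ y (Y y) ∈ E := by
      intro Y hY
      filter_upwards [hY.1.mem_nhds hx] with y hy
      have := hY.2.2 y hy
      rwa [hΔ y (hVX hy)] at this
    rw [hΔ x (hVX hx)]
    change fderiv ℝ φ x _ ∈ E
    -- The image of the bracket is a difference of derivatives of maps with values in the fixed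
    -- subspace `E`.
    rw [fderiv_apply_lieBracket_of_contDiffOn hk hY.1 (hφ.mono hVX) hY.2.1 hZ.2.1 hx]
    exact E.sub_mem (fderiv_mem_of_eventually_mem (hmem hZ) _)
      (fderiv_mem_of_eventually_mem (hmem hY) _)

end

/-- The distribution `Δ + [F, Δ]` when, in some coordinates, `Δ` is constant and `F` is linear
up to an element of a constant subspace. -/
theorem addBracket_eq_comap {n : ℕ} {k : WithTop ℕ∞} (hk : k = ∞ ∨ k = ω) {X : Set (Vec n)}
    (hX : IsOpen X) {φ : OpenPartialHomeomorph (Vec n) (Vec n)} (hφ : ContDiffOn ℝ k φ φ.source)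
    (hφ' : ContDiffOn ℝ k φ.symm φ.target) (hXφ : X ⊆ φ.source) {F : Vec n → Vec n}
    (hF : ContDiffOn ℝ k F X) {A : Vec n →ₗ[ℝ] Vec n} {R E : Submodule ℝ (Vec n)} (hRE : R ≤ E)
    (hFA : ∀ x ∈ X, fderiv ℝ φ x (F x) - A (φ x) ∈ R) {Δ : Vec n → Submodule ℝ (Vec n)}
    (hΔ : ∀ x ∈ X, Δ x = E.comap (fderiv ℝ φ x : Vec n →ₗ[ℝ] Vec n)) {x : Vec n} (hx : x ∈ X) :
    addBracket k X F Δ x = (E ⊔ E.map A).comap (fderiv ℝ φ x : Vec n →ₗ[ℝ] Vec n) := by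
  have hk0 : k ≠ 0 := (zero_lt_one.trans_le (one_le_of_smooth_or_analytic hk)).ne'
  have hk1 := add_one_le_of_smooth_or_analytic hk
  have hφX := hφ.mono hXφ
  have hφe : ∀ y ∈ X, ∃ e : Vec n ≃L[ℝ] Vec n, (e : Vec n →L[ℝ] Vec n) = fderiv ℝ φ y ∧
      (e.symm : Vec n →L[ℝ] Vec n) = fderiv ℝ φ.symm (φ y) := fun y hy =>
    exists_continuousLinearEquiv_fderiv (hφ.differentiableOn hk0) (hφ'.differentiableOn hk0)
      (hXφ hy)
  have hFd : fderiv ℝ (fun y => fderiv ℝ φ y (F y)) x =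
      (LinearMap.toContinuousLinearMap A).comp (fderiv ℝ φ x) +
        fderiv ℝ (fun y => fderiv ℝ φ y (F y) - A (φ y)) x := by
    have h1 : HasFDerivAt (fun y => A (φ y))
        ((LinearMap.toContinuousLinearMap A).comp (fderiv ℝ φ x)) x :=
      (LinearMap.toContinuousLinearMap A).hasFDerivAt.comp x
        ((hφX.contDiffAt (hX.mem_nhds hx)).differentiableAt hk0).hasFDerivAt
    have h2 : DifferentiableAt ℝ (fun y => fderiv ℝ φ y (F y)) x :=
      ((((hφX.fderiv_of_isOpen hX hk1).clm_apply hF).contDiffAt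
        (hX.mem_nhds hx)).differentiableAt hk0)
    have h3 : fderiv ℝ (fun y => fderiv ℝ φ y (F y) - A (φ y)) x = _ :=
      (h2.hasFDerivAt.sub h1).fderiv
    rw [h3, add_sub_cancel]
  have hb : ∀ v, fderiv ℝ (fun y => fderiv ℝ φ y (F y) - A (φ y)) x v ∈ E := fun v =>
    hRE (fderiv_mem_of_eventually_mem
      ((eventually_of_mem (hX.mem_nhds hx)) fun y hy => hFA y hy) v)
  -- The remainder of the drift has values in `R ≤ E`, and so have its derivatives; they are
  -- collected in `w`.
  have hbr : ∀ {V Y}, V ⊆ X → x ∈ V → IsSection k Δ V Y →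
      ∃ w ∈ E, fderiv ℝ φ x (VectorField.lieBracket ℝ F Y x) =
        fderiv ℝ (fun y => fderiv ℝ φ y (Y y)) x (F x) - A (fderiv ℝ φ x (Y x)) - w := by
    intro V Y hV hxV hY
    refine ⟨_, hb (Y x), ?_⟩
    rw [fderiv_apply_lieBracket_of_contDiffOn hk hY.1 (hφX.mono hV) (hF.mono hV) hY.2.1 hxV, hFd]
    simp [sub_sub]
  refine le_antisymm (sup_le ?_ (Submodule.span_le.mpr ?_)) ?_
  · rw [hΔ x hx]
    exact Submodule.comap_mono le_sup_left
  · rintro _ ⟨V, Y, hV, hxV, hY, rfl⟩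
    obtain ⟨w, hw, hbw⟩ := hbr hV hxV hY
    have hYE : ∀ᶠ y in 𝓝 x, fderiv ℝ φ y (Y y) ∈ E := by
      filter_upwards [hY.1.mem_nhds hxV] with y hy
      have := hY.2.2 y hy
      rwa [hΔ y (hV hy)] at this
    change fderiv ℝ φ x _ ∈ E ⊔ E.map A
    rw [hbw]
    exact Submodule.sub_mem _ (Submodule.sub_mem _
      (Submodule.mem_sup_left (fderiv_mem_of_eventually_mem hYE _))
      (Submodule.mem_sup_right (Submodule.mem_map_of_mem hYE.self_of_nhds)))
      (Submodule.mem_sup_left hw)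
  · obtain ⟨e, he, -⟩ := hφe x hx
    have hE : ∀ w ∈ E, e.symm w ∈ addBracket k X F Δ x := by
      intro w hw
      refine Submodule.mem_sup_left ?_
      rw [hΔ x hx, ← he]
      simpa using hw
    intro v hv
    obtain ⟨a, ha, _, ⟨c, hc, rfl⟩, hac⟩ := Submodule.mem_sup.mp (Submodule.mem_comap.mp hv)
    have hv' : v = e.symm a + e.symm (A c) := by
      rw [← map_add, hac, ← he]
      simp
    rw [hv']
    refine Submodule.add_mem _ (hE a ha) ?_
    -- The field that is constant equal to `c` in the coordinates; its bracket with the drift is `-A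
    -- c` modulo `E`, which produces the image of `A`.
    set Y : Vec n → Vec n := fun y => fderiv ℝ φ.symm (φ y) c with hY
    have hYc : ∀ y ∈ X, fderiv ℝ φ y (Y y) = c := by
      intro y hy
      obtain ⟨e', he', hes'⟩ := hφe y hy
      change fderiv ℝ φ y (fderiv ℝ φ.symm (φ y) c) = c
      rw [← he', ← hes']
      simp
    have hYs : IsSection k Δ X Y := by
      refine ⟨hX, ?_, fun y hy => ?_⟩
      · exact ((hφ'.fderiv_of_isOpen φ.open_target hk1).comp hφX fun y hy =>
          φ.map_source (hXφ hy)).clm_apply contDiffOn_const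
      · rw [hΔ y hy]
        change fderiv ℝ φ y (Y y) ∈ E
        rw [hYc y hy]
        exact hc
    obtain ⟨w, hw, hbw⟩ := hbr le_rfl hx hYs
    have h0 : fderiv ℝ (fun y => fderiv ℝ φ y (Y y)) x = 0 := by
      have h3 : (fun y => fderiv ℝ φ y (Y y)) =ᶠ[𝓝 x] fun _ => c := by
        filter_upwards [hX.mem_nhds hx] with y hy
        exact hYc y hy
      rw [h3.fderiv_eq]
      simp
    have h4 : e.symm (A c) = -(VectorField.lieBracket ℝ F Y x) - e.symm w := by
      apply e.injective
      have h5 : e (VectorField.lieBracket ℝ F Y x) = - A c - w := by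
        have h6 : e (VectorField.lieBracket ℝ F Y x) =
            fderiv ℝ φ x (VectorField.lieBracket ℝ F Y x) := by rw [← he]; rfl
        rw [h6, hbw, h0, hYc x hx]
        simp
      rw [map_sub, map_neg, h5]
      simp
    rw [h4]
    exact Submodule.sub_mem _ (Submodule.neg_mem _ (lieBracket_mem_addBracket le_rfl hx hYs))
      (hE w hw)

/-- The subspaces `Im B + A Im B + ⋯ + A^j Im B`. -/
def reachable {n m : ℕ} (A : Matrix (Fin n) (Fin n) ℝ) (B : Matrix (Fin n) (Fin m) ℝ) :
    ℕ → Submodule ℝ (Vec n)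
  | 0 => LinearMap.range (Matrix.toEuclideanLin B)
  | j + 1 => reachable A B j ⊔ (reachable A B j).map (Matrix.toEuclideanLin A)

theorem range_le_reachable {n m : ℕ} (A : Matrix (Fin n) (Fin n) ℝ) (B : Matrix (Fin n) (Fin m) ℝ)
    (j : ℕ) : LinearMap.range (Matrix.toEuclideanLin B) ≤ reachable A B j := by
  induction j with
  | zero => exact le_rfl
  | succ j ih => exact ih.trans le_sup_left

theorem pow_mem_reachable {n m : ℕ} (A : Matrix (Fin n) (Fin n) ℝ) (B : Matrix (Fin n) (Fin m) ℝ)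
    (u : Vec m) {i j : ℕ} (hij : i ≤ j) :
    (Matrix.toEuclideanLin A ^ i) (Matrix.toEuclideanLin B u) ∈ reachable A B j := by
  induction j generalizing i with
  | zero =>
    obtain rfl : i = 0 := by omega
    exact ⟨u, rfl⟩
  | succ j ih =>
    rcases i with _ | i
    · exact range_le_reachable A B _ ⟨u, rfl⟩
    · rw [pow_succ']
      exact Submodule.mem_sup_right ⟨_, ih (by omega), rfl⟩

theorem reachable_eq_top {n m : ℕ} {A : Matrix (Fin n) (Fin n) ℝ} {B : Matrix (Fin n) (Fin m) ℝ}
    (h : IsControllable A B) : reachable A B (n - 1) = ⊤ := by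
  rw [eq_top_iff]
  intro v _
  refine Vec.mem_of_forms fun l hl => ?_
  rw [isControllable_iff.mp h l fun j hj u => hl _ (pow_mem_reachable A B u (by omega))]
  rfl

/-! ### The fibration of a linearizable system -/

theorem isC0Fibration_of_homeomorph {E B F : Type*} [TopologicalSpace E] [TopologicalSpace B]
    [TopologicalSpace F] {g : E → B} (ψ : E ≃ₜ B × F) (hψ : ∀ p, (ψ p).1 = g p) :
    IsC0Fibration F g := by
  refine ⟨(continuous_fst.comp ψ.continuous).congr hψ, fun ξ => ⟨univ, univ_mem,
    ((Homeomorph.setCongr preimage_univ).trans (Homeomorph.Set.univ E)).trans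
      (ψ.trans ((Homeomorph.Set.univ B).symm.prodCongr (Homeomorph.refl F))), fun p => hψ p⟩⟩

/-- A map is a fibration with fiber a normed space when a complementary coordinate takes its
values in a ball, and every pair of values is attained, continuously. -/
theorem isC0Fibration_of_section {E B F : Type*} [TopologicalSpace E] [TopologicalSpace B]
    [NormedAddCommGroup F] [InnerProductSpace ℝ F] {W : Set E} {G : E → B} (hG : ContinuousOn G W)
    {κ : E → F} (hκ : ContinuousOn κ W) {c : F} {r : ℝ} (hr : 0 < r)
    (hκr : MapsTo κ W (Metric.ball c r)) {s : B × F → E}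
    (hs : ContinuousOn s ((G '' W) ×ˢ Metric.ball c r))
    (hsW : ∀ ξ ∈ G '' W, ∀ a ∈ Metric.ball c r, s (ξ, a) ∈ W)
    (hGs : ∀ ξ ∈ G '' W, ∀ a ∈ Metric.ball c r, G (s (ξ, a)) = ξ)
    (hκs : ∀ ξ ∈ G '' W, ∀ a ∈ Metric.ball c r, κ (s (ξ, a)) = a)
    (hsG : ∀ p ∈ W, s (G p, κ p) = p) : IsC0Fibration F (imageFactorization G W) := by
  -- The fibers are balls; a homeomorphism from the whole space onto the ball converts them to the
  -- required model.
  set ub := OpenPartialHomeomorph.univBall c r with hub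
  have hubs : ∀ a, ub a ∈ Metric.ball c r := fun a => by
    rw [← OpenPartialHomeomorph.univBall_target c hr]
    exact ub.map_source (by simp [hub])
  have hur : ∀ a ∈ Metric.ball c r, ub (ub.symm a) = a := fun a ha =>
    ub.right_inv (by rwa [hub, OpenPartialHomeomorph.univBall_target c hr])
  have hul : ∀ a, ub.symm (ub a) = a := fun a => ub.left_inv (by simp [hub])
  refine isC0Fibration_of_homeomorph (ψ :=
    { toFun := fun p => (imageFactorization G W p, ub.symm (κ p))
      invFun := fun q => ⟨s (q.1, ub q.2), hsW _ q.1.2 _ (hubs q.2)⟩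
      left_inv := fun p => Subtype.ext ?_
      right_inv := fun q => Prod.ext (Subtype.ext ?_) ?_
      continuous_toFun := ?_
      continuous_invFun := ?_ }) fun p => rfl
  · change s (G p, ub (ub.symm (κ p))) = p
    rw [hur _ (hκr p.2), hsG _ p.2]
  · exact hGs _ q.1.2 _ (hubs q.2)
  · change ub.symm (κ (s (q.1, ub q.2))) = q.2
    rw [hκs _ q.1.2 _ (hubs q.2), hul]
  · refine Continuous.prodMk ((continuousOn_iff_continuous_domRestrict.mp hG).subtype_mk _) ?_
    exact (OpenPartialHomeomorph.continuousOn_univBall_symm c r).comp_continuous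
      (continuousOn_iff_continuous_domRestrict.mp hκ) fun p => hκr p.2
  · refine Continuous.subtype_mk ?_ _
    exact hs.comp_continuous ((continuous_subtype_val.comp continuous_fst).prodMk
      ((OpenPartialHomeomorph.continuous_univBall c r).comp continuous_snd))
      fun q => ⟨q.1.2, hubs q.2⟩

/-- A linear map is, up to an isomorphism, the projection onto its range. -/
theorem exists_equiv_range_prod {n m : ℕ} (B : Vec m →ₗ[ℝ] Vec n) :
    ∃ e : Vec m ≃L[ℝ] LinearMap.range B × Vec (m - Module.finrank ℝ (LinearMap.range B)),
      ∀ v, ((e v).1 : Vec n) = B v := by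
  obtain ⟨q, hq⟩ := (LinearMap.ker B).exists_isCompl
  set e₀ := LinearMap.equivProdOfSurjectiveOfIsCompl B.rangeRestrict
    ((LinearMap.ker B).projectionOnto q hq) B.range_rangeRestrict
    (Submodule.range_projectionOnto hq) (by
      rw [LinearMap.ker_rangeRestrict, Submodule.ker_projectionOnto]; exact hq)
  have hdim : Module.finrank ℝ (LinearMap.ker B) =
      Module.finrank ℝ (Vec (m - Module.finrank ℝ (LinearMap.range B))) := by
    have := B.finrank_range_add_finrank_ker
    simp only [finrank_euclideanSpace, Fintype.card_fin] at this ⊢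
    omega
  refine ⟨(e₀.trans ((LinearEquiv.refl ℝ _).prodCongr
    (LinearEquiv.ofFinrankEq _ _ hdim))).toContinuousLinearEquiv, fun v => rfl⟩

/-- Neighborhoods which are boxes in the target of a homeomorphism. -/
theorem exists_box {n m : ℕ} {T K : Type*} [NormedAddCommGroup T] [NormedSpace ℝ T]
    [NormedAddCommGroup K] [NormedSpace ℝ K]
    {χ : OpenPartialHomeomorph (Vec n × Vec m) (Vec n × Vec m)} {p₀ : Vec n × Vec m}
    (hp₀ : p₀ ∈ χ.source) {N : Set (Vec n × Vec m)} (hN : N ∈ 𝓝 p₀) (e : Vec m ≃L[ℝ] T × K) :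
    ∃ ε > 0, ∃ W ∈ 𝓝 p₀, W ⊆ N ∧
      (∀ p, p ∈ W ↔ p ∈ χ.source ∧ (χ p).1 ∈ Metric.ball (χ p₀).1 ε ∧
        (e (χ p).2).1 ∈ Metric.ball (e (χ p₀).2).1 ε ∧
        (e (χ p).2).2 ∈ Metric.ball (e (χ p₀).2).2 ε) ∧
      ∀ z ∈ Metric.ball (χ p₀).1 ε, ∀ b ∈ Metric.ball (e (χ p₀).2).1 ε,
        ∀ c ∈ Metric.ball (e (χ p₀).2).2 ε, (z, e.symm (b, c)) ∈ χ.target := by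
  set Ψ : Vec n × Vec m ≃ₜ Vec n × (T × K) :=
    (Homeomorph.refl (Vec n)).prodCongr e.toHomeomorph with hΨ
  have hT : ∀ᶠ q in 𝓝 (χ p₀), q ∈ χ.target ∧ χ.symm q ∈ N := by
    have h1 : ∀ᶠ q in 𝓝 (χ p₀), q ∈ χ.target := χ.open_target.mem_nhds (χ.map_source hp₀)
    refine h1.and ((χ.symm.continuousAt (χ.map_source hp₀)).eventually_mem ?_)
    rwa [χ.left_inv hp₀]
  have hT' : ∀ᶠ z in 𝓝 (Ψ (χ p₀)), Ψ.symm z ∈ χ.target ∧ χ.symm (Ψ.symm z) ∈ N := by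
    have h1 := Ψ.symm.continuous.tendsto (Ψ (χ p₀))
    rw [Ψ.symm_apply_apply] at h1
    exact h1.eventually hT
  obtain ⟨ε, hε, hball⟩ := Metric.eventually_nhds_iff_ball.mp hT'
  have hmem : ∀ z b c, (z, b, c) ∈ Metric.ball (Ψ (χ p₀)) ε ↔ z ∈ Metric.ball (χ p₀).1 ε ∧
      b ∈ Metric.ball (e (χ p₀).2).1 ε ∧ c ∈ Metric.ball (e (χ p₀).2).2 ε := by
    intro z b c
    have h1 : Metric.ball (Ψ (χ p₀)) ε = Metric.ball (χ p₀).1 ε ×ˢ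
        (Metric.ball (e (χ p₀).2).1 ε ×ˢ Metric.ball (e (χ p₀).2).2 ε) := by
      rw [ball_prod_same, ball_prod_same]
      rfl
    rw [h1, mem_prod, mem_prod]
  refine ⟨ε, hε, χ.source ∩ χ ⁻¹' (Ψ ⁻¹' Metric.ball (Ψ (χ p₀)) ε), ?_, ?_, ?_, ?_⟩
  · have h1 : Ψ (χ p₀) ∈ Metric.ball (Ψ (χ p₀)) ε := Metric.mem_ball_self hε
    exact (χ.continuousOn.isOpen_inter_preimage χ.open_source
      (Metric.isOpen_ball.preimage Ψ.continuous)).mem_nhds (mem_inter hp₀ h1)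
  · rintro p ⟨hp, h1⟩
    have h2 := (hball _ h1).2
    rwa [Ψ.symm_apply_apply, χ.left_inv hp] at h2
  · exact fun p => and_congr_right fun _ => hmem (χ p).1 (e (χ p).2).1 (e (χ p).2).2
  · exact fun z hz b hb c hc => (hball _ ((hmem z b c).mpr ⟨hz, hb, hc⟩)).1

/-- In linearizing coordinates `(x, f (x, u))` determines exactly the state and the component of the
control in `R`; the component in `Vec r` is free. On a neighborhood that is a box in these
coordinates, each fiber is a full ball in this last component. -/
theorem exists_isC0Fibration_of_conjugates {n m : ℕ} {f : Vec n × Vec m → Vec n}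
    {A : Matrix (Fin n) (Fin n) ℝ} {B : Matrix (Fin n) (Fin m) ℝ}
    {χ : OpenPartialHomeomorph (Vec n × Vec m) (Vec n × Vec m)}
    {φ : OpenPartialHomeomorph (Vec n) (Vec n)} (hs : φ.source = Prod.fst '' χ.source)
    (hφ : ContDiffOn ℝ 1 φ φ.source) (hφ' : ContDiffOn ℝ 1 φ.symm φ.target)
    (hfc : ContinuousOn f χ.source) (hχφ : ∀ p ∈ χ.source, (χ p).1 = φ p.1)
    (hD : ∀ p ∈ χ.source, fderiv ℝ φ p.1 (f p) = linearRHS A B (χ p)) {p₀ : Vec n × Vec m}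
    (hp₀ : p₀ ∈ χ.source) {N : Set (Vec n × Vec m)} (hN : N ∈ 𝓝 p₀) {R : Submodule ℝ (Vec n)}
    {r : ℕ} (e : Vec m ≃L[ℝ] R × Vec r) (he : ∀ v, ((e v).1 : Vec n) = Matrix.toEuclideanLin B v) :
    ∃ W ∈ 𝓝 p₀, W ⊆ N ∧ IsC0Fibration (Vec r)
      (imageFactorization (fun p : Vec n × Vec m => (p.1, f p)) W) := by
  have hsx : ∀ p ∈ χ.source, p.1 ∈ φ.source := fun p hp => hs ▸ ⟨p, hp, rfl⟩
  obtain ⟨ε, hε, W, hWp, hWN, hW, hbox⟩ := exists_box hp₀ hN e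
  have hWs : W ⊆ χ.source := fun p hp => ((hW p).mp hp).1
  have hφd : ∀ x ∈ φ.source, ∃ e : Vec n ≃L[ℝ] Vec n,
      (e : Vec n →L[ℝ] Vec n) = fderiv ℝ φ x := fun x hx => by
    obtain ⟨a, ha, -⟩ := exists_continuousLinearEquiv_fderiv (hφ.differentiableOn one_ne_zero)
      (hφ'.differentiableOn one_ne_zero) hx
    exact ⟨a, ha⟩
  -- Recovers the effective part of the control from state and velocity, continuously in both.
  set β : Vec n × Vec n → R := fun ξ => R.orthogonalProjectionOnto
    (fderiv ℝ φ ξ.1 ξ.2 - Matrix.toEuclideanLin A (φ ξ.1)) with hβ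
  have hβG : ∀ p ∈ χ.source, β (p.1, f p) = (e (χ p).2).1 := by
    intro p hp
    have h1 : fderiv ℝ φ p.1 (f p) - Matrix.toEuclideanLin A (φ p.1) = (e (χ p).2).1 := by
      rw [hD p hp, linearRHS, hχφ p hp, add_sub_cancel_left, he]
    change R.orthogonalProjectionOnto _ = _
    rw [h1]
    exact Submodule.orthogonalProjectionOnto_mem_subspace_eq_self _
  have hGc : ContinuousOn (fun p : Vec n × Vec m => (p.1, f p)) W :=
    continuous_fst.continuousOn.prodMk (hfc.mono hWs)
  have hGW : ∀ ξ ∈ (fun p : Vec n × Vec m => (p.1, f p)) '' W, ξ.1 ∈ φ.source ∧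
      φ ξ.1 ∈ Metric.ball (χ p₀).1 ε ∧ β ξ ∈ Metric.ball (e (χ p₀).2).1 ε ∧
      fderiv ℝ φ ξ.1 ξ.2 = Matrix.toEuclideanLin A (φ ξ.1) + β ξ := by
    rintro _ ⟨p, hpW, rfl⟩
    obtain ⟨hp, h1, h2, h3⟩ := (hW p).mp hpW
    refine ⟨hsx p hp, ?_, ?_, ?_⟩
    · rw [← hχφ p hp]; exact h1
    · rw [hβG p hp]; exact h2
    · rw [hβG p hp, he]
      change fderiv ℝ φ p.1 (f p) = _
      rw [hD p hp, linearRHS, hχφ p hp]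
  have hst : ∀ ξ ∈ (fun p : Vec n × Vec m => (p.1, f p)) '' W,
      ∀ a ∈ Metric.ball (e (χ p₀).2).2 ε, (φ ξ.1, e.symm (β ξ, a)) ∈ χ.target := fun ξ hξ a ha =>
    hbox _ (hGW ξ hξ).2.1 _ (hGW ξ hξ).2.2.1 _ ha
  refine ⟨W, hWp, hWN, isC0Fibration_of_section hGc
    (κ := fun p => (e (χ p).2).2) ?_ hε (c := (e (χ p₀).2).2) ?_
    (s := fun z => χ.symm (φ z.1.1, e.symm (β z.1, z.2))) ?_ ?_ ?_ ?_ ?_⟩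
  · exact (continuous_snd.comp (e.continuous.comp continuous_snd)).comp_continuousOn
      (χ.continuousOn.mono hWs)
  · exact fun p hp => ((hW p).mp hp).2.2.2
  · refine χ.continuousOn_symm.comp ?_ fun z hz => hst _ hz.1 _ hz.2
    have hc1 : ContinuousOn (fun z : (Vec n × Vec n) × Vec r => φ z.1.1)
        (((fun p : Vec n × Vec m => (p.1, f p)) '' W) ×ˢ Metric.ball (e (χ p₀).2).2 ε) :=
      φ.continuousOn.comp (continuous_fst.comp continuous_fst).continuousOn
        fun z hz => (hGW _ hz.1).1
    refine hc1.prodMk (e.symm.continuous.comp_continuousOn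
      (ContinuousOn.prodMk ?_ continuous_snd.continuousOn))
    refine (R.orthogonalProjectionOnto).continuous.comp_continuousOn
      ((ContinuousOn.clm_apply ?_ (continuous_snd.comp continuous_fst).continuousOn).sub
        ((LinearMap.continuous_of_finiteDimensional _).comp_continuousOn hc1))
    exact (hφ.continuousOn_fderiv_of_isOpen φ.open_source le_rfl).comp
      (continuous_fst.comp continuous_fst).continuousOn fun z hz => (hGW _ hz.1).1
  · intro ξ hξ a ha
    rw [hW, χ.right_inv (hst ξ hξ a ha), e.apply_symm_apply]
    exact ⟨χ.map_target (hst ξ hξ a ha), (hGW ξ hξ).2.1, (hGW ξ hξ).2.2.1, ha⟩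
  · intro ξ hξ a ha
    obtain ⟨h1, h2, h3, h4⟩ := hGW ξ hξ
    have ht := hst ξ hξ a ha
    have h5 : (χ.symm (φ ξ.1, e.symm (β ξ, a))).1 = ξ.1 := by
      refine φ.injOn (hsx _ (χ.map_target ht)) h1 ?_
      rw [← hχφ _ (χ.map_target ht), χ.right_inv ht]
    refine Prod.ext h5 ?_
    obtain ⟨d, hd⟩ := hφd _ h1
    apply d.injective
    have h6 := hD _ (χ.map_target ht)
    rw [h5, χ.right_inv ht, linearRHS, ← he, e.apply_symm_apply] at h6
    have h7 : ∀ v, d v = fderiv ℝ φ ξ.1 v := fun v => by rw [← hd]; rfl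
    rw [h7, h7, h4]
    exact h6
  · intro ξ hξ a ha
    change (e (χ (χ.symm (φ ξ.1, e.symm (β ξ, a)))).2).2 = a
    rw [χ.right_inv (hst ξ hξ a ha), e.apply_symm_apply]
  · intro p hp
    change χ.symm (φ p.1, e.symm (β (p.1, f p), (e (χ p).2).2)) = p
    rw [hβG p (hWs hp), ← hχφ p (hWs hp), Prod.mk.eta, e.symm_apply_apply, Prod.mk.eta,
      χ.left_inv (hWs hp)]

/-! ### Necessity of the geometric conditions. -/

/-- The flag of a system which is conjugate to a linear one. -/
theorem flag_eq_comap_reachable {n m : ℕ} {k : WithTop ℕ∞} (hk : k = ∞ ∨ k = ω)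
    {f : Vec n × Vec m → Vec n} {A : Matrix (Fin n) (Fin n) ℝ} {B : Matrix (Fin n) (Fin m) ℝ}
    {χ : OpenPartialHomeomorph (Vec n × Vec m) (Vec n × Vec m)}
    (hf : ContDiffOn ℝ k f χ.source) {φ : OpenPartialHomeomorph (Vec n) (Vec n)}
    (hs : φ.source = Prod.fst '' χ.source)
    (hφ : ContDiffOn ℝ k φ φ.source) (hφ' : ContDiffOn ℝ k φ.symm φ.target)
    (hχφ : ∀ p ∈ χ.source, (χ p).1 = φ p.1)
    (hD : ∀ p ∈ χ.source, fderiv ℝ φ p.1 (f p) = linearRHS A B (χ p)) {X : Set (Vec n)}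
    {U : Set (Vec m)} (hX : IsOpen X) (hU : IsOpen U) (hXU : X ×ˢ U ⊆ χ.source) {u₀ : Vec m}
    (hu₀ : u₀ ∈ U) (j : ℕ) {x : Vec n} (hx : x ∈ X) :
    flag k f X U u₀ j x = (reachable A B j).comap (fderiv ℝ φ x : Vec n →ₗ[ℝ] Vec n) := by
  have hk0 : k ≠ 0 := (zero_lt_one.trans_le (one_le_of_smooth_or_analytic hk)).ne'
  have hXφ : X ⊆ φ.source := fun y hy => hs ▸ ⟨(y, u₀), hXU ⟨hy, hu₀⟩, rfl⟩
  induction j generalizing x with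
  | zero =>
    obtain ⟨e, he, -⟩ := exists_continuousLinearEquiv_fderiv (hφ.differentiableOn hk0)
      (hφ'.differentiableOn hk0) (hXφ hx)
    exact genRange_eq_comap hχφ (hs ▸ φ.injOn) hD hU hu₀ (fun w hw => hXU ⟨hx, hw⟩) e he
  | succ j ih =>
    -- The drift deviates from its linear part by `B` applied to the second component of `χ (y,
    -- u₀)`, an element of the range of `B`.
    refine addBracket_eq_comap hk hX hφ hφ' hXφ (contDiffOn_drift hf hXU hu₀)
      (range_le_reachable A B j) (fun y hy => ?_) (fun y hy => ih hy) hx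
    have hy' := hXU (mk_mem_prod hy hu₀)
    refine ⟨(χ (y, u₀)).2, ?_⟩
    change _ = fderiv ℝ φ (y, u₀).1 (f (y, u₀)) - _
    rw [hD _ hy', linearRHS, hχφ _ hy', add_sub_cancel_left]

/-- Local quasi-linearizability implies the geometric conditions. -/
theorem exists_neighborhoods_of_conjugates {n m : ℕ} {k : WithTop ℕ∞} (hk : k = ∞ ∨ k = ω)
    {f : Vec n × Vec m → Vec n} {A : Matrix (Fin n) (Fin n) ℝ} {B : Matrix (Fin n) (Fin m) ℝ}
    {χ : OpenPartialHomeomorph (Vec n × Vec m) (Vec n × Vec m)}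
    (hf : ContDiffOn ℝ k f χ.source) {Ω : Set (Vec n × Vec m)} (hχΩ : χ.source ⊆ Ω)
    {x₀ : Vec n} {u₀ : Vec m} (hp : (x₀, u₀) ∈ χ.source)
    {φ : OpenPartialHomeomorph (Vec n) (Vec n)} (hs : φ.source = Prod.fst '' χ.source)
    (hφ : ContDiffOn ℝ k φ φ.source) (hφ' : ContDiffOn ℝ k φ.symm φ.target)
    (hχφ : ∀ p ∈ χ.source, (χ p).1 = φ p.1) (hctrl : IsControllable A B)
    (hconj : Conjugates f (linearRHS A B) χ) :
    ∃ (X : Set (Vec n)) (U : Set (Vec m)), IsOpen X ∧ IsOpen U ∧ x₀ ∈ X ∧ u₀ ∈ U ∧ X ×ˢ U ⊆ Ω ∧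
      (∀ x ∈ X, ∀ u ∈ U, ∀ u' ∈ U, genRange f U x u = genRange f U x u') ∧
      ((∀ j ≤ n - 1, IsIntegrable k X (flag k f X U u₀ j)) ∧
        ∀ x ∈ X, Module.finrank ℝ (flag k f X U u₀ (n - 1) x) = n) ∧
      ∃ W ∈ 𝓝 (x₀, u₀), W ⊆ X ×ˢ U ∧
        IsC0Fibration (Vec (m - Module.finrank ℝ (flag k f X U u₀ 0 x₀)))
          (imageFactorization (fun p : Vec n × Vec m => (p.1, f p)) W) := by
  have hk1 := one_le_of_smooth_or_analytic hk
  have hk0 : k ≠ 0 := (zero_lt_one.trans_le hk1).ne'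
  have hD : ∀ p ∈ χ.source, fderiv ℝ φ p.1 (f p) = linearRHS A B (χ p) := fun p hp =>
    fderiv_eq_of_conjugates hf.continuousOn hconj hχφ hp
      ((hφ.contDiffAt (φ.open_source.mem_nhds (hs ▸ ⟨p, hp, rfl⟩))).differentiableAt hk0)
  obtain ⟨X, U, hX, hx₀, hU, hu₀, hXU⟩ :=
    mem_nhds_prod_iff'.mp (χ.open_source.mem_nhds hp)
  have hXφ : X ⊆ φ.source := fun y hy => hs ▸ ⟨(y, u₀), hXU ⟨hy, hu₀⟩, rfl⟩
  have hφe : ∀ x ∈ X, ∃ e : Vec n ≃L[ℝ] Vec n, (e : Vec n →L[ℝ] Vec n) = fderiv ℝ φ x := by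
    intro x hx
    obtain ⟨e, he, -⟩ := exists_continuousLinearEquiv_fderiv (hφ.differentiableOn hk0)
      (hφ'.differentiableOn hk0) (hXφ hx)
    exact ⟨e, he⟩
  have hflag : ∀ j, ∀ x ∈ X, flag k f X U u₀ j x =
      (reachable A B j).comap (fderiv ℝ φ x : Vec n →ₗ[ℝ] Vec n) := fun j x hx =>
    flag_eq_comap_reachable hk hf hs hφ hφ' hχφ hD hX hU hXU hu₀ j hx
  have hgen : ∀ x ∈ X, ∀ u ∈ U, genRange f U x u =
      (LinearMap.range (Matrix.toEuclideanLin B)).comap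
        (fderiv ℝ φ x : Vec n →ₗ[ℝ] Vec n) := by
    intro x hx u hu
    obtain ⟨e, he⟩ := hφe x hx
    exact genRange_eq_comap hχφ (hs ▸ φ.injOn) hD hU hu (fun w hw => hXU ⟨hx, hw⟩) e he
  -- The resulting fiber has dimension `m` minus the rank of `B`, which is the rank of the first
  -- distribution because `φ'` is an isomorphism.
  obtain ⟨e, he⟩ := exists_equiv_range_prod (Matrix.toEuclideanLin B)
  obtain ⟨W, hW, hWXU, hfib⟩ := exists_isC0Fibration_of_conjugates hs (hφ.of_le hk1)
    (hφ'.of_le hk1) hf.continuousOn hχφ hD hp ((hX.prod hU).mem_nhds ⟨hx₀, hu₀⟩) e he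
  refine ⟨X, U, hX, hU, hx₀, hu₀, hXU.trans hχΩ, fun x hx u hu u' hu' => ?_,
    ⟨fun j _ => isIntegrable_of_eq_comap hk (hφ.mono hXφ) hφe (hflag j), fun x hx => ?_⟩,
    W, hW, hWXU, ?_⟩
  · rw [hgen x hx u hu, hgen x hx u' hu']
  · rw [hflag _ x hx, reachable_eq_top hctrl, Submodule.comap_top, finrank_top]
    simp
  · obtain ⟨a, ha⟩ := hφe x₀ hx₀
    rw [hflag 0 x₀ hx₀, finrank_comap_fderiv a ha]
    exact hfib

end ControlSys

end

/-! ### The equivalence. -/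

theorem theorem5p7 (n m : ℕ) (k : WithTop ℕ∞) (hk : k = ∞ ∨ k = ω)
    (f : ControlSys.Vec n × ControlSys.Vec m → ControlSys.Vec n)
    (Ω : Set (ControlSys.Vec n × ControlSys.Vec m)) (hΩ : IsOpen Ω)
    (hf : ContDiffOn ℝ k f Ω)
    (x₀ : ControlSys.Vec n) (u₀ : ControlSys.Vec m) (hp : (x₀, u₀) ∈ Ω) :
    ControlSys.LocallyQuasiLinearizableAt k f Ω (x₀, u₀) ↔
      ∃ (X : Set (ControlSys.Vec n)) (U : Set (ControlSys.Vec m)),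
        IsOpen X ∧ IsOpen U ∧ x₀ ∈ X ∧ u₀ ∈ U ∧ X ×ˢ U ⊆ Ω ∧
        -- the generalized range does not depend on the control
        (∀ x ∈ X, ∀ u ∈ U, ∀ u' ∈ U,
          ControlSys.genRange f U x u = ControlSys.genRange f U x u') ∧
        -- the flag is made of integrable distributions, the last one of rank `n`
        ((∀ j ≤ n - 1, ControlSys.IsIntegrable k X (ControlSys.flag k f X U u₀ j)) ∧
          ∀ x ∈ X, Module.finrank ℝ (ControlSys.flag k f X U u₀ (n - 1) x) = n) ∧
        -- `(x, u) ↦ (x, f (x, u))` restricts to a fibration around `(x₀, u₀)`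
        (∃ W ∈ 𝓝 (x₀, u₀), W ⊆ X ×ˢ U ∧
          ControlSys.IsC0Fibration
            (ControlSys.Vec (m - Module.finrank ℝ (ControlSys.flag k f X U u₀ 0 x₀)))
            (Set.imageFactorization
              (fun p : ControlSys.Vec n × ControlSys.Vec m => (p.1, f p)) W)) := by
  constructor
  · rintro ⟨A, B, hctrl, χ, hpχ, hχΩ, ⟨φ, hs, -, hφ, hφ', hχφ⟩, hconj⟩
    exact ControlSys.exists_neighborhoods_of_conjugates hk (hf.mono hχΩ) hχΩ hpχ hs hφ hφ' hχφ
      hctrl hconj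
  · rintro ⟨X, U, hX, hU, hx₀, hu₀, hXU, hD, ⟨hint, hrank⟩, W, hW, hWXU, hfib⟩
    exact ControlSys.locallyQuasiLinearizableAt_of_isIntegrable hk hΩ hf hX hU hx₀ hu₀ hXU hD
      hint hrank hW hWXU hfib
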